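/- Let $N\ge 2$. All fields are real-valued, $G_t(x)=(4\pi t)^{-N/2}e^{-|x|^2/(4t)}$, and $e^{t\Delta}\varphi=G_t*\varphi$ for a tempered distribution $\varphi\in(\mathcal S'(\mathbb R^N))^N$ and $t>0$. For $S>0$ let $$\|\varphi\|_{(S)}=\sup_{0<t<S}\sqrt t\,\Big|\ln\frac{t}{e^2S}\Big|\,\|e^{t\Delta}\varphi\|_{L^\infty},$$ and let $B^{-1(\ln)}_{\infty\infty}$ be the space of all $\varphi\in(\mathcal S'(\mathbb R^N))^N$ with $e^{t\Delta}\varphi\in L^\infty$ for all $t>0$ and $\|\varphi\|_{(S)}<\infty$ (neither the space nor its topology depends on $S$). Let $\mathcal C^{-1(\ln)}_{bu}$ be the closure in $B^{-1(\ln)}_{\infty\infty}$ of the bounded uniformly continuous functions. Let $\mathbb P$ be the Helmholtz–Weyl projection, with matrix symbol $\delta_{ij}-\xi_i\xi_j/|\xi|^2$. A mild solution on $[0,T]$ of the Navier–Stokes problem with initial value $u_0$ is a path $u$ with $u(0)=u_0$ and $$u(t)=e^{t\Delta}u_0-\int_0^t e^{(t-\tau)\Delta}\,\mathbb P\nabla\cdot\big(u(\tau)\otimes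 u(\tau)\big)\,d\tau\qquad(0<t\le T).$$ Let $\mathscr Y^0_T$ be the space of all $u\in C([0,T],\mathcal C^{-1(\ln)}_{bu})\cap L^\infty_{\rm loc}((0,T),L^\infty(\mathbb R^N))$ with $\nabla\cdot u=0$, $$\|u\|_{\mathscr X_T}=\sup_{0<t<T}\sqrt t\,\Big|\ln\frac{t}{e^2T}\Big|\,\|u(t)\|_{\infty}<\infty,\qquad \lim_{t\to0^+}\sqrt t\,\Big|\ln\frac{t}{e^2T}\Big|\,\|u(t)\|_{\infty}=0,$$ with the norm $\sup_{0\le t\le T}\|u(t)\|_{(S)}+\|u\|_{\mathscr X_T}$. Fix any $S>0$; balls in $\mathcal C^{-1(\ln)}_{bu}$ are taken with respect to $\|\cdot\|_{(S)}$. **Theorem.** (i) (Local well-posedness.) For every $u_0\in\mathcal C^{-1(\ln)}_{bu}$ with $\nabla\cdot u_0=0$ there is $T>0$ such that there is exactly one mild solution on $[0,T]$ with initial value $u_0$ in the class $\mathscr Y^0_T$. Moreover, there is $\varepsilon>0$ such that for each of the two closed balls $\overline B(0,\varepsilon)$ and $\overline B(u_0,\varepsilon)$ in $\mathcal C^{-1(\ln)}_{bu}$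 the following holds: every divergence-free $v_0$ in the ball has exactly one mild solution $v\in\mathscr Y^0_T$ on $[0,T]$, and the map $v_0\mapsto v$ from the divergence-free elements of the ball to $\mathscr Y_T^0$ is Lipschitz continuous. (ii) (Semi-global well-posedness for small data.) For every $T>0$ there is $\varepsilon>0$ such that every $u_0\in\mathcal C^{-1(\ln)}_{bu}$ with $\nabla\cdot u_0=0$ and $\|u_0\|_{(S)}\le\varepsilon$ has exactly one mild solution $u\in\mathscr Y^0_T$ on $[0,T]$, and the map $u_0\mapsto u$ from the divergence-free elements of $\overline B(0,\varepsilon)\subseteq\mathcal C^{-1(\ln)}_{bu}$ to $\mathscr Y_T^0$ is Lipschitz continuous. -/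

import Mathlib

open MeasureTheory Set Filter Topology
open scoped ENNReal NNReal SchwartzMap FourierTransform LineDeriv

namespace NSLog

noncomputable section

/-- The Euclidean space `ℝ^N`; it serves both as the physical space and as the space of values
of velocity fields. -/
abbrev Vec (N : ℕ) : Type := EuclideanSpace ℝ (Fin N)

/-- The space `(𝓢'(ℝ^N))^N` of real `N`-vector valued tempered distributions: continuous linear
maps from the real Schwartz space to `ℝ^N`. -/
abbrev TDist (N : ℕ) : Type := 𝓢(Vec N, ℝ) →L[ℝ] Vec N

theorem pow_mul_exp_bounded {a : ℝ} (ha : 0 < a) (m : ℕ) :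
    ∃ C : ℝ, ∀ r : ℝ, 0 ≤ r → (1 + r) ^ m * Real.exp (-(a * r ^ 2)) ≤ C := by
  have hc : ∀ r : ℝ, 0 ≤ r →
      (1 + r) ^ m * Real.exp (-(a * r ^ 2)) ≤
        (m.factorial : ℝ) * Real.exp (1 + 1 / (4 * a)) := by
    intro r hr
    have h1 : (1 + r) ^ m ≤ (m.factorial : ℝ) * Real.exp (1 + r) := by
      have h := Real.pow_div_factorial_le_exp (1 + r) (by linarith) m
      rw [div_le_iff₀ (by positivity)] at h
      linarith
    calc (1 + r) ^ m * Real.exp (-(a * r ^ 2))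
        ≤ (m.factorial : ℝ) * Real.exp (1 + r) * Real.exp (-(a * r ^ 2)) := by gcongr
      _ = (m.factorial : ℝ) * Real.exp (1 + r + -(a * r ^ 2)) := by
          rw [mul_assoc, ← Real.exp_add]
      _ ≤ (m.factorial : ℝ) * Real.exp (1 + 1 / (4 * a)) := by
          refine mul_le_mul_of_nonneg_left (Real.exp_le_exp.mpr ?_) (by positivity)
          have h2 : 1 / (4 * a) - r + a * r ^ 2 = a * (r - 1 / (2 * a)) ^ 2 := by
            field_simp
            ring
          have h3 : 0 ≤ a * (r - 1 / (2 * a)) ^ 2 := by positivity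
          linarith
  exact ⟨_, hc⟩

theorem gaussian_decay {N : ℕ} {a : ℝ} (ha : 0 < a) (k n : ℕ) :
    ∃ C : ℝ, ∀ x : Vec N,
      ‖x‖ ^ k * ‖iteratedFDeriv ℝ n (fun y : Vec N => Real.exp (-(a * ‖y‖ ^ 2))) x‖ ≤ C := by
  have hf : (fun y : Vec N => -(a * ‖y‖ ^ 2)).HasTemperateGrowth :=
    ((Function.HasTemperateGrowth.const a).mul
      (Function.hasTemperateGrowth_norm_sq (H := Vec N))).neg
  obtain ⟨p, C, hC, hb⟩ := hf.norm_iteratedFDeriv_le_uniform n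
  obtain ⟨M, hM⟩ := pow_mul_exp_bounded ha (k + p * n)
  refine ⟨n.factorial * (C + 1) ^ n * M, fun x => ?_⟩
  have hx : (1 : ℝ) ≤ 1 + ‖x‖ := by linarith [norm_nonneg x]
  have hD1 : (1 : ℝ) ≤ (C + 1) * (1 + ‖x‖) ^ p :=
    one_le_mul_of_one_le_of_one_le (by linarith) (one_le_pow₀ hx)
  have key := norm_iteratedFDeriv_comp_le (𝕜 := ℝ) (g := Real.exp)
    (f := fun y : Vec N => -(a * ‖y‖ ^ 2)) (N := (⊤ : ℕ∞)) (n := n) (by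
      exact Real.contDiff_exp) hf.1 (by exact_mod_cast le_top) x
    (C := Real.exp (-(a * ‖x‖ ^ 2))) (D := (C + 1) * (1 + ‖x‖) ^ p)
    (by
      intro i _
      rw [norm_iteratedFDeriv_eq_norm_iteratedDeriv, iteratedDeriv_eq_iterate,
        Real.iter_deriv_exp, Real.norm_eq_abs, abs_of_pos (Real.exp_pos _)])
    (by
      intro i hi1 hin
      calc _ ≤ C * (1 + ‖x‖) ^ p := hb i hin x
        _ ≤ (C + 1) * (1 + ‖x‖) ^ p := by gcongr; linarith
        _ ≤ ((C + 1) * (1 + ‖x‖) ^ p) ^ i := le_self_pow₀ hD1 (by omega))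
  calc ‖x‖ ^ k * ‖iteratedFDeriv ℝ n (fun y : Vec N => Real.exp (-(a * ‖y‖ ^ 2))) x‖
      ≤ (1 + ‖x‖) ^ k * (n.factorial * Real.exp (-(a * ‖x‖ ^ 2)) *
          ((C + 1) * (1 + ‖x‖) ^ p) ^ n) := by
        gcongr
        · linarith
        · exact key
    _ = n.factorial * (C + 1) ^ n *
          ((1 + ‖x‖) ^ (k + p * n) * Real.exp (-(a * ‖x‖ ^ 2))) := by
        rw [mul_pow, ← pow_mul, pow_add]; ring
    _ ≤ n.factorial * (C + 1) ^ n * M := by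
        gcongr
        exact hM _ (norm_nonneg x)

/-- The Gaussian `y ↦ exp (-a |y|²)`, `a > 0`, as a Schwartz function. -/
def gaussian (N : ℕ) (a : ℝ) (ha : 0 < a) : 𝓢(Vec N, ℝ) where
  toFun y := Real.exp (-(a * ‖y‖ ^ 2))
  smooth' := by
    refine Real.contDiff_exp.comp ?_
    exact (contDiff_const.mul (contDiff_norm_sq ℝ)).neg
  decay' k n := gaussian_decay ha k n

/-- The heat kernel `G_t(y) = (4πt)^{-N/2} exp (-|y|²/(4t))`, `t > 0`, as a Schwartz function. -/
def heatKernel (N : ℕ) (t : ℝ) (ht : 0 < t) : 𝓢(Vec N, ℝ) :=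
  ((4 * Real.pi * t) ^ (-(N : ℝ) / 2)) • gaussian N (1 / (4 * t)) (by positivity)

/-- The function `e^{tΔ}φ = G_t * φ` for a tempered distribution `φ` and `t > 0`, that is,
`x ↦ ⟨φ, G_t(· - x)⟩` (recall that `G_t` is even). The value for `t ≤ 0` is irrelevant. -/
def heat {N : ℕ} (t : ℝ) (φ : TDist N) (x : Vec N) : Vec N :=
  if ht : 0 < t then φ (SchwartzMap.compSubConstCLM ℝ x (heatKernel N t ht)) else 0

/-- The (class of the) function `f` belongs to `L^∞` and `φ` is the distribution given by `f`. -/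
def IsBoundedRep {N : ℕ} (φ : TDist N) (f : Vec N → Vec N) : Prop :=
  MemLp f ∞ volume ∧ ∀ ψ : 𝓢(Vec N, ℝ), φ ψ = ∫ x, ψ x • f x

/-- The `L^∞` norm of a distribution; it is `∞` when the distribution is not given by an
`L^∞` function (infimum over the empty family). -/
def linftyNorm {N : ℕ} (φ : TDist N) : ℝ≥0∞ :=
  ⨅ (f : Vec N → Vec N) (_ : IsBoundedRep φ f), eLpNorm f ∞ volume

/-- The divergence-free condition `∇ · φ = 0` in the sense of distributions. -/
def DivFree {N : ℕ} (φ : TDist N) : Prop :=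
  ∀ ψ : 𝓢(Vec N, ℝ), ∑ i : Fin N, (φ (∂_{EuclideanSpace.single i (1 : ℝ)} ψ)) i = 0

/-- The weight `√t |ln (t / (e² T))|`. -/
def weight (T t : ℝ) : ℝ := √t * |Real.log (t / (Real.exp 2 * T))|

/-- The norm `sup_{0 < t < S} √t |ln (t / (e² S))| ‖e^{tΔ}φ‖_∞` of `B^{-1(ln)}_{∞∞}` with
reference time `S`. -/
def logNorm {N : ℕ} (S : ℝ) (φ : TDist N) : ℝ≥0∞ :=
  ⨆ t ∈ Ioo (0 : ℝ) S, ENNReal.ofReal (weight S t) * eLpNorm (heat t φ) ∞ volume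

/-- Membership in `B^{-1(ln)}_{∞∞}`. -/
def MemB {N : ℕ} (S : ℝ) (φ : TDist N) : Prop :=
  (∀ t : ℝ, 0 < t → MemLp (heat t φ) ∞ volume) ∧ logNorm S φ < ∞

/-- Membership in `C_bu^{-1(ln)}`, the closure of the bounded uniformly continuous functions in
`B^{-1(ln)}_{∞∞}`. -/
def MemC {N : ℕ} (S : ℝ) (φ : TDist N) : Prop :=
  MemB S φ ∧ ∀ ε : ℝ≥0∞, 0 < ε → ∃ (g : Vec N → Vec N) (γ : TDist N),
    UniformContinuous g ∧ (∃ M : ℝ, ∀ x, ‖g x‖ ≤ M) ∧ IsBoundedRep γ g ∧ logNorm S (φ - γ) < ε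

/-- The Fourier symbol of the `(i,j,k)` entry of `e^{sΔ} ℙ ∂_k`, where `ℙ` has the matrix symbol
`δ_ij - ξ_i ξ_j / |ξ|²`. Mathlib's Fourier transform uses the character `e^{2πi x·ξ}`, so `∂_k`
has the symbol `2πi ξ_k` and `e^{sΔ}` the symbol `exp (-4π² s |ξ|²)`. -/
def oseenSymbol {N : ℕ} (s : ℝ) (i j k : Fin N) (ξ : Vec N) : ℂ :=
  2 * Real.pi * Complex.I * (ξ k : ℂ) *
    (((if i = j then 1 else 0) - ξ i * ξ j / ‖ξ‖ ^ 2 : ℝ) : ℂ) *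
    (Real.exp (-(4 * Real.pi ^ 2 * s * ‖ξ‖ ^ 2)) : ℂ)

/-- The convolution kernel of the `(i,j,k)` entry of `e^{sΔ} ℙ ∂_k`, `s > 0`: the inverse Fourier
transform of its (integrable) symbol, which is a real function. -/
def oseenKernel {N : ℕ} (s : ℝ) (i j k : Fin N) (x : Vec N) : ℝ :=
  ((𝓕⁻ (oseenSymbol s i j k) : Vec N → ℂ) x).re

/-- `e^{sΔ} ℙ ∇ · F` for a bounded matrix field `F`, `s > 0`:
its `i`-th component is `∑_{j,k} (e^{sΔ} ℙ ∂_k)_{ij} F_{jk}`. -/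
def heatLerayDiv {N : ℕ} (s : ℝ) (F : Vec N → Matrix (Fin N) (Fin N) ℝ) (x : Vec N) : Vec N :=
  WithLp.toLp 2 fun i => ∑ j, ∑ k, ∫ y, oseenKernel s i j k (x - y) * F y j k

/-- The tensor product `u ⊗ v` of two vector fields. -/
def tensor {N : ℕ} (u v : Vec N → Vec N) (y : Vec N) : Matrix (Fin N) (Fin N) ℝ :=
  fun j k => u y j * v y k

/-- `B(u,v)(t) = ∫_0^t e^{(t-τ)Δ} ℙ ∇ · (u(τ) ⊗ v(τ)) dτ`. -/
def duhamel {N : ℕ} (u v : ℝ → Vec N → Vec N) (t : ℝ) (x : Vec N) : Vec N :=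
  ∫ τ in Ioo 0 t, heatLerayDiv (t - τ) (tensor (u τ) (v τ)) x

/-- `‖U‖_{X_T} = sup_{0 < t < T} √t |ln (t / (e² T))| ‖U(t)‖_∞`. -/
def pathNorm {N : ℕ} (T : ℝ) (U : ℝ → TDist N) : ℝ≥0∞ :=
  ⨆ t ∈ Ioo (0 : ℝ) T, ENNReal.ofReal (weight T t) * linftyNorm (U t)

/-- The norm of the space
`C([0,T], C_bu^{-1(ln)}) ∩ {‖·‖_{X_T} < ∞}` of paths. -/
def solNorm {N : ℕ} (S T : ℝ) (U : ℝ → TDist N) : ℝ≥0∞ :=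
  (⨆ t ∈ Icc (0 : ℝ) T, logNorm S (U t)) + pathNorm T U

/-- The solution class on `[0,T]`. Only the values `U t` with `0 ≤ t ≤ T` matter. Finiteness
of `pathNorm T U` contains the bound of `‖U(t)‖_∞` on every compact subinterval of `(0,T)`. -/
structure InClass {N : ℕ} (S T : ℝ) (U : ℝ → TDist N) : Prop where
  mem : ∀ t ∈ Icc (0 : ℝ) T, MemC S (U t)
  cont : ∀ t₀ ∈ Icc (0 : ℝ) T,
    Tendsto (fun t => logNorm S (U t - U t₀)) (𝓝[Icc (0 : ℝ) T] t₀) (𝓝 0)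
  div_free : ∀ t ∈ Icc (0 : ℝ) T, DivFree (U t)
  bounded : pathNorm T U < ∞
  tendsto_zero :
    Tendsto (fun t => ENNReal.ofReal (weight T t) * linftyNorm (U t)) (𝓝[>] (0 : ℝ)) (𝓝 0)

/-- `U` is a mild solution on `[0,T]` with initial value `u₀`: it solves
`U(t) = e^{tΔ} u₀ - B(U,U)(t)` for `0 < t ≤ T` and `U(0) = u₀`. Here `u` is a jointly measurable
function on `(0,T) × ℝ^N` that represents `U`. -/
def IsMild {N : ℕ} (T : ℝ) (u₀ : TDist N) (U : ℝ → TDist N) : Prop :=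
  U 0 = u₀ ∧ ∃ u : ℝ → Vec N → Vec N,
    AEStronglyMeasurable (fun p : ℝ × Vec N => u p.1 p.2)
      ((volume.restrict (Ioo (0 : ℝ) T)).prod volume) ∧
    (∀ t ∈ Ioo (0 : ℝ) T, IsBoundedRep (U t) (u t)) ∧
    ∀ t ∈ Ioc (0 : ℝ) T, IsBoundedRep (U t) (fun x => heat t u₀ x - duhamel u u t x)

/-- `U` is a mild solution on `[0,T]` with initial value `u₀` in the solution class. -/
def IsSolution {N : ℕ} (S T : ℝ) (u₀ : TDist N) (U : ℝ → TDist N) : Prop :=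
  InClass S T U ∧ IsMild T u₀ U

/-- There is exactly one solution on `[0,T]` with initial value `u₀`. -/
def UniquelySolvable {N : ℕ} (S T : ℝ) (u₀ : TDist N) : Prop :=
  ∃ U : ℝ → TDist N, IsSolution S T u₀ U ∧
    ∀ V : ℝ → TDist N, IsSolution S T u₀ V → EqOn V U (Icc 0 T)

/-- Divergence-free elements of the closed ball of radius `ε` about `c` in `C_bu^{-1(ln)}`. -/
def dataBall {N : ℕ} (S : ℝ) (c : TDist N) (ε : ℝ) : Set (TDist N) :=
  {v | MemC S v ∧ DivFree v ∧ logNorm S (v - c) ≤ ENNReal.ofReal ε}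

/-- Every datum in `A` has exactly one solution on `[0,T]` and the solution map is Lipschitz
continuous on `A`. -/
def LipschitzSolvableOn {N : ℕ} (S T : ℝ) (A : Set (TDist N)) : Prop :=
  (∀ v ∈ A, UniquelySolvable S T v) ∧
  ∃ L : ℝ≥0, ∀ v ∈ A, ∀ w ∈ A, ∀ V W : ℝ → TDist N, IsSolution S T v V → IsSolution S T w W →
    solNorm S T (fun t => V t - W t) ≤ L * logNorm S (v - w)

end

end NSLog

namespace NSLog

noncomputable section


/-! The logarithm makes the quadratic term integrable at time zero. With `w_T(t) = √t (2 + ln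
(T/t))` and `w_T ‖u‖_∞ ≤ A`, the field `u ⊗ u` is of size `A² / w_T²`, and `1 / w_T(τ)² = 1 / (τ (2
+ ln (T/τ))²)` is the exact derivative of `1 / (2 + ln (T/τ))`, which vanishes at `0`; without the
logarithm the size would be the non-integrable `1/τ`.

The kernel of `e^{sΔ} ℙ ∂_k` has `L¹` norm of order `s^{-1/2}`
(`integrable_fourierInv_oseenSymbol`), and `∫_0^t (t-τ)^{-1/2} w_T(τ)^{-2} dτ ≤ 4 / w_T(t)`
(`integral_inv_sqrt_mul_gw`). So the bilinear term `B` is bounded for the weighted norm with a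
constant independent of `T`, and Picard iteration converges once the weighted heat flow of the datum
is small (`exists_solves`). A second integral estimate (`weight_mul_integral_le`) controls `B` in
the Besov norm.

Smallness has two sources. If the datum is small in the Besov norm, its heat flow is small on any
`(0,T)`, since reference times may be exchanged at the price of a constant (`wBound_extend`). If it
merely lies in the closure of the bounded uniformly continuous functions, its weighted heat flow
tends to zero at `t = 0` (`MemC.wBound_small`), so a short time suffices. The same density argument
gives strong continuity at `t = 0` (`MemC.tendsto_shift`).

Uniqueness needs no smallness of the data: two solutions in the class are small near `0`, where
contraction applies, and away from `0` the weight is harmless and equality propagates in steps of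
fixed length (`Solves.unique`).

All estimates concern pointwise defined, jointly measurable functions. `IsSolution.exists_solves`
turns a distributional solution into such a function and `exists_isSolution_of_solves` goes back. -/

/-! ### The Gaussian kernel -/

/-- The heat kernel as a plain function of time and space. -/
def gk {N : ℕ} (t : ℝ) (x : Vec N) : ℝ :=
  (4 * Real.pi * t) ^ (-(N : ℝ) / 2) * Real.exp (-(1 / (4 * t) * ‖x‖ ^ 2))

theorem heatKernel_apply {N : ℕ} {t : ℝ} (ht : 0 < t) (x : Vec N) :
    heatKernel N t ht x = gk t x := rfl

theorem gk_nonneg {N : ℕ} {t : ℝ} (ht : 0 < t) (x : Vec N) : 0 ≤ gk t x := by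
  unfold gk; positivity

theorem gk_neg {N : ℕ} (t : ℝ) (x : Vec N) : gk t (-x) = gk t x := by
  unfold gk; rw [norm_neg]

theorem gk_sub_comm {N : ℕ} (t : ℝ) (x y : Vec N) : gk t (x - y) = gk t (y - x) := by
  rw [← gk_neg, neg_sub]

theorem continuous_gk {N : ℕ} (t : ℝ) : Continuous (gk t : Vec N → ℝ) := by
  unfold gk; fun_prop

theorem measurable_gk {N : ℕ} : Measurable (fun p : ℝ × Vec N => gk p.1 p.2) := by
  unfold gk; fun_prop

theorem integrable_gk {N : ℕ} {t : ℝ} (ht : 0 < t) : Integrable (gk t : Vec N → ℝ) :=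
  (heatKernel N t ht).integrable

theorem integral_gk_mul_char {N : ℕ} {t : ℝ} (ht : 0 < t) (ξ : Vec N) :
    ∫ y : Vec N, (gk t y : ℂ) * Complex.exp (-(2 * Real.pi * Complex.I * inner ℝ ξ y)) =
      (Real.exp (-(4 * Real.pi ^ 2 * t * ‖ξ‖ ^ 2)) : ℂ) := by
  have hb : 0 < ((1 / (4 * t) : ℝ) : ℂ).re := by
    rw [Complex.ofReal_re]; positivity
  have key := GaussianFourier.integral_cexp_neg_mul_sq_norm_add hb (-(2 * Real.pi * Complex.I)) ξ
  have h1 : ∀ y : Vec N, (gk t y : ℂ) * Complex.exp (-(2 * Real.pi * Complex.I * inner ℝ ξ y)) =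
      (((4 * Real.pi * t) ^ (-(N : ℝ) / 2) : ℝ) : ℂ) * Complex.exp
        (-((1 / (4 * t) : ℝ) : ℂ) * ‖y‖ ^ 2 + -(2 * Real.pi * Complex.I) * inner ℝ ξ y) := by
    intro y
    rw [Complex.exp_add, gk]
    push_cast
    ring_nf
  simp_rw [h1]
  rw [integral_const_mul, key, ← mul_assoc]
  have h2 : (((4 * Real.pi * t) ^ (-(N : ℝ) / 2) : ℝ) : ℂ) *
      ((Real.pi : ℂ) / ((1 / (4 * t) : ℝ) : ℂ)) ^ ((Module.finrank ℝ (Vec N) : ℂ) / 2) = 1 := by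
    have h3 : ((Real.pi : ℂ) / ((1 / (4 * t) : ℝ) : ℂ)) = ((4 * Real.pi * t : ℝ) : ℂ) := by
      push_cast; field_simp
    have h4 : ((Module.finrank ℝ (Vec N) : ℂ) / 2) = (((N : ℝ) / 2 : ℝ) : ℂ) := by
      rw [finrank_euclideanSpace_fin]; push_cast; rfl
    rw [h3, h4, ← Complex.ofReal_cpow (by positivity), ← Complex.ofReal_mul,
      ← Real.rpow_add (by positivity)]
    rw [show -(N : ℝ) / 2 + N / 2 = 0 by ring]
    simp
  rw [h2, one_mul, Complex.ofReal_exp]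
  congr 1
  have hI := Complex.I_sq
  push_cast
  field_simp
  linear_combination (4 * t * (‖ξ‖ : ℂ) ^ 2) * hI

theorem integral_gk {N : ℕ} {t : ℝ} (ht : 0 < t) : ∫ y : Vec N, gk t y = 1 := by
  have h := integral_gk_mul_char ht (0 : Vec N)
  simp only [inner_zero_left, Complex.ofReal_zero, mul_zero, neg_zero, Complex.exp_zero, mul_one,
    norm_zero, ne_eq, OfNat.ofNat_ne_zero, not_false_eq_true, zero_pow, Real.exp_zero,
    Complex.ofReal_one] at h
  rw [integral_complex_ofReal] at h
  exact_mod_cast h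

theorem norm_char {N : ℕ} (ξ y : Vec N) :
    ‖Complex.exp (2 * Real.pi * Complex.I * inner ℝ ξ y)‖ = 1 := by
  rw [show (2 * Real.pi * Complex.I * inner ℝ ξ y : ℂ) =
    ((2 * Real.pi * inner ℝ ξ y : ℝ) : ℂ) * Complex.I by push_cast; ring]
  exact Complex.norm_exp_ofReal_mul_I _

theorem fourierInv_eq_integral {N : ℕ} (m : Vec N → ℂ) (x : Vec N) :
    𝓕⁻ m x = ∫ ξ, Complex.exp (2 * Real.pi * Complex.I * inner ℝ ξ x) * m ξ := by
  rw [Real.fourierInv_eq']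
  congr 1; ext ξ
  rw [smul_eq_mul]; congr 2; push_cast; ring

/-- Fubini, since the Gaussian factor is the Fourier transform of `gk r`. The symbol is arbitrary
because this serves both the semigroup law of `gk` and the action of the heat flow on the Oseen
kernel. -/
theorem gk_conv_fourierInv {N : ℕ} {r : ℝ} (hr : 0 < r) {m : Vec N → ℂ} (hm : Integrable m)
    (x : Vec N) :
    ∫ y, (gk r (x - y) : ℂ) * 𝓕⁻ m y =
      𝓕⁻ (fun ξ => (Real.exp (-(4 * Real.pi ^ 2 * r * ‖ξ‖ ^ 2)) : ℂ) * m ξ) x := by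
  rw [← integral_sub_left_eq_self _ volume x]
  simp only [sub_sub_cancel]
  simp_rw [fourierInv_eq_integral, ← integral_const_mul]
  rw [integral_integral_swap]
  · congr 1; ext ξ
    rw [← integral_gk_mul_char hr ξ]
    have : ∀ y : Vec N, (gk r y : ℂ) *
        (Complex.exp (2 * Real.pi * Complex.I * inner ℝ ξ (x - y)) * m ξ) =
        ((gk r y : ℂ) * Complex.exp (-(2 * Real.pi * Complex.I * inner ℝ ξ y))) *
        (Complex.exp (2 * Real.pi * Complex.I * inner ℝ ξ x) * m ξ) := by
      intro y
      rw [inner_sub_right]; push_cast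
      rw [mul_sub, sub_eq_add_neg, Complex.exp_add]; ring
    simp_rw [this]
    rw [integral_mul_const]; ring
  · have h1 : Integrable (fun p : Vec N × Vec N => (gk r p.1 : ℂ) * m p.2)
        (volume.prod volume) := (integrable_gk hr).ofReal.mul_prod hm
    have h2 : Function.uncurry (fun (y ξ : Vec N) => (gk r y : ℂ) *
        (Complex.exp (2 * Real.pi * Complex.I * inner ℝ ξ (x - y)) * m ξ)) =
        fun p : Vec N × Vec N => Complex.exp (2 * Real.pi * Complex.I * inner ℝ p.2 (x - p.1)) *
          ((gk r p.1 : ℂ) * m p.2) := by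
      ext p; simp only [Function.uncurry]; ring
    rw [h2]
    refine h1.bdd_mul (c := 1) (Continuous.aestronglyMeasurable (by fun_prop)) ?_
    exact Eventually.of_forall fun p => (norm_char _ _).le

theorem integrable_gaussSymbol {N : ℕ} {t : ℝ} (ht : 0 < t) :
    Integrable (fun ξ : Vec N => (Real.exp (-(4 * Real.pi ^ 2 * t * ‖ξ‖ ^ 2)) : ℂ)) :=
  ((gaussian N (4 * Real.pi ^ 2 * t) (by positivity)).integrable (μ := volume)).ofReal

theorem gk_eq_fourierInv {N : ℕ} {t : ℝ} (ht : 0 < t) (x : Vec N) :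
    (gk t x : ℂ) = 𝓕⁻ (fun ξ : Vec N => (Real.exp (-(4 * Real.pi ^ 2 * t * ‖ξ‖ ^ 2)) : ℂ)) x := by
  have hF : 𝓕 (fun y : Vec N => (gk t y : ℂ)) =
      fun ξ : Vec N => (Real.exp (-(4 * Real.pi ^ 2 * t * ‖ξ‖ ^ 2)) : ℂ) := by
    ext ξ
    rw [Real.fourier_eq', ← integral_gk_mul_char ht ξ]
    congr 1; ext y
    rw [smul_eq_mul, mul_comm, real_inner_comm]; congr 2; push_cast; ring
  have hc : Continuous (fun y : Vec N => (gk t y : ℂ)) :=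
    Complex.continuous_ofReal.comp (continuous_gk t)
  rw [← hF, hc.fourierInv_fourier_eq (integrable_gk ht).ofReal]
  rw [hF]; exact integrable_gaussSymbol ht

theorem gk_conv_gk {N : ℕ} {r s : ℝ} (hr : 0 < r) (hs : 0 < s) (x : Vec N) :
    ∫ y, gk r (x - y) * gk s y = gk (r + s) x := by
  have h := gk_conv_fourierInv hr (integrable_gaussSymbol (N := N) hs) x
  simp_rw [← gk_eq_fourierInv hs] at h
  have h2 : (fun ξ : Vec N => (Real.exp (-(4 * Real.pi ^ 2 * r * ‖ξ‖ ^ 2)) : ℂ) *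
      (Real.exp (-(4 * Real.pi ^ 2 * s * ‖ξ‖ ^ 2)) : ℂ)) =
      fun ξ : Vec N => (Real.exp (-(4 * Real.pi ^ 2 * (r + s) * ‖ξ‖ ^ 2)) : ℂ) := by
    ext ξ
    rw [← Complex.ofReal_mul, ← Real.exp_add]; congr 3; ring
  rw [h2, ← gk_eq_fourierInv (by positivity)] at h
  simp_rw [← Complex.ofReal_mul] at h
  rw [integral_complex_ofReal] at h
  exact_mod_cast h

/-! ### `L¹` continuity of the Gaussian kernel -/

/-- Dominated convergence: for `t₀/2 < t < 2t₀` all kernels lie below one Gaussian with the largest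
prefactor and the widest spread. -/
theorem tendsto_gk_time {N : ℕ} {t₀ : ℝ} (ht₀ : 0 < t₀) :
    Tendsto (fun t => ∫ x : Vec N, |gk t x - gk t₀ x|) (𝓝 t₀) (𝓝 0) := by
  have h0 : (0 : ℝ) = ∫ x : Vec N, |gk t₀ x - gk t₀ x| := by simp
  rw [h0]
  have hev : ∀ᶠ t in 𝓝 t₀, t₀ / 2 < t ∧ t < 2 * t₀ :=
    (eventually_gt_nhds (by linarith)).and (eventually_lt_nhds (by linarith))
  refine tendsto_integral_filter_of_dominated_convergence
    (fun x : Vec N => (4 * Real.pi * (t₀ / 2)) ^ (-(N : ℝ) / 2) *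
      Real.exp (-(1 / (4 * (2 * t₀)) * ‖x‖ ^ 2)) + gk t₀ x) ?_ ?_ ?_ ?_
  · exact Eventually.of_forall fun t =>
      (((continuous_gk t).sub (continuous_gk t₀)).abs).aestronglyMeasurable
  · filter_upwards [hev] with t ht
    refine Eventually.of_forall fun x => ?_
    have htp : 0 < t := by linarith [ht.1]
    rw [Real.norm_eq_abs, abs_abs]
    refine (abs_sub _ _).trans ?_
    rw [abs_of_nonneg (gk_nonneg htp x), abs_of_nonneg (gk_nonneg ht₀ x)]
    refine add_le_add ?_ le_rfl
    unfold gk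
    refine mul_le_mul ?_ ?_ (by positivity) (by positivity)
    · refine Real.rpow_le_rpow_of_nonpos (by positivity) ?_ ?_
      · have := Real.pi_pos; nlinarith [ht.1]
      · have : (0 : ℝ) ≤ N := Nat.cast_nonneg N
        linarith
    · rw [Real.exp_le_exp, neg_le_neg_iff]
      gcongr
      exact ht.2.le
  · refine Integrable.add (Integrable.const_mul ?_ _) (integrable_gk ht₀)
    exact (gaussian N (1 / (4 * (2 * t₀))) (by positivity)).integrable
  · refine Eventually.of_forall fun x => ?_
    have hc : ContinuousAt (fun t => gk t x) t₀ := by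
      unfold gk
      refine ContinuousAt.mul ?_ ?_
      · refine ContinuousAt.rpow (by fun_prop) (by fun_prop) (Or.inl (by positivity))
      · have : ContinuousAt (fun t : ℝ => 1 / (4 * t)) t₀ :=
          continuousAt_const.div (by fun_prop) (by positivity)
        fun_prop
    exact ((hc.sub continuousAt_const).abs).tendsto

/-- Dominated convergence: for `‖h‖ < 1` the inequality `‖x‖² ≤ 2‖x+h‖² + 2` puts every translate
below one Gaussian with half the decay rate. -/
theorem tendsto_gk_space {N : ℕ} {t : ℝ} (ht : 0 < t) :
    Tendsto (fun h : Vec N => ∫ x : Vec N, |gk t (x + h) - gk t x|) (𝓝 0) (𝓝 0) := by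
  have h0 : (0 : ℝ) = ∫ x : Vec N, |gk t (x + 0) - gk t x| := by simp
  rw [show 𝓝 (0 : ℝ) = 𝓝 (∫ x : Vec N, |gk t (x + 0) - gk t x|) by rw [← h0]]
  have hev : ∀ᶠ h : Vec N in 𝓝 0, ‖h‖ < 1 := by
    have : Tendsto (fun h : Vec N => ‖h‖) (𝓝 0) (𝓝 0) := by
      simpa using (continuous_norm (E := Vec N)).tendsto 0
    exact this.eventually (eventually_lt_nhds one_pos)
  refine tendsto_integral_filter_of_dominated_convergence
    (fun x : Vec N => (4 * Real.pi * t) ^ (-(N : ℝ) / 2) * Real.exp (1 / (4 * t)) *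
      Real.exp (-(1 / (8 * t) * ‖x‖ ^ 2)) + gk t x) ?_ ?_ ?_ ?_
  · exact Eventually.of_forall fun h =>
      ((((continuous_gk t).comp (continuous_id.add continuous_const)).sub
        (continuous_gk t)).abs).aestronglyMeasurable
  · filter_upwards [hev] with h hh
    refine Eventually.of_forall fun x => ?_
    rw [Real.norm_eq_abs, abs_abs]
    refine (abs_sub _ _).trans ?_
    rw [abs_of_nonneg (gk_nonneg ht _), abs_of_nonneg (gk_nonneg ht x)]
    refine add_le_add ?_ le_rfl
    unfold gk
    rw [mul_assoc ((4 * Real.pi * t) ^ (-(N : ℝ) / 2)), ← Real.exp_add]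
    refine mul_le_mul_of_nonneg_left ?_ (by positivity)
    rw [Real.exp_le_exp]
    have h1 : ‖x‖ ≤ ‖x + h‖ + ‖h‖ := by
      simpa using norm_sub_le (x + h) h
    have h2 : ‖x‖ ^ 2 ≤ 2 * ‖x + h‖ ^ 2 + 2 := by
      have : ‖x‖ ≤ ‖x + h‖ + 1 := by linarith
      nlinarith [sq_nonneg (‖x + h‖ - 1), norm_nonneg x, norm_nonneg (x + h)]
    have h3 : 1 / (8 * t) * ‖x‖ ^ 2 ≤ 1 / (8 * t) * (2 * ‖x + h‖ ^ 2 + 2) := by gcongr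
    have h4 : 1 / (8 * t) * (2 * ‖x + h‖ ^ 2 + 2) =
        1 / (4 * t) * ‖x + h‖ ^ 2 + 1 / (4 * t) := by field_simp; ring
    linarith
  · refine Integrable.add (Integrable.const_mul ?_ _) (integrable_gk ht)
    exact (gaussian N (1 / (8 * t)) (by positivity)).integrable
  · refine Eventually.of_forall fun x => ?_
    have hc : Continuous (fun h : Vec N => |gk t (x + h) - gk t x|) :=
      (((continuous_gk t).comp (continuous_const.add continuous_id)).sub continuous_const).abs
    exact hc.tendsto 0

/-! ### Parabolic scaling and the second moment of the Gaussian. -/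

theorem gk_scale {N : ℕ} {t : ℝ} (ht : 0 < t) (x : Vec N) :
    gk t (√t • x) = t ^ (-(N : ℝ) / 2) * gk 1 x := by
  unfold gk
  rw [norm_smul, mul_pow, Real.norm_eq_abs, abs_of_nonneg (Real.sqrt_nonneg t), Real.sq_sqrt ht.le,
    Real.mul_rpow (by positivity) ht.le]
  rw [show 1 / (4 * t) * (t * ‖x‖ ^ 2) = 1 / (4 * 1) * ‖x‖ ^ 2 by field_simp, mul_one]
  ring_nf

theorem sqrt_pow_eq {t : ℝ} (ht : 0 < t) (N : ℕ) : √t ^ N = t ^ ((N : ℝ) / 2) := by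
  rw [Real.sqrt_eq_rpow, ← Real.rpow_natCast, ← Real.rpow_mul ht.le]; congr 1; ring

theorem integral_scale {N : ℕ} {t : ℝ} (ht : 0 < t) {F : Type*} [NormedAddCommGroup F]
    [NormedSpace ℝ F] (f : Vec N → F) :
    ∫ x, f x = t ^ ((N : ℝ) / 2) • ∫ x, f (√t • x) := by
  rw [Measure.integral_comp_smul_of_nonneg volume f _ (hR := Real.sqrt_nonneg t),
    finrank_euclideanSpace_fin, smul_smul, sqrt_pow_eq ht, mul_inv_cancel₀ (by positivity),
    one_smul]

theorem integral_sq_gk {N : ℕ} {t : ℝ} (ht : 0 < t) :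
    ∫ x : Vec N, ‖x‖ ^ 2 * gk t x = t * ∫ x : Vec N, ‖x‖ ^ 2 * gk 1 x := by
  rw [integral_scale ht, smul_eq_mul, ← integral_const_mul, ← integral_const_mul]
  congr 1; ext x
  rw [gk_scale ht, norm_smul, mul_pow, Real.norm_eq_abs, abs_of_nonneg (Real.sqrt_nonneg t),
    Real.sq_sqrt ht.le]
  have : t ^ ((N : ℝ) / 2) * t ^ (-(N : ℝ) / 2) = 1 := by
    rw [← Real.rpow_add ht]; ring_nf; simp
  linear_combination (t * ‖x‖ ^ 2 * gk 1 x) * this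

theorem integrable_sq_gk {N : ℕ} {t : ℝ} (ht : 0 < t) :
    Integrable (fun x : Vec N => ‖x‖ ^ 2 * gk t x) := by
  have := (heatKernel N t ht).integrable_pow_mul volume 2
  refine this.congr (Eventually.of_forall fun x => ?_)
  simp only [heatKernel_apply, Real.norm_eq_abs, abs_of_nonneg (gk_nonneg ht x)]


/-! ### Convolution of integrable kernels with essentially bounded functions -/

section Convolution

variable {N : ℕ} {F : Type*} [NormedAddCommGroup F] [NormedSpace ℝ F]

theorem integrable_comp_sub {k : Vec N → ℝ} (hk : Integrable k) (x : Vec N) :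
    Integrable (fun y => k (x - y)) := hk.comp_sub_left x

theorem integrable_kernel_smul {k : Vec N → ℝ} (hk : Integrable k) {f : Vec N → F} {M : ℝ}
    (hf : AEStronglyMeasurable f volume) (hM : ∀ᵐ y, ‖f y‖ ≤ M) (x : Vec N) :
    Integrable (fun y => k (x - y) • f y) := by
  refine Integrable.mono' ((integrable_comp_sub hk x).norm.mul_const M)
    ((integrable_comp_sub hk x).aestronglyMeasurable.smul hf) ?_
  filter_upwards [hM] with y hy
  rw [norm_smul]; gcongr

theorem norm_kernel_integral_le {k : Vec N → ℝ} (hk : Integrable k) {f : Vec N → F} {M : ℝ}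
    (hM : ∀ᵐ y, ‖f y‖ ≤ M) (x : Vec N) :
    ‖∫ y, k (x - y) • f y‖ ≤ (∫ y, |k y|) * M := by
  refine (norm_integral_le_of_norm_le ((integrable_comp_sub hk x).norm.mul_const M) ?_).trans ?_
  · filter_upwards [hM] with y hy
    rw [norm_smul]; gcongr
  · rw [integral_mul_const, integral_sub_left_eq_self (fun y => ‖k y‖) volume x]; rfl

theorem norm_kernel_integral_sub_le {k l : Vec N → ℝ} (hk : Integrable k) (hl : Integrable l)
    {f : Vec N → F} {M : ℝ} (hf : AEStronglyMeasurable f volume) (hM : ∀ᵐ y, ‖f y‖ ≤ M)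
    (x : Vec N) :
    ‖(∫ y, k (x - y) • f y) - ∫ y, l (x - y) • f y‖ ≤ (∫ y, |k y - l y|) * M := by
  rw [← integral_sub (integrable_kernel_smul hk hf hM x) (integrable_kernel_smul hl hf hM x)]
  simp_rw [← sub_smul]
  exact norm_kernel_integral_le (k := fun y => k y - l y) (hk.sub hl) hM x

/-- Associativity `k * (l * f) = (k * l) * f`, by Fubini. The kernel `k * l` enters through `m` so
that a closed formula for it can be inserted. -/
theorem kernel_integral_comp [CompleteSpace F] {k l m : Vec N → ℝ} (hk : Integrable k)
    (hl : Integrable l)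
    (hm : ∀ x, ∫ y, k (x - y) * l y = m x) {f : Vec N → F} {M : ℝ}
    (hf : AEStronglyMeasurable f volume) (hM : ∀ᵐ y, ‖f y‖ ≤ M) (x : Vec N) :
    ∫ y, k (x - y) • (∫ z, l (y - z) • f z) = ∫ z, m (x - z) • f z := by
  simp_rw [← integral_smul]
  rw [integral_integral_swap]
  · congr 1; ext z
    simp_rw [smul_smul]
    rw [integral_smul_const, ← hm (x - z)]
    congr 1
    rw [← integral_sub_right_eq_self (fun y => k (x - z - y) * l y) z]
    congr 1; ext y; congr 2; abel
  · have h1 := (Integrable.convolution_integrand (ContinuousLinearMap.mul ℝ ℝ)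
      (integrable_comp_sub hk x) hl.comp_neg).swap
    have h2 : Integrable (fun p : Vec N × Vec N => (k (x - p.1) * l (p.1 - p.2)) • f p.2)
        (volume.prod volume) := by
      refine Integrable.mono' (h1.norm.mul_const M) ?_ ?_
      · have := h1.aestronglyMeasurable.smul (hf.comp_snd (μ := volume))
        refine this.congr (Eventually.of_forall fun p => ?_)
        simp
      · have := Measure.quasiMeasurePreserving_snd (μ := (volume : Measure (Vec N)))
          (ν := (volume : Measure (Vec N))) |>.ae hM
        filter_upwards [this] with p hp
        rw [norm_smul]
        simp only [Function.comp, Prod.fst_swap, Prod.snd_swap, ContinuousLinearMap.mul_apply',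
          neg_sub]
        gcongr
    refine h2.congr (Eventually.of_forall fun p => ?_)
    simp [Function.uncurry, mul_smul]

end Convolution

/-! ### The heat semigroup on bounded functions -/

/-- `e^{tΔ} f = G_t * f` for a function `f`. -/
def hs {N : ℕ} (t : ℝ) (f : Vec N → Vec N) (x : Vec N) : Vec N := ∫ y, gk t (x - y) • f y

section HeatFun

variable {N : ℕ} {t r s M : ℝ} {f g : Vec N → Vec N}

theorem integral_abs_gk (ht : 0 < t) : ∫ y : Vec N, |gk t y| = 1 := by
  rw [← integral_gk ht]; congr 1; ext y; exact abs_of_nonneg (gk_nonneg ht y)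

theorem norm_hs_le (ht : 0 < t) (hM : ∀ᵐ y, ‖f y‖ ≤ M) (x : Vec N) : ‖hs t f x‖ ≤ M := by
  have := norm_kernel_integral_le (integrable_gk ht) hM x
  rwa [integral_abs_gk ht, one_mul] at this

theorem hs_congr (h : f =ᵐ[volume] g) (x : Vec N) : hs t f x = hs t g x := by
  refine integral_congr_ae ?_
  filter_upwards [h] with y hy
  rw [hy]

theorem hs_sub {M' : ℝ} (ht : 0 < t) (hf : AEStronglyMeasurable f volume) (hM : ∀ᵐ y, ‖f y‖ ≤ M)
    (hg : AEStronglyMeasurable g volume) (hM' : ∀ᵐ y, ‖g y‖ ≤ M') (x : Vec N) :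
    hs t (fun y => f y - g y) x = hs t f x - hs t g x := by
  unfold hs
  rw [← integral_sub (integrable_kernel_smul (integrable_gk ht) hf hM x)
    (integrable_kernel_smul (integrable_gk ht) hg hM' x)]
  simp_rw [smul_sub]

theorem norm_hs_sub_hs_le (ht : 0 < t) (hs' : 0 < s) (hf : AEStronglyMeasurable f volume)
    (hM : ∀ᵐ y, ‖f y‖ ≤ M) (x : Vec N) :
    ‖hs t f x - hs s f x‖ ≤ (∫ y : Vec N, |gk t y - gk s y|) * M :=
  norm_kernel_integral_sub_le (integrable_gk ht) (integrable_gk hs') hf hM x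

/-- The increment by `h` is at most `M` times the `L¹` distance of `gk t` from its translate by `h`,
uniformly in the base point. -/
theorem uniformContinuous_hs (ht : 0 < t) (hf : AEStronglyMeasurable f volume)
    (hM : ∀ᵐ y, ‖f y‖ ≤ M) : UniformContinuous (hs t f) := by
  have hb : ∀ x h : Vec N, ‖hs t f (x + h) - hs t f x‖ ≤ (∫ y, |gk t (y + h) - gk t y|) * M := by
    intro x h
    have := norm_kernel_integral_sub_le ((integrable_gk ht).comp_add_right h)
      (integrable_gk ht) hf hM x
    simpa only [hs, sub_add_eq_add_sub] using this
  have hlim : Tendsto (fun h : Vec N => (∫ y, |gk t (y + h) - gk t y|) * M) (𝓝 0) (𝓝 0) := by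
    simpa using (tendsto_gk_space ht).mul_const M
  rw [Metric.uniformContinuous_iff]
  intro ε hε
  obtain ⟨δ, hδ, hδ'⟩ := Metric.eventually_nhds_iff.mp (hlim.eventually (eventually_lt_nhds hε))
  refine ⟨δ, hδ, fun {a b} hab => ?_⟩
  rw [dist_eq_norm]
  have h1 := hb b (a - b)
  rw [add_sub_cancel] at h1
  refine h1.trans_lt (hδ' ?_)
  rwa [dist_zero_right, ← dist_eq_norm]

/-- A Chebyshev argument: uniform continuity and boundedness give `‖g y - g x‖ ≤ ε/2 + (2M/η²)
‖x-y‖²`, and the second moment of `gk t` is proportional to `t`. -/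
theorem hs_tendsto_of_uniformContinuous (hg : UniformContinuous g) (hM : ∀ x, ‖g x‖ ≤ M)
    {ε : ℝ} (hε : 0 < ε) :
    ∃ δ > 0, ∀ t ∈ Ioo 0 δ, ∀ x, ‖hs t g x - g x‖ ≤ ε := by
  obtain ⟨η, hη, hgη⟩ := Metric.uniformContinuous_iff.mp hg (ε / 2) (by positivity)
  have hM0 : 0 ≤ M := (norm_nonneg _).trans (hM 0)
  set A := ∫ x : Vec N, ‖x‖ ^ 2 * gk 1 x with hA
  have hA0 : 0 ≤ A := integral_nonneg fun x => mul_nonneg (by positivity) (gk_nonneg one_pos x)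
  refine ⟨ε / 2 / (2 * M / η ^ 2 * A + 1), by positivity, fun t ht x => ?_⟩
  have hgm := hg.continuous.aestronglyMeasurable (μ := (volume : Measure (Vec N)))
  have hpt : ∀ y, ‖g y - g x‖ ≤ ε / 2 + 2 * M / η ^ 2 * ‖x - y‖ ^ 2 := by
    intro y
    by_cases hy : dist y x < η
    · have := hgη hy
      rw [dist_eq_norm] at this
      have h0 : 0 ≤ 2 * M / η ^ 2 * ‖x - y‖ ^ 2 := by positivity
      linarith
    · have h1 : η ≤ ‖x - y‖ := by rwa [not_lt, dist_comm, dist_eq_norm] at hy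
      have h2 : 2 * M ≤ 2 * M / η ^ 2 * ‖x - y‖ ^ 2 := by
        rw [div_mul_eq_mul_div, le_div_iff₀ (by positivity)]
        gcongr
      have h3 := norm_sub_le (g y) (g x)
      linarith [hM y, hM x]
  have hx : g x = ∫ y, gk t (x - y) • g x := by
    rw [integral_smul_const, integral_sub_left_eq_self (fun y : Vec N => gk t y) volume x,
      integral_gk ht.1, one_smul]
  have hdiff : hs t g x - g x = ∫ y, gk t (x - y) • (g y - g x) := by
    simp_rw [smul_sub]
    rw [integral_sub
      (integrable_kernel_smul (integrable_gk ht.1) hgm (Eventually.of_forall hM) x)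
      ((integrable_comp_sub (integrable_gk ht.1) x).smul_const _), ← hx]
    rfl
  rw [hdiff]
  have hi1 : Integrable (fun y => (ε / 2) * gk t (x - y)) :=
    (integrable_comp_sub (integrable_gk ht.1) x).const_mul _
  have hi2 : Integrable (fun y => 2 * M / η ^ 2 * (‖x - y‖ ^ 2 * gk t (x - y))) :=
    (integrable_comp_sub (integrable_sq_gk ht.1) x).const_mul _
  refine (norm_integral_le_of_norm_le (hi1.add hi2) (Eventually.of_forall fun y => ?_)).trans ?_
  · rw [norm_smul, Real.norm_eq_abs, abs_of_nonneg (gk_nonneg ht.1 _)]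
    have := mul_le_mul_of_nonneg_left (hpt y) (gk_nonneg ht.1 (x - y))
    simp only [Pi.add_apply]
    linarith
  · simp only [Pi.add_apply]
    rw [integral_add hi1 hi2, integral_const_mul, integral_const_mul,
      integral_sub_left_eq_self (fun y : Vec N => gk t y) volume x,
      integral_sub_left_eq_self (fun y : Vec N => ‖y‖ ^ 2 * gk t y) volume x,
      integral_gk ht.1, integral_sq_gk ht.1, ← hA]
    have h1 := ht.2
    rw [lt_div_iff₀ (by positivity)] at h1
    have h2 : 0 ≤ t := ht.1.le
    nlinarith

theorem stronglyMeasurable_hs (hf : AEStronglyMeasurable f volume) :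
    StronglyMeasurable (fun p : ℝ × Vec N => hs p.1 f p.2) := by
  have h1 : (fun p : ℝ × Vec N => hs p.1 f p.2) = fun p => hs p.1 (hf.mk f) p.2 := by
    ext1 p; exact hs_congr hf.ae_eq_mk p.2
  rw [h1]
  refine StronglyMeasurable.integral_prod_right' (f := fun q : (ℝ × Vec N) × Vec N =>
    gk q.1.1 (q.1.2 - q.2) • hf.mk f q.2) ?_
  have hk : StronglyMeasurable fun q : (ℝ × Vec N) × Vec N => gk q.1.1 (q.1.2 - q.2) :=
    (measurable_gk.comp (f := fun q : (ℝ × Vec N) × Vec N => (q.1.1, q.1.2 - q.2))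
      (by fun_prop)).stronglyMeasurable
  exact hk.smul (hf.stronglyMeasurable_mk.comp_measurable measurable_snd)

end HeatFun


/-! ### Convolutions with Schwartz functions and tempered distributions -/

theorem hasFDerivAt_kernel_integral {N : ℕ} {F : Type} [NormedAddCommGroup F] [NormedSpace ℝ F]
    [CompleteSpace F] {k : Vec N → ℝ} (hk : Integrable k) (h : 𝓢(Vec N, F)) (x : Vec N) :
    HasFDerivAt (fun x => ∫ y, k y • h (x - y))
      (∫ y, k y • SchwartzMap.fderivCLM ℝ (Vec N) F h (x - y)) x := by
  have hm : ∀ x : Vec N, AEStronglyMeasurable (fun y => k y • h (x - y)) volume := fun x =>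
    hk.aestronglyMeasurable.smul
      (h.continuous.comp (continuous_const.sub continuous_id)).aestronglyMeasurable
  have : SecondCountableTopologyEither (Vec N) (Vec N →L[ℝ] F) :=
    secondCountableTopologyEither_of_left _ _
  refine hasFDerivAt_integral_of_dominated_of_fderiv_le (s := univ)
    (F' := fun x y => k y • SchwartzMap.fderivCLM ℝ (Vec N) F h (x - y))
    (bound := fun y => ‖k y‖ * SchwartzMap.seminorm ℝ 0 0 (SchwartzMap.fderivCLM ℝ (Vec N) F h))
    univ_mem (Eventually.of_forall hm) ?_ ?_ ?_ ?_ ?_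
  · refine Integrable.mono' (hk.norm.mul_const (SchwartzMap.seminorm ℝ 0 0 h)) (hm x)
      (Eventually.of_forall fun y => ?_)
    rw [norm_smul]
    exact mul_le_mul_of_nonneg_left (h.norm_le_seminorm ℝ _) (norm_nonneg _)
  · exact hk.aestronglyMeasurable.smul ((SchwartzMap.continuous _).comp
      (continuous_const.sub continuous_id)).aestronglyMeasurable
  · refine Eventually.of_forall fun y x _ => ?_
    rw [norm_smul]
    exact mul_le_mul_of_nonneg_left (SchwartzMap.norm_le_seminorm ℝ _ _) (norm_nonneg _)
  · exact hk.norm.mul_const _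
  · refine Eventually.of_forall fun y x _ => ?_
    have h1 := (h.hasFDerivAt (x - y)).comp x ((hasFDerivAt_id x).sub_const y)
    rw [ContinuousLinearMap.comp_id] at h1
    rw [SchwartzMap.fderivCLM_apply]
    exact h1.const_smul (k y)

/-- The target `F` is quantified inside the induction because one differentiation replaces `h` by a
Schwartz function with values in `Vec N →L[ℝ] F`. -/
theorem iteratedFDeriv_kernel_integral {N : ℕ} {k : Vec N → ℝ} (hk : Integrable k) (n : ℕ) :
    ∀ {F : Type} [NormedAddCommGroup F] [NormedSpace ℝ F] [CompleteSpace F] (h : 𝓢(Vec N, F))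
      (x : Vec N), iteratedFDeriv ℝ n (fun x => ∫ y, k y • h (x - y)) x =
        ∫ y, k y • iteratedFDeriv ℝ n h (x - y) := by
  induction n with
  | zero =>
    intro F _ _ _ h x
    simp only [iteratedFDeriv_zero_eq_comp, Function.comp]
    have := ((continuousMultilinearCurryFin0 ℝ (Vec N) F).symm.toContinuousLinearEquiv
      ).integral_comp_comm (μ := volume) (fun y => k y • h (x - y))
    simp only [map_smul] at this
    exact this.symm
  | succ n ih =>
    intro F _ _ _ h x
    have h1 : fderiv ℝ (fun x => ∫ y, k y • h (x - y)) =
        fun x => ∫ y, k y • SchwartzMap.fderivCLM ℝ (Vec N) F h (x - y) :=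
      funext fun x => (hasFDerivAt_kernel_integral hk h x).fderiv
    rw [iteratedFDeriv_succ_eq_comp_right, Function.comp, h1, ih]
    have := ((continuousMultilinearCurryRightEquiv' ℝ n (Vec N) F).symm.toContinuousLinearEquiv
      ).integral_comp_comm (μ := volume) (fun y => k y •
        iteratedFDeriv ℝ n (SchwartzMap.fderivCLM ℝ (Vec N) F h) (x - y))
    simp only [map_smul] at this
    refine this.symm.trans ?_
    congr 1; ext1 y
    rw [iteratedFDeriv_succ_eq_comp_right]
    rfl

theorem pow_norm_mul_translate_le {N : ℕ} (η : 𝓢(Vec N, ℝ)) (k n : ℕ) (x y : Vec N) :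
    ‖x‖ ^ k * ‖iteratedFDeriv ℝ n η (x - y)‖ ≤
      2 ^ k * (SchwartzMap.seminorm ℝ k n η + ‖y‖ ^ k * SchwartzMap.seminorm ℝ 0 n η) := by
  have h1 : ‖x‖ ≤ ‖x - y‖ + ‖y‖ := by simpa using norm_add_le (x - y) y
  have h2 : ‖x‖ ^ k ≤ 2 ^ k * (‖x - y‖ ^ k + ‖y‖ ^ k) := by
    refine (pow_le_pow_left₀ (norm_nonneg _) h1 k).trans ?_
    rcases le_total ‖x - y‖ ‖y‖ with h | h
    · calc (‖x - y‖ + ‖y‖) ^ k ≤ (2 * ‖y‖) ^ k := by gcongr; linarith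
        _ = 2 ^ k * ‖y‖ ^ k := mul_pow _ _ _
        _ ≤ _ := by gcongr; linarith [pow_nonneg (norm_nonneg (x - y)) k]
    · calc (‖x - y‖ + ‖y‖) ^ k ≤ (2 * ‖x - y‖) ^ k := by gcongr; linarith
        _ = 2 ^ k * ‖x - y‖ ^ k := mul_pow _ _ _
        _ ≤ _ := by gcongr; linarith [pow_nonneg (norm_nonneg y) k]
  calc ‖x‖ ^ k * ‖iteratedFDeriv ℝ n η (x - y)‖
      ≤ 2 ^ k * (‖x - y‖ ^ k + ‖y‖ ^ k) * ‖iteratedFDeriv ℝ n η (x - y)‖ := by gcongr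
    _ = 2 ^ k * (‖x - y‖ ^ k * ‖iteratedFDeriv ℝ n η (x - y)‖ +
          ‖y‖ ^ k * ‖iteratedFDeriv ℝ n η (x - y)‖) := by ring
    _ ≤ _ := by
      gcongr
      · exact SchwartzMap.le_seminorm ℝ k n η _
      · exact SchwartzMap.norm_iteratedFDeriv_le_seminorm ℝ η n _

theorem iteratedFDeriv_compSubConst {N : ℕ} (η : 𝓢(Vec N, ℝ)) (n : ℕ) (x y : Vec N) :
    iteratedFDeriv ℝ n (SchwartzMap.compSubConstCLM ℝ y η) x = iteratedFDeriv ℝ n η (x - y) := by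
  have : (SchwartzMap.compSubConstCLM ℝ y η : Vec N → ℝ) = fun z => η (z - y) := by
    ext z; simp
  rw [this, iteratedFDeriv_comp_sub]

/-- For each Schwartz seminorm, the mean value inequality in the translation parameter bounds the
difference of two nearby translates by their distance times seminorms of order `n + 1`. -/
theorem continuous_compSubConst {N : ℕ} (η : 𝓢(Vec N, ℝ)) :
    Continuous (fun y : Vec N => SchwartzMap.compSubConstCLM ℝ y η) := by
  rw [continuous_iff_continuousAt]
  intro y₀
  rw [ContinuousAt, (schwartz_withSeminorms ℝ (Vec N) ℝ).tendsto_nhds]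
  rintro ⟨k, n⟩ ε hε
  set C : ℝ := 2 ^ k * (SchwartzMap.seminorm ℝ k (n + 1) η +
    (‖y₀‖ + 1) ^ k * SchwartzMap.seminorm ℝ 0 (n + 1) η) with hC
  have hC0 : 0 ≤ C := by positivity
  have hev : ∀ᶠ y in 𝓝 y₀, y ∈ Metric.ball y₀ (min 1 (ε / (C + 1))) :=
    Metric.ball_mem_nhds _ (by positivity)
  filter_upwards [hev] with y hy
  rw [Metric.mem_ball, lt_min_iff] at hy
  have hbound : ∀ x : Vec N, ‖x‖ ^ k * ‖iteratedFDeriv ℝ n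
      (SchwartzMap.compSubConstCLM ℝ y η - SchwartzMap.compSubConstCLM ℝ y₀ η) x‖ ≤
      C * dist y y₀ := by
    intro x
    have hsub : iteratedFDeriv ℝ n
        (SchwartzMap.compSubConstCLM ℝ y η - SchwartzMap.compSubConstCLM ℝ y₀ η) x =
        iteratedFDeriv ℝ n η (x - y) - iteratedFDeriv ℝ n η (x - y₀) := by
      rw [← iteratedFDeriv_compSubConst, ← iteratedFDeriv_compSubConst]
      exact iteratedFDeriv_sub_apply ((SchwartzMap.smooth _ n).contDiffAt)
        ((SchwartzMap.smooth _ n).contDiffAt)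
    rw [hsub]
    have hd : ∀ z ∈ Metric.ball y₀ 1, HasFDerivWithinAt
        (fun z => ‖x‖ ^ k • iteratedFDeriv ℝ n η (x - z))
        (-(‖x‖ ^ k • fderiv ℝ (iteratedFDeriv ℝ n η) (x - z))) (Metric.ball y₀ 1) z := by
      intro z _
      have h1 : DifferentiableAt ℝ (iteratedFDeriv ℝ n η) (x - z) :=
        ((η.smooth (n + 1 : ℕ)).differentiable_iteratedFDeriv (m := n)
          (by exact_mod_cast Nat.lt_succ_self n)) _
      have h2 := (h1.hasFDerivAt.comp z ((hasFDerivAt_id z).const_sub x)).const_smul (‖x‖ ^ k)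
      refine h2.hasFDerivWithinAt.congr_fderiv ?_
      ext v; simp
    have := (convex_ball y₀ 1).norm_image_sub_le_of_norm_hasFDerivWithin_le (C := C) hd (by
      intro z hz
      rw [norm_neg, norm_smul, norm_fderiv_iteratedFDeriv, norm_pow, norm_norm]
      refine (pow_norm_mul_translate_le η k (n + 1) x z).trans ?_
      rw [hC]
      gcongr
      have h3 : ‖z‖ ≤ ‖y₀‖ + ‖z - y₀‖ := by simpa using norm_add_le y₀ (z - y₀)
      rw [Metric.mem_ball, dist_eq_norm] at hz
      linarith) (Metric.mem_ball_self one_pos) (Metric.mem_ball.mpr hy.1)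
    rw [← smul_sub, norm_smul, norm_pow, norm_norm] at this
    rwa [dist_eq_norm]
  refine (SchwartzMap.seminorm_le_bound ℝ k n _ (by positivity) hbound).trans_lt ?_
  have h2 := hy.2
  rw [lt_div_iff₀ (by positivity)] at h2
  nlinarith [dist_nonneg (x := y) (y := y₀)]

/-- The space of values of `n`-th derivatives. -/
def JetSpace (N n : ℕ) : Type := ContinuousMultilinearMap ℝ (fun _ : Fin n => Vec N) ℝ

instance (N n : ℕ) : NormedAddCommGroup (JetSpace N n) :=
  inferInstanceAs (NormedAddCommGroup (ContinuousMultilinearMap ℝ (fun _ : Fin n => Vec N) ℝ))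

instance (N n : ℕ) : NormedSpace ℝ (JetSpace N n) :=
  inferInstanceAs (NormedSpace ℝ (ContinuousMultilinearMap ℝ (fun _ : Fin n => Vec N) ℝ))

instance (N n : ℕ) : CompleteSpace (JetSpace N n) :=
  inferInstanceAs (CompleteSpace (ContinuousMultilinearMap ℝ (fun _ : Fin n => Vec N) ℝ))

/-- The `n`-th derivative of a Schwartz function. -/
def jetAt {N : ℕ} (n : ℕ) (ψ : 𝓢(Vec N, ℝ)) (x : Vec N) : JetSpace N n := iteratedFDeriv ℝ n ψ x

theorem norm_jetAt {N n : ℕ} (ψ : 𝓢(Vec N, ℝ)) (x : Vec N) :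
    ‖jetAt n ψ x‖ = ‖iteratedFDeriv ℝ n ψ x‖ := rfl

/-- The map `ψ ↦ |x|^k D^n ψ` into bounded continuous functions. -/
def jet (N k n : ℕ) : 𝓢(Vec N, ℝ) →L[ℝ]
    BoundedContinuousFunction (Vec N) (JetSpace N n) :=
  SchwartzMap.mkCLMtoNormedSpace (fun ψ => BoundedContinuousFunction.ofNormedAddCommGroup
      (fun x => ‖x‖ ^ k • jetAt n ψ x)
      ((continuous_norm.pow k).smul ((ψ.smooth n).continuous_iteratedFDeriv le_rfl))
      (SchwartzMap.seminorm ℝ k n ψ)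
      (fun x => by
        rw [norm_smul, norm_pow, norm_norm]; exact SchwartzMap.le_seminorm ℝ k n ψ x))
    (fun f g => by
      ext1 x
      change ‖x‖ ^ k • jetAt n (f + g) x =
        ‖x‖ ^ k • jetAt n f x + ‖x‖ ^ k • jetAt n g x
      rw [← smul_add]; congr 1
      exact iteratedFDeriv_add_apply (f.smooth n).contDiffAt (g.smooth n).contDiffAt)
    (fun a f => by
      ext1 x
      change ‖x‖ ^ k • jetAt n (a • f) x = a • ‖x‖ ^ k • jetAt n f x
      rw [smul_comm]; congr 1
      exact iteratedFDeriv_const_smul_apply (f.smooth n).contDiffAt)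
    ⟨{(k, n)}, 1, zero_le_one, fun f => by
      rw [BoundedContinuousFunction.norm_le (by positivity)]
      intro x
      rw [Finset.sup_singleton, one_mul]
      change ‖‖x‖ ^ k • jetAt n f x‖ ≤ SchwartzMap.seminorm ℝ k n f
      rw [norm_smul, norm_pow, norm_norm]; exact SchwartzMap.le_seminorm ℝ k n f x⟩

theorem jet_apply {N k n : ℕ} (ψ : 𝓢(Vec N, ℝ)) (x : Vec N) :
    jet N k n ψ x = ‖x‖ ^ k • jetAt n ψ x := rfl

theorem seminorm_le_norm_jet {N k n : ℕ} (ψ : 𝓢(Vec N, ℝ)) :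
    SchwartzMap.seminorm ℝ k n ψ ≤ ‖jet N k n ψ‖ := by
  refine SchwartzMap.seminorm_le_bound ℝ k n ψ (norm_nonneg _) fun x => ?_
  have := (jet N k n ψ).norm_coe_le_norm x
  rwa [jet_apply, norm_smul, norm_pow, norm_norm, norm_jetAt] at this

/-- The finite family of jets indexed by `s`. -/
def jets (N : ℕ) (s : Finset (ℕ × ℕ)) : 𝓢(Vec N, ℝ) →L[ℝ] ((p : s) →
    BoundedContinuousFunction (Vec N)
      (JetSpace N p.1.2)) :=
  ContinuousLinearMap.pi fun p => jet N p.1.1 p.1.2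

/-- Continuity bounds `l` by finitely many seminorms, that is, by the norm of `jets N s`. So `l`
descends to a bounded functional on the range of `jets N s`, and Hahn–Banach extends it. This moves
`l` to a Banach space, where Bochner integrals commute with functionals. -/
theorem exists_factor_jets {N : ℕ} (l : 𝓢(Vec N, ℝ) →L[ℝ] ℝ) :
    ∃ (s : Finset (ℕ × ℕ)) (Λ : StrongDual ℝ ((p : s) → BoundedContinuousFunction (Vec N)
      (JetSpace N p.1.2))),
      ∀ ψ, l ψ = Λ (jets N s ψ) := by
  obtain ⟨s, C, -, hC⟩ := Seminorm.bound_of_continuous (schwartz_withSeminorms ℝ (Vec N) ℝ)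
    ((normSeminorm ℝ ℝ).comp l.toLinearMap) (by
      change Continuous fun ψ => ‖l ψ‖
      exact l.continuous.norm)
  have hb : ∀ ψ, ‖l ψ‖ ≤ C * ‖jets N s ψ‖ := by
    intro ψ
    refine (hC ψ).trans ?_
    rw [_root_.smul_apply, NNReal.smul_def, smul_eq_mul]
    refine mul_le_mul_of_nonneg_left ?_ C.2
    refine Seminorm.finset_sup_apply_le (norm_nonneg _) fun p hp => ?_
    exact (seminorm_le_norm_jet ψ).trans (norm_le_pi_norm (jets N s ψ) ⟨p, hp⟩)
  refine ⟨s, ?_⟩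
  have : Module.Free ℝ (LinearMap.range (jets N s).toLinearMap) := Module.Free.of_divisionRing ℝ _
  obtain ⟨σ, hσ⟩ := LinearMap.exists_rightInverse_of_surjective
    (jets N s).toLinearMap.rangeRestrict (LinearMap.range_rangeRestrict _)
  have hσ' : ∀ y, jets N s (σ y) = y := fun y => by
    have := congrArg Subtype.val (LinearMap.congr_fun hσ y)
    exact this
  let f₀ : StrongDual ℝ (LinearMap.range (jets N s).toLinearMap) :=
    LinearMap.mkContinuous (l.toLinearMap.comp σ) C fun y => by
      refine (hb (σ y)).trans ?_
      rw [hσ' y]; rfl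
  obtain ⟨Λ, hΛ, -⟩ := exists_extension_norm_eq _ f₀
  refine ⟨Λ, fun ψ => ?_⟩
  have h1 := hΛ ⟨jets N s ψ, LinearMap.mem_range_self _ ψ⟩
  have h2 : f₀ ⟨jets N s ψ, LinearMap.mem_range_self _ ψ⟩ =
    l (σ ⟨jets N s ψ, LinearMap.mem_range_self _ ψ⟩) := rfl
  rw [h1, h2]
  -- The functional does not depend on the chosen section `σ`: equal jets force equal values of `l`.
  have h3 := hb (ψ - σ ⟨jets N s ψ, LinearMap.mem_range_self _ ψ⟩)
  rw [map_sub, map_sub, hσ', sub_self, norm_zero, mul_zero] at h3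
  exact sub_eq_zero.mp (norm_le_zero_iff.mp h3)

theorem integrable_smul_jet_translate {N k n : ℕ} (ψ η : 𝓢(Vec N, ℝ)) :
    Integrable (fun y => ψ y • jet N k n (SchwartzMap.compSubConstCLM ℝ y η)) := by
  have hi : Integrable fun y => 2 ^ k * (‖ψ y‖ * SchwartzMap.seminorm ℝ k n η +
      (‖y‖ ^ k * ‖ψ y‖) * SchwartzMap.seminorm ℝ 0 n η) :=
    ((ψ.integrable.norm.mul_const _).add ((ψ.integrable_pow_mul volume k).mul_const _)).const_mul _
  refine Integrable.mono' hi ?_ (Eventually.of_forall fun y => ?_)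
  · exact (ψ.continuous.smul
      ((jet N k n).continuous.comp (continuous_compSubConst η))).aestronglyMeasurable
  · rw [norm_smul]
    have : ‖jet N k n (SchwartzMap.compSubConstCLM ℝ y η)‖ ≤
        2 ^ k * (SchwartzMap.seminorm ℝ k n η + ‖y‖ ^ k * SchwartzMap.seminorm ℝ 0 n η) := by
      rw [BoundedContinuousFunction.norm_le (by positivity)]
      intro x
      rw [jet_apply, norm_smul, norm_pow, norm_norm, norm_jetAt, iteratedFDeriv_compSubConst]
      exact pow_norm_mul_translate_le η k n x y
    calc _ ≤ ‖ψ y‖ * (2 ^ k * (SchwartzMap.seminorm ℝ k n η +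
          ‖y‖ ^ k * SchwartzMap.seminorm ℝ 0 n η)) := by gcongr
      _ = _ := by ring

/-- A tempered distribution passes under the convolution integral: after factoring through `jets`,
the convolution is a Bochner integral of translates of `η`, checked pointwise by differentiating
under the integral. -/
theorem apply_convolution {N : ℕ} (l : 𝓢(Vec N, ℝ) →L[ℝ] ℝ) {ψ η Ψ : 𝓢(Vec N, ℝ)}
    (hΨ : ∀ x, Ψ x = ∫ y, ψ y * η (x - y)) :
    l Ψ = ∫ y, ψ y * l (SchwartzMap.compSubConstCLM ℝ y η) := by
  obtain ⟨s, Λ, hΛ⟩ := exists_factor_jets l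
  have hi : Integrable (fun y => ψ y • jets N s (SchwartzMap.compSubConstCLM ℝ y η)) := by
    refine Integrable.of_eval fun p => ?_
    exact integrable_smul_jet_translate ψ η
  have hJ : jets N s Ψ = ∫ y, ψ y • jets N s (SchwartzMap.compSubConstCLM ℝ y η) := by
    ext1 p
    have e1 : (∫ y, ψ y • jets N s (SchwartzMap.compSubConstCLM ℝ y η)) p =
        ∫ y, ψ y • jet N p.1.1 p.1.2 (SchwartzMap.compSubConstCLM ℝ y η) := by
      exact ((ContinuousLinearMap.proj (R := ℝ) p).integral_comp_comm hi).symm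
    rw [e1]
    change jet N p.1.1 p.1.2 Ψ = _
    ext1 x
    have e2 := (BoundedContinuousFunction.evalCLM ℝ x).integral_comp_comm
      (integrable_smul_jet_translate (k := p.1.1) (n := p.1.2) ψ η)
    change _ = (BoundedContinuousFunction.evalCLM ℝ x)
      (∫ y, ψ y • jet N p.1.1 p.1.2 (SchwartzMap.compSubConstCLM ℝ y η))
    rw [← e2, jet_apply]
    have hΨ' : (Ψ : Vec N → ℝ) = fun x => ∫ y, ψ y • η (x - y) := funext hΨ
    have e3 : jetAt p.1.2 Ψ x = ∫ y, ψ y • jetAt p.1.2 (SchwartzMap.compSubConstCLM ℝ y η) x := by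
      unfold jetAt
      rw [hΨ', iteratedFDeriv_kernel_integral ψ.integrable]
      simp_rw [iteratedFDeriv_compSubConst]
      rfl
    rw [e3, ← integral_smul]
    congr 1; ext1 y
    rw [map_smul, smul_comm]
    rfl
  rw [hΛ, hJ, ← Λ.integral_comp_comm hi]
  congr 1; ext1 y
  rw [map_smul, ← hΛ, smul_eq_mul]


/-! ### The `L^∞` norm and essential bounds -/

theorem eLpNorm_top_le_iff {N : ℕ} {f : Vec N → Vec N} {c : ℝ} (hc : 0 ≤ c) :
    eLpNorm f ∞ volume ≤ ENNReal.ofReal c ↔ ∀ᵐ x, ‖f x‖ ≤ c := by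
  rw [eLpNorm_exponent_top, eLpNormEssSup]
  constructor
  · intro h
    filter_upwards [enorm_ae_le_eLpNormEssSup f volume] with x hx
    have := hx.trans h
    rwa [← ofReal_norm, ENNReal.ofReal_le_ofReal_iff hc] at this
  · intro h
    refine essSup_le_of_ae_le _ ?_
    filter_upwards [h] with x hx
    rw [← ofReal_norm]
    exact ENNReal.ofReal_le_ofReal hx

theorem ae_bound_toReal {N : ℕ} {f : Vec N → Vec N} (hf : eLpNorm f ∞ volume ≠ ∞) :
    ∀ᵐ x, ‖f x‖ ≤ (eLpNorm f ∞ volume).toReal := by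
  rw [← eLpNorm_top_le_iff ENNReal.toReal_nonneg, ENNReal.ofReal_toReal hf]

/-! ### Distributions given by bounded functions -/

theorem integrable_schwartz_smul {N : ℕ} (ψ : 𝓢(Vec N, ℝ)) {f : Vec N → Vec N}
    (hf : MemLp f ∞ volume) : Integrable (fun x => ψ x • f x) :=
  ψ.integrable.smul_of_top_left hf

/-- The distribution given by a bounded function. -/
def ofFun {N : ℕ} (f : Vec N → Vec N) (hf : MemLp f ∞ volume) : TDist N :=
  SchwartzMap.mkCLMtoNormedSpace (fun ψ => ∫ x, ψ x • f x)
    (fun ψ χ => by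
      rw [← integral_add (integrable_schwartz_smul ψ hf) (integrable_schwartz_smul χ hf)]
      congr 1; ext1 x
      rw [← add_smul]; rfl)
    (fun a ψ => by
      rw [RingHom.id_apply, ← integral_smul]
      congr 1; ext1 x
      rw [smul_smul]; rfl)
    (by
      set P := (volume : Measure (Vec N)).integrablePower
      set C := (2 ^ P * ∫ x : Vec N, (1 + ‖x‖) ^ (-(P : ℝ)))
      have hC : 0 ≤ C := by positivity
      -- `C` times the sum of the two seminorms bounds the `L¹` norm of `ψ`; the factor `2` replaces
      -- the sum by the supremum of the two.
      refine ⟨{(0, 0), (P, 0)}, C * (2 * (eLpNorm f ∞ volume).toReal), by positivity, fun ψ => ?_⟩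
      have h1 := SchwartzMap.integral_pow_mul_iteratedFDeriv_le ℝ (volume : Measure (Vec N)) ψ 0 0
      simp only [pow_zero, norm_iteratedFDeriv_zero, one_mul, zero_add] at h1
      refine (norm_integral_le_of_norm_le
        (ψ.integrable.norm.mul_const (eLpNorm f ∞ volume).toReal) ?_).trans ?_
      · filter_upwards [ae_bound_toReal hf.2.ne] with x hx
        rw [norm_smul]; gcongr
      · rw [integral_mul_const]
        set s : Finset (ℕ × ℕ) := {(0, 0), (P, 0)}
        have h2 : ∀ p ∈ s, SchwartzMap.seminorm ℝ p.1 p.2 ψ ≤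
            s.sup (schwartzSeminormFamily ℝ (Vec N) ℝ) ψ := fun p hp =>
          Seminorm.le_def.mp (Finset.le_sup (f := schwartzSeminormFamily ℝ (Vec N) ℝ) hp) ψ
        have h3 := h2 (0, 0) (by simp [s])
        have h4 := h2 (P, 0) (by simp [s])
        have h5 : SchwartzMap.seminorm ℝ 0 0 ψ + SchwartzMap.seminorm ℝ P 0 ψ ≤
          2 * s.sup (schwartzSeminormFamily ℝ (Vec N) ℝ) ψ := by linarith
        calc _ ≤ C * (SchwartzMap.seminorm ℝ 0 0 ψ + SchwartzMap.seminorm ℝ P 0 ψ) *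
              (eLpNorm f ∞ volume).toReal := by gcongr
          _ ≤ C * (2 * s.sup (schwartzSeminormFamily ℝ (Vec N) ℝ) ψ) *
              (eLpNorm f ∞ volume).toReal := by gcongr
          _ = _ := by ring)

theorem isBoundedRep_ofFun {N : ℕ} {f : Vec N → Vec N} (hf : MemLp f ∞ volume) :
    IsBoundedRep (ofFun f hf) f := ⟨hf, fun _ => rfl⟩

section Rep

variable {N : ℕ} {φ γ : TDist N} {f g : Vec N → Vec N}

theorem IsBoundedRep.congr (h : IsBoundedRep φ f) (hfg : f =ᵐ[volume] g) : IsBoundedRep φ g := by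
  refine ⟨(memLp_congr_ae hfg).mp h.1, fun ψ => (h.2 ψ).trans (integral_congr_ae ?_)⟩
  filter_upwards [hfg] with x hx
  rw [hx]

theorem IsBoundedRep.eq_of_ae (hf : IsBoundedRep φ f) (hg : IsBoundedRep γ g)
    (h : f =ᵐ[volume] g) : φ = γ := by
  ext1 ψ
  rw [(hf.congr h).2, hg.2]

theorem IsBoundedRep.sub (hf : IsBoundedRep φ f) (hg : IsBoundedRep γ g) :
    IsBoundedRep (φ - γ) (fun x => f x - g x) := by
  refine ⟨hf.1.sub hg.1, fun ψ => ?_⟩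
  rw [_root_.sub_apply, hf.2, hg.2, ← integral_sub (integrable_schwartz_smul ψ hf.1)
    (integrable_schwartz_smul ψ hg.1)]
  simp_rw [smul_sub]

theorem MemLp.locallyIntegrable_top (hf : MemLp f ∞ volume) : LocallyIntegrable f volume :=
  hf.locallyIntegrable le_top

/-- Smooth compactly supported functions are Schwartz and already separate locally integrable
functions. -/
theorem IsBoundedRep.ae_eq (hf : IsBoundedRep φ f) (hg : IsBoundedRep φ g) : f =ᵐ[volume] g := by
  refine ae_eq_of_integral_contDiff_smul_eq (MemLp.locallyIntegrable_top hf.1)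
    (MemLp.locallyIntegrable_top hg.1) fun χ hχ hχc => ?_
  have h1 := hf.2 (hχc.toSchwartzMap hχ)
  rw [hg.2] at h1
  exact h1.symm

theorem linftyNorm_eq (hf : IsBoundedRep φ f) : linftyNorm φ = eLpNorm f ∞ volume := by
  refine le_antisymm (iInf₂_le f hf) (le_iInf₂ fun g hg => ?_)
  exact (eLpNorm_congr_ae (hf.ae_eq hg)).le

end Rep

/-! ### The heat semigroup on distributions -/

section Heat

variable {N : ℕ} {t s M : ℝ}

theorem heat_eq (ht : 0 < t) (φ : TDist N) (x : Vec N) :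
    heat t φ x = φ (SchwartzMap.compSubConstCLM ℝ x (heatKernel N t ht)) := dif_pos ht

theorem heat_sub (φ γ : TDist N) (x : Vec N) : heat t (φ - γ) x = heat t φ x - heat t γ x := by
  unfold heat; split_ifs <;> simp

theorem continuous_heat (φ : TDist N) : Continuous (heat t φ) := by
  by_cases ht : 0 < t
  · have : heat t φ = fun x => φ (SchwartzMap.compSubConstCLM ℝ x (heatKernel N t ht)) :=
      funext (heat_eq ht φ)
    rw [this]
    exact φ.continuous.comp (continuous_compSubConst _)
  · have : heat t φ = fun _ => 0 := funext fun x => dif_neg ht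
    rw [this]; exact continuous_const

theorem heat_rep {φ : TDist N} {f : Vec N → Vec N} (ht : 0 < t) (hf : IsBoundedRep φ f)
    (x : Vec N) : heat t φ x = hs t f x := by
  rw [heat_eq ht, hf.2, hs]
  congr 1; ext1 y
  rw [SchwartzMap.compSubConstCLM_apply, heatKernel_apply, gk_sub_comm]

/-- A closed set of full measure is everything, because sets of full measure are dense. -/
theorem forall_norm_le_of_ae {f : Vec N → Vec N} (hf : Continuous f) (h : ∀ᵐ x, ‖f x‖ ≤ M)
    (x : Vec N) : ‖f x‖ ≤ M := by
  have hd : Dense {x | ‖f x‖ ≤ M} := Measure.dense_of_ae h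
  have hc : IsClosed {x | ‖f x‖ ≤ M} := isClosed_le hf.norm continuous_const
  have := hc.closure_eq ▸ hd x
  exact this

theorem apply_eq_integral_heat (ht : 0 < t) {φ : TDist N} (hM : ∀ᵐ y, ‖heat t φ y‖ ≤ M)
    {ψ Ψ : 𝓢(Vec N, ℝ)} (hΨ : ∀ x, Ψ x = ∫ y, ψ y * gk t (x - y)) :
    φ Ψ = ∫ y, ψ y • heat t φ y := by
  have hi : Integrable (fun y => ψ y • heat t φ y) := by
    refine Integrable.mono' (ψ.integrable.norm.mul_const M)
      (ψ.continuous.smul (continuous_heat φ)).aestronglyMeasurable ?_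
    filter_upwards [hM] with y hy
    rw [norm_smul]; gcongr
  ext i
  have h1 := apply_convolution ((EuclideanSpace.proj i).comp φ) (η := heatKernel N t ht) hΨ
  have h2 := (EuclideanSpace.proj (𝕜 := ℝ) i).integral_comp_comm hi
  change (φ Ψ) i = _ at h1
  rw [h1]
  refine Eq.trans ?_ h2
  congr 1; ext1 y
  rw [map_smul, smul_eq_mul, heat_eq ht]
  rfl

/-- The test function `G_{s+t}(· - x)` is the convolution of `G_s(· - x)` with `G_t`, so
`apply_eq_integral_heat` applies. Only an essential bound on `heat t φ` is needed, not on `φ`. -/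
theorem heat_heat (hs' : 0 < s) (ht : 0 < t) {φ : TDist N} (hM : ∀ᵐ y, ‖heat t φ y‖ ≤ M)
    (x : Vec N) : hs s (heat t φ) x = heat (s + t) φ x := by
  have hΨ : ∀ z, SchwartzMap.compSubConstCLM ℝ x (heatKernel N (s + t) (by positivity)) z =
      ∫ y, SchwartzMap.compSubConstCLM ℝ x (heatKernel N s hs') y * gk t (z - y) := by
    intro z
    simp only [SchwartzMap.compSubConstCLM_apply, heatKernel_apply]
    rw [← gk_conv_gk hs' ht (z - x), ← integral_sub_left_eq_self _ volume z]
    congr 1; ext1 y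
    rw [show z - x - (z - y) = y - x by abel]
  rw [heat_eq (by positivity), apply_eq_integral_heat ht hM hΨ, hs]
  congr 1; ext1 y
  rw [SchwartzMap.compSubConstCLM_apply, heatKernel_apply, gk_sub_comm]

/-- The convolution of a real Schwartz function with the heat kernel. -/
def schwartzHeat (ht : 0 < t) (ψ : 𝓢(Vec N, ℝ)) : 𝓢(Vec N, ℝ) :=
  SchwartzMap.postcompCLM Complex.reCLM
    (SchwartzMap.convolution (ContinuousLinearMap.mul ℂ ℂ)
      (SchwartzMap.postcompCLM Complex.ofRealCLM (heatKernel N t ht))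
      (SchwartzMap.postcompCLM Complex.ofRealCLM ψ))

theorem schwartzHeat_apply (ht : 0 < t) (ψ : 𝓢(Vec N, ℝ)) (x : Vec N) :
    schwartzHeat ht ψ x = ∫ y, gk t y * ψ (x - y) := by
  rw [schwartzHeat, SchwartzMap.postcompCLM_apply, SchwartzMap.convolution_apply]
  unfold MeasureTheory.convolution
  simp only [SchwartzMap.postcompCLM_apply, ContinuousLinearMap.mul_apply', heatKernel_apply,
    Complex.ofRealCLM_apply, ← Complex.ofReal_mul]
  rw [integral_complex_ofReal]
  rfl

theorem schwartzHeat_apply' (ht : 0 < t) (ψ : 𝓢(Vec N, ℝ)) (x : Vec N) :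
    schwartzHeat ht ψ x = ∫ y, ψ y * gk t (x - y) := by
  rw [schwartzHeat_apply, ← integral_sub_left_eq_self _ volume x]
  congr 1; ext1 y
  rw [sub_sub_cancel, mul_comm]

theorem lineDeriv_schwartzHeat (ht : 0 < t) (ψ : 𝓢(Vec N, ℝ)) (v : Vec N) :
    ∂_{v} (schwartzHeat ht ψ) = schwartzHeat ht (∂_{v} ψ) := by
  ext x
  rw [SchwartzMap.lineDerivOp_apply_eq_fderiv]
  have h1 : (schwartzHeat ht ψ : Vec N → ℝ) = fun x => ∫ y, gk t y • ψ (x - y) :=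
    funext (schwartzHeat_apply ht ψ)
  rw [h1, (hasFDerivAt_kernel_integral (integrable_gk ht) ψ x).fderiv, schwartzHeat_apply]
  have hi : Integrable (fun y => gk t y • SchwartzMap.fderivCLM ℝ (Vec N) ℝ ψ (x - y)) := by
    have : SecondCountableTopologyEither (Vec N) (Vec N →L[ℝ] ℝ) :=
      secondCountableTopologyEither_of_left _ _
    refine Integrable.mono' ((integrable_gk ht).norm.mul_const
      (SchwartzMap.seminorm ℝ 0 0 (SchwartzMap.fderivCLM ℝ (Vec N) ℝ ψ))) ?_ ?_
    · exact ((continuous_gk t).smul ((SchwartzMap.continuous _).comp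
        (continuous_const.sub continuous_id))).aestronglyMeasurable
    · refine Eventually.of_forall fun y => ?_
      rw [norm_smul]
      exact mul_le_mul_of_nonneg_left (SchwartzMap.norm_le_seminorm ℝ _ _) (norm_nonneg _)
  have h2 := (ContinuousLinearMap.apply ℝ ℝ v).integral_comp_comm hi
  exact h2.symm

/-- The heat flow is symmetric, so `γ χ = φ (G_t * χ)`, and convolution commutes with derivatives of
the test function. -/
theorem divFree_of_rep_heat (ht : 0 < t) {φ γ : TDist N} (hφ : DivFree φ)
    (hγ : IsBoundedRep γ (heat t φ)) : DivFree γ := by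
  intro ψ
  have hM := ae_bound_toReal hγ.1.2.ne
  have : ∀ χ, γ χ = φ (schwartzHeat ht χ) := fun χ => by
    rw [hγ.2, apply_eq_integral_heat ht hM (schwartzHeat_apply' ht χ)]
  simp_rw [this, ← lineDeriv_schwartzHeat]
  exact hφ _

theorem DivFree.sub {φ γ : TDist N} (hφ : DivFree φ) (hγ : DivFree γ) : DivFree (φ - γ) := by
  intro ψ
  have h1 := hφ ψ
  have h2 := hγ ψ
  simp only [_root_.sub_apply, PiLp.sub_apply, Finset.sum_sub_distrib, h1, h2, sub_zero]

end Heat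


/-! ### The Oseen kernel -/

section Oseen

variable {N : ℕ}

/-- The Fourier symbol of `∂_i ∂_j ∂_k e^{sΔ}`. -/
def cubicSymbol (s : ℝ) (i j k : Fin N) (ξ : Vec N) : ℂ :=
  (2 * Real.pi * Complex.I) ^ 3 * (ξ i * ξ j * ξ k : ℝ) *
    (Real.exp (-(4 * Real.pi ^ 2 * s * ‖ξ‖ ^ 2)) : ℂ)

/-- The Fourier symbol of `∂_k e^{sΔ}`. -/
def linearSymbol (s : ℝ) (k : Fin N) (ξ : Vec N) : ℂ :=
  (2 * Real.pi * Complex.I) * (ξ k : ℂ) * (Real.exp (-(4 * Real.pi ^ 2 * s * ‖ξ‖ ^ 2)) : ℂ)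

theorem abs_coord_le (ξ : Vec N) (i : Fin N) : |ξ i| ≤ ‖ξ‖ := by
  simpa using PiLp.norm_apply_le ξ i

theorem measurable_oseenSymbol (i j k : Fin N) :
    Measurable (fun p : ℝ × Vec N => oseenSymbol p.1 i j k p.2) := by
  unfold oseenSymbol
  have h : ∀ l : Fin N, Measurable fun p : ℝ × Vec N => p.2 l := fun l => by fun_prop
  have h1 := h i
  have h2 := h j
  have h3 := h k
  have hn : Measurable fun p : ℝ × Vec N => ‖p.2‖ := by fun_prop
  refine Measurable.mul (Measurable.mul ?_ ?_) ?_
  · exact measurable_const.mul (Complex.measurable_ofReal.comp h3)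
  · exact Complex.measurable_ofReal.comp (measurable_const.sub ((h1.mul h2).div (hn.pow_const 2)))
  · exact Complex.measurable_ofReal.comp (by fun_prop)

theorem measurable_cubicSymbol (i j k : Fin N) :
    Measurable (fun p : ℝ × Vec N => cubicSymbol p.1 i j k p.2) := by
  unfold cubicSymbol
  refine Measurable.mul (measurable_const.mul (Complex.measurable_ofReal.comp ?_))
    (Complex.measurable_ofReal.comp ?_) <;> fun_prop

theorem stronglyMeasurable_fourierInv {m : ℝ → Vec N → ℂ}
    (hm : Measurable (fun p : ℝ × Vec N => m p.1 p.2)) :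
    StronglyMeasurable (fun p : ℝ × Vec N => 𝓕⁻ (m p.1) p.2) := by
  simp_rw [fourierInv_eq_integral]
  refine StronglyMeasurable.integral_prod_right' (f := fun q : (ℝ × Vec N) × Vec N =>
    Complex.exp (2 * Real.pi * Complex.I * inner ℝ q.2 q.1.2) * m q.1.1 q.2) ?_
  refine Measurable.stronglyMeasurable (Measurable.mul ?_ ?_)
  · fun_prop
  · exact hm.comp (f := fun q : (ℝ × Vec N) × Vec N => (q.1.1, q.2)) (by fun_prop)

theorem measurable_oseenKernel (i j k : Fin N) :
    Measurable (fun p : ℝ × Vec N => oseenKernel p.1 i j k p.2) := by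
  unfold oseenKernel
  exact Complex.measurable_re.comp (stronglyMeasurable_fourierInv
    (m := fun s => oseenSymbol s i j k) (measurable_oseenSymbol i j k)).measurable

theorem fourierInv_scale {t : ℝ} (ht : 0 < t) {a b : Vec N → ℂ} {c : ℂ}
    (h : ∀ ξ, a (√t • ξ) = c * b ξ) (x : Vec N) :
    𝓕⁻ a x = t ^ ((N : ℝ) / 2) • (c * 𝓕⁻ b (√t • x)) := by
  rw [fourierInv_eq_integral, fourierInv_eq_integral, integral_scale ht, ← integral_const_mul]
  congr 2; ext ξ
  rw [h, inner_smul_left, inner_smul_right]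
  simp only [conj_trivial]
  ring

/-- Dilating a symbol does not change the `L¹` norm of its inverse transform, so only the
homogeneity factor `c` survives. This yields the rates `s^{-1/2}` for the Oseen kernel and
`s^{-3/2}` for the third derivatives of the heat kernel. -/
theorem integrable_fourierInv_scale {t : ℝ} (ht : 0 < t) {a b : Vec N → ℂ} {c : ℂ}
    (h : ∀ ξ, a (√t • ξ) = c * b ξ) (hb : Integrable (𝓕⁻ b)) :
    Integrable (𝓕⁻ a) ∧ ∫ x, ‖𝓕⁻ a x‖ = ‖c‖ * ∫ x, ‖𝓕⁻ b x‖ := by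
  have h1 : 𝓕⁻ a = fun x => t ^ ((N : ℝ) / 2) • (c * 𝓕⁻ b (√t • x)) :=
    funext (fourierInv_scale ht h)
  have hpos : (0 : ℝ) < t ^ ((N : ℝ) / 2) := by positivity
  constructor
  · rw [h1]
    have h2 : Integrable fun x => c * 𝓕⁻ b (√t • x) :=
      (hb.comp_smul (by positivity : √t ≠ 0)).const_mul c
    exact h2.smul (t ^ ((N : ℝ) / 2))
  · rw [h1]
    simp_rw [norm_smul, norm_mul, Real.norm_eq_abs, abs_of_pos hpos]
    rw [integral_const_mul, integral_const_mul, integral_scale ht (fun x => ‖𝓕⁻ b x‖), smul_eq_mul]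
    ring

theorem integrable_scale {t : ℝ} (ht : 0 < t) {a b : Vec N → ℂ} {c : ℂ}
    (h : ∀ ξ, a (√t • ξ) = c * b ξ) (hb : Integrable b) :
    Integrable a ∧ ∫ ξ, ‖a ξ‖ = t ^ ((N : ℝ) / 2) * (‖c‖ * ∫ ξ, ‖b ξ‖) := by
  constructor
  · rw [← integrable_comp_smul_iff volume a (by positivity : √t ≠ 0)]
    simp_rw [h]
    exact hb.const_mul c
  · rw [integral_scale ht]
    simp_rw [h, norm_mul]
    rw [integral_const_mul, smul_eq_mul]

theorem gauss_scale {t s : ℝ} (ht : 0 < t) (hs : t * s = 1) (ξ : Vec N) :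
    4 * Real.pi ^ 2 * s * ‖√t • ξ‖ ^ 2 = 4 * Real.pi ^ 2 * 1 * ‖ξ‖ ^ 2 := by
  rw [norm_smul, mul_pow, Real.norm_eq_abs, sq_abs, Real.sq_sqrt ht.le]
  linear_combination (4 * Real.pi ^ 2 * ‖ξ‖ ^ 2) * hs

theorem cubicSymbol_scale {t s : ℝ} (ht : 0 < t) (hs : t * s = 1) (i j k : Fin N) (ξ : Vec N) :
    cubicSymbol s i j k (√t • ξ) = ((√t ^ 3 : ℝ) : ℂ) * cubicSymbol 1 i j k ξ := by
  unfold cubicSymbol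
  rw [gauss_scale ht hs]
  simp only [PiLp.smul_apply, smul_eq_mul]
  push_cast; ring

theorem oseenSymbol_scale {t s : ℝ} (ht : 0 < t) (hs : t * s = 1) (i j k : Fin N) (ξ : Vec N) :
    oseenSymbol s i j k (√t • ξ) = ((√t : ℝ) : ℂ) * oseenSymbol 1 i j k ξ := by
  unfold oseenSymbol
  rw [gauss_scale ht hs]
  have h1 : (√t • ξ) i * (√t • ξ) j / ‖√t • ξ‖ ^ 2 = ξ i * ξ j / ‖ξ‖ ^ 2 := by
    rw [norm_smul, mul_pow, Real.norm_eq_abs, sq_abs]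
    simp only [PiLp.smul_apply, smul_eq_mul]
    have : √t ^ 2 ≠ 0 := by positivity
    rw [show √t * ξ i * (√t * ξ j) = √t ^ 2 * (ξ i * ξ j) by ring, mul_div_mul_left _ _ this]
  rw [h1]
  simp only [PiLp.smul_apply, smul_eq_mul]
  push_cast; ring

/-- The Gaussian as a complex valued Schwartz function. -/
def complexGaussian (N : ℕ) : 𝓢(Vec N, ℂ) :=
  SchwartzMap.postcompCLM Complex.ofRealCLM (gaussian N (4 * Real.pi ^ 2 * 1) (by positivity))

theorem hasTemperateGrowth_coord (i : Fin N) :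
    Function.HasTemperateGrowth (fun ξ : Vec N => ξ i) :=
  (EuclideanSpace.proj (𝕜 := ℝ) i : Vec N →L[ℝ] ℝ).hasTemperateGrowth

theorem integrable_fourierInv_schwartz {m : Vec N → ℂ} (S : 𝓢(Vec N, ℂ)) (h : ∀ ξ, m ξ = S ξ) :
    Integrable m ∧ Integrable (𝓕⁻ m) := by
  have : m = S := funext h
  rw [this]
  refine ⟨S.integrable, ?_⟩
  rw [← SchwartzMap.fourierInv_coe]
  exact SchwartzMap.integrable _

theorem integrable_cubicSymbol_one (i j k : Fin N) :
    Integrable (cubicSymbol 1 i j k) ∧ Integrable (𝓕⁻ (cubicSymbol 1 i j k)) := by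
  refine integrable_fourierInv_schwartz (((2 * Real.pi * Complex.I) ^ 3 : ℂ) •
    SchwartzMap.smulLeftCLM ℂ (fun ξ : Vec N => ξ i) (SchwartzMap.smulLeftCLM ℂ
      (fun ξ : Vec N => ξ j) (SchwartzMap.smulLeftCLM ℂ (fun ξ : Vec N => ξ k)
        (complexGaussian N)))) fun ξ => ?_
  rw [_root_.smul_apply, SchwartzMap.smulLeftCLM_apply_apply (hasTemperateGrowth_coord i),
    SchwartzMap.smulLeftCLM_apply_apply (hasTemperateGrowth_coord j),
    SchwartzMap.smulLeftCLM_apply_apply (hasTemperateGrowth_coord k)]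
  simp only [cubicSymbol, smul_eq_mul, Complex.real_smul]
  have : complexGaussian N ξ = (Real.exp (-(4 * Real.pi ^ 2 * 1 * ‖ξ‖ ^ 2)) : ℂ) := rfl
  rw [this]; push_cast; ring

theorem integrable_linearSymbol_one (k : Fin N) :
    Integrable (linearSymbol 1 k) ∧ Integrable (𝓕⁻ (linearSymbol 1 k)) := by
  refine integrable_fourierInv_schwartz (((2 * Real.pi * Complex.I) : ℂ) •
    (SchwartzMap.smulLeftCLM ℂ (fun ξ : Vec N => ξ k) (complexGaussian N))) fun ξ => ?_
  rw [_root_.smul_apply, SchwartzMap.smulLeftCLM_apply_apply (hasTemperateGrowth_coord k)]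
  simp only [linearSymbol, smul_eq_mul, Complex.real_smul]
  have : complexGaussian N ξ = (Real.exp (-(4 * Real.pi ^ 2 * 1 * ‖ξ‖ ^ 2)) : ℂ) := rfl
  rw [this]; ring

theorem integrable_cubicSymbol_prod (i j k : Fin N) :
    Integrable (fun p : ℝ × Vec N => cubicSymbol p.1 i j k p.2)
      ((volume.restrict (Ioi 1)).prod volume) := by
  rw [integrable_prod_iff (measurable_cubicSymbol i j k).aestronglyMeasurable]
  have key : ∀ s ∈ Ioi (1 : ℝ), Integrable (cubicSymbol s i j k) ∧
      ∫ ξ, ‖cubicSymbol s i j k ξ‖ =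
        s ^ (-((N : ℝ) + 3) / 2) * ∫ ξ, ‖cubicSymbol 1 i j k ξ‖ := by
    intro s hs
    have hs0 : 0 < s := one_pos.trans hs
    have hs1 : s⁻¹ * s = 1 := inv_mul_cancel₀ hs0.ne'
    have := integrable_scale (inv_pos.mpr hs0) (cubicSymbol_scale (inv_pos.mpr hs0) hs1 i j k)
      (integrable_cubicSymbol_one i j k).1
    refine ⟨this.1, this.2.trans ?_⟩
    rw [← mul_assoc]
    congr 1
    rw [Complex.norm_real, Real.norm_eq_abs, abs_of_nonneg (by positivity),
      sqrt_pow_eq (inv_pos.mpr hs0), ← Real.rpow_add (inv_pos.mpr hs0), Real.inv_rpow hs0.le,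
      ← Real.rpow_neg hs0.le]
    congr 1; push_cast; ring
  constructor
  · filter_upwards [ae_restrict_mem measurableSet_Ioi] with s hs using (key s hs).1
  · have : IntegrableOn (fun s : ℝ => s ^ (-((N : ℝ) + 3) / 2) * ∫ ξ, ‖cubicSymbol 1 i j k ξ‖)
        (Ioi 1) := by
      refine Integrable.mul_const ?_ _
      refine integrableOn_Ioi_rpow_of_lt ?_ one_pos
      have : (0 : ℝ) ≤ N := Nat.cast_nonneg N
      linarith
    refine this.congr ?_
    filter_upwards [ae_restrict_mem measurableSet_Ioi] with s hs using (key s hs).2.symm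

/-- By scaling the `L¹` norm at time `s` is a constant times `s^{-3/2}`, which is integrable on
`(1,∞)`. -/
theorem integrable_fourierInv_cubicSymbol_prod (i j k : Fin N) :
    Integrable (fun p : ℝ × Vec N => 𝓕⁻ (cubicSymbol p.1 i j k) p.2)
      ((volume.restrict (Ioi 1)).prod volume) := by
  rw [integrable_prod_iff (stronglyMeasurable_fourierInv (m := fun s => cubicSymbol s i j k)
    (measurable_cubicSymbol i j k)).aestronglyMeasurable]
  have key : ∀ s ∈ Ioi (1 : ℝ), Integrable (𝓕⁻ (cubicSymbol s i j k)) ∧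
      ∫ ξ, ‖𝓕⁻ (cubicSymbol s i j k) ξ‖ =
        s ^ (-(3 : ℝ) / 2) * ∫ ξ, ‖𝓕⁻ (cubicSymbol 1 i j k) ξ‖ := by
    intro s hs
    have hs0 : 0 < s := one_pos.trans hs
    have hs1 : s⁻¹ * s = 1 := inv_mul_cancel₀ hs0.ne'
    have := integrable_fourierInv_scale (inv_pos.mpr hs0)
      (cubicSymbol_scale (inv_pos.mpr hs0) hs1 i j k) (integrable_cubicSymbol_one i j k).2
    refine ⟨this.1, this.2.trans ?_⟩
    congr 1
    rw [Complex.norm_real, Real.norm_eq_abs, abs_of_nonneg (by positivity),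
      sqrt_pow_eq (inv_pos.mpr hs0), Real.inv_rpow hs0.le, ← Real.rpow_neg hs0.le]
    congr 1; push_cast; ring
  constructor
  · filter_upwards [ae_restrict_mem measurableSet_Ioi] with s hs using (key s hs).1
  · have : IntegrableOn (fun s : ℝ => s ^ (-(3 : ℝ) / 2) *
        ∫ ξ, ‖𝓕⁻ (cubicSymbol 1 i j k) ξ‖) (Ioi 1) :=
      Integrable.mul_const (integrableOn_Ioi_rpow_of_lt (by norm_num) one_pos) _
    refine this.congr ?_
    filter_upwards [ae_restrict_mem measurableSet_Ioi] with s hs using (key s hs).2.symm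

/-- The identity `(-Δ)^{-1} e^Δ = ∫_1^∞ e^{sΔ} ds` on the Fourier side. It removes the singular
factor `1/‖ξ‖²` of the Helmholtz projection. -/
theorem integral_cubicSymbol (i j k : Fin N) (ξ : Vec N) :
    ∫ s in Ioi (1 : ℝ), cubicSymbol s i j k ξ =
      -(2 * Real.pi * Complex.I) * ((ξ i * ξ j / ‖ξ‖ ^ 2 * ξ k : ℝ) : ℂ) *
        (Real.exp (-(4 * Real.pi ^ 2 * 1 * ‖ξ‖ ^ 2)) : ℂ) := by
  unfold cubicSymbol
  by_cases hξ : ξ = 0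
  · subst hξ; simp
  have hn : 0 < ‖ξ‖ := norm_pos_iff.mpr hξ
  rw [integral_const_mul, integral_complex_ofReal]
  have ha : -(4 * Real.pi ^ 2 * ‖ξ‖ ^ 2) < 0 := by
    have : 0 < 4 * Real.pi ^ 2 * ‖ξ‖ ^ 2 := by positivity
    linarith
  have h1 : ∀ s : ℝ, Real.exp (-(4 * Real.pi ^ 2 * s * ‖ξ‖ ^ 2)) =
      Real.exp (-(4 * Real.pi ^ 2 * ‖ξ‖ ^ 2) * s) := fun s => by congr 1; ring
  simp_rw [h1]
  rw [integral_exp_mul_Ioi ha]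
  have hI := Complex.I_sq
  have hn' : (‖ξ‖ : ℂ) ≠ 0 := by exact_mod_cast hn.ne'
  have hpi : (Real.pi : ℂ) ≠ 0 := by exact_mod_cast Real.pi_ne_zero
  push_cast
  field_simp
  linear_combination (4 * (ξ i : ℂ) * ξ j * ξ k) * hI

theorem oseenSymbol_one_eq (i j k : Fin N) (ξ : Vec N) :
    oseenSymbol 1 i j k ξ = (if i = j then (1 : ℂ) else 0) * linearSymbol 1 k ξ +
      ∫ s in Ioi (1 : ℝ), cubicSymbol s i j k ξ := by
  rw [integral_cubicSymbol]
  unfold oseenSymbol linearSymbol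
  push_cast
  split_ifs <;> push_cast <;> ring

theorem integrable_oseenSymbol_one (i j k : Fin N) : Integrable (oseenSymbol 1 i j k) := by
  have : oseenSymbol 1 i j k = fun ξ => (if i = j then (1 : ℂ) else 0) * linearSymbol 1 k ξ +
      ∫ s in Ioi (1 : ℝ), cubicSymbol s i j k ξ := funext (oseenSymbol_one_eq i j k)
  rw [this]
  exact ((integrable_linearSymbol_one k).1.const_mul _).add
    (integrable_cubicSymbol_prod i j k).integral_prod_right

/-- The symbol is not smooth at the origin, so the kernel is not Schwartz. By `oseenSymbol_one_eq`
it is a Schwartz part plus `∫_1^∞ ∂_i ∂_j ∂_k G_s ds`, and the latter converges in `L¹`. -/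
theorem integrable_fourierInv_oseenSymbol_one (i j k : Fin N) :
    Integrable (𝓕⁻ (oseenSymbol 1 i j k)) := by
  have h1 : ∀ x, 𝓕⁻ (oseenSymbol 1 i j k) x =
      (if i = j then (1 : ℂ) else 0) * 𝓕⁻ (linearSymbol 1 k) x +
        ∫ s in Ioi (1 : ℝ), 𝓕⁻ (cubicSymbol s i j k) x := by
    intro x
    simp_rw [fourierInv_eq_integral, oseenSymbol_one_eq, mul_add]
    have hb : ∀ {m : Vec N → ℂ}, Integrable m → Integrable fun ξ =>
        Complex.exp (2 * Real.pi * Complex.I * inner ℝ ξ x) * m ξ := fun hm =>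
      hm.bdd_mul (c := 1) (Continuous.aestronglyMeasurable (by fun_prop))
        (Eventually.of_forall fun ξ => (norm_char ξ x).le)
    rw [integral_add (hb ((integrable_linearSymbol_one k).1.const_mul _))
      (hb (integrable_cubicSymbol_prod i j k).integral_prod_right)]
    congr 1
    · rw [← integral_const_mul]; congr 1; ext ξ; ring
    · simp_rw [← integral_const_mul]
      refine integral_integral_swap ?_
      have h2 := (integrable_cubicSymbol_prod i j k).swap
      exact h2.bdd_mul (c := 1) (f := fun p : Vec N × ℝ =>
          Complex.exp (2 * Real.pi * Complex.I * inner ℝ p.1 x))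
        (Continuous.aestronglyMeasurable (by fun_prop))
        (Eventually.of_forall fun p => (norm_char p.1 x).le)
  have : 𝓕⁻ (oseenSymbol 1 i j k) = fun x =>
      (if i = j then (1 : ℂ) else 0) * 𝓕⁻ (linearSymbol 1 k) x +
        ∫ s in Ioi (1 : ℝ), 𝓕⁻ (cubicSymbol s i j k) x := funext h1
  rw [this]
  exact ((integrable_linearSymbol_one k).2.const_mul _).add
    (integrable_fourierInv_cubicSymbol_prod i j k).integral_prod_right

theorem integrable_oseenSymbol {s : ℝ} (hs : 0 < s) (i j k : Fin N) : Integrable (oseenSymbol s i j k) :=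
  (integrable_scale (inv_pos.mpr hs)
    (oseenSymbol_scale (inv_pos.mpr hs) (inv_mul_cancel₀ hs.ne') i j k)
    (integrable_oseenSymbol_one i j k)).1

theorem integrable_fourierInv_oseenSymbol {s : ℝ} (hs : 0 < s) (i j k : Fin N) :
    Integrable (𝓕⁻ (oseenSymbol s i j k)) ∧
    ∫ x, ‖𝓕⁻ (oseenSymbol s i j k) x‖ = (√s)⁻¹ * ∫ x, ‖𝓕⁻ (oseenSymbol 1 i j k) x‖ := by
  have := integrable_fourierInv_scale (inv_pos.mpr hs)
    (oseenSymbol_scale (inv_pos.mpr hs) (inv_mul_cancel₀ hs.ne') i j k)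
    (integrable_fourierInv_oseenSymbol_one i j k)
  rwa [Complex.norm_real, Real.norm_eq_abs, abs_of_nonneg (by positivity), Real.sqrt_inv] at this

theorem integrable_oseenKernel {s : ℝ} (hs : 0 < s) (i j k : Fin N) : Integrable (oseenKernel s i j k) :=
  (integrable_fourierInv_oseenSymbol hs i j k).1.re

theorem integral_abs_oseenKernel_le {s : ℝ} (hs : 0 < s) (i j k : Fin N) :
    ∫ x, |oseenKernel s i j k x| ≤ (√s)⁻¹ * ∫ x, ‖𝓕⁻ (oseenSymbol 1 i j k) x‖ := by
  rw [← (integrable_fourierInv_oseenSymbol hs i j k).2]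
  refine integral_mono (integrable_oseenKernel hs i j k).abs
    (integrable_fourierInv_oseenSymbol hs i j k).1.norm fun x => ?_
  exact Complex.abs_re_le_norm _

theorem gk_conv_oseenKernel {s : ℝ} (hs : 0 < s) (i j k : Fin N) {r : ℝ} (hr : 0 < r)
    (x : Vec N) :
    ∫ y, gk r (x - y) * oseenKernel s i j k y = oseenKernel (r + s) i j k x := by
  have h := gk_conv_fourierInv hr (integrable_oseenSymbol hs i j k) x
  have h2 : (fun ξ : Vec N => (Real.exp (-(4 * Real.pi ^ 2 * r * ‖ξ‖ ^ 2)) : ℂ) *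
      oseenSymbol s i j k ξ) = oseenSymbol (r + s) i j k := by
    ext ξ
    unfold oseenSymbol
    rw [mul_left_comm, ← Complex.ofReal_mul, ← Real.exp_add]
    congr 4; ring
  rw [h2] at h
  unfold oseenKernel
  rw [← h]
  have hi : Integrable fun y => (gk r (x - y) : ℂ) * 𝓕⁻ (oseenSymbol s i j k) y := by
    refine (integrable_fourierInv_oseenSymbol hs i j k).1.bdd_mul
      (c := (4 * Real.pi * r) ^ (-(N : ℝ) / 2)) ?_ (Eventually.of_forall fun y => ?_)
    · exact (Complex.continuous_ofReal.comp ((continuous_gk r).comp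
        (continuous_const.sub continuous_id))).aestronglyMeasurable
    · rw [Complex.norm_real, Real.norm_eq_abs, abs_of_nonneg (gk_nonneg hr _), gk]
      refine mul_le_of_le_one_right (by positivity) ?_
      rw [Real.exp_le_one_iff, neg_nonpos]; positivity
  refine Eq.trans ?_ (Complex.reCLM.integral_comp_comm hi)
  congr 1; ext1 y
  simp

end Oseen


/-! ### The Oseen kernel is divergence free. -/

section DivKernel

variable {N : ℕ}

/-- The projection annihilates gradients: `∑_i ξ_i (δ_ij - ξ_i ξ_j / ‖ξ‖²) = 0`. At `ξ = 0`, where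
the quotient is a default value, the factors `ξ_i` vanish. -/
theorem sum_coord_mul_oseenSymbol (s : ℝ) (j k : Fin N) (ξ : Vec N) :
    ∑ i, (ξ i : ℂ) * oseenSymbol s i j k ξ = 0 := by
  by_cases hξ : ξ = 0
  · subst hξ; simp
  have hn : (‖ξ‖ : ℂ) ^ 2 ≠ 0 := by
    have : ‖ξ‖ ≠ 0 := norm_ne_zero_iff.mpr hξ
    exact pow_ne_zero 2 (by exact_mod_cast this)
  have h1 : ∀ i, (ξ i : ℂ) * oseenSymbol s i j k ξ =
      (2 * Real.pi * Complex.I * (ξ k : ℂ) *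
      (Real.exp (-(4 * Real.pi ^ 2 * s * ‖ξ‖ ^ 2)) : ℂ)) *
      ((if i = j then (ξ i : ℂ) else 0) - (ξ i : ℂ) ^ 2 * ((ξ j : ℂ) / (‖ξ‖ : ℂ) ^ 2)) := by
    intro i
    unfold oseenSymbol
    split_ifs <;> push_cast <;> ring
  simp_rw [h1]
  rw [← Finset.mul_sum, Finset.sum_sub_distrib, Finset.sum_ite_eq' Finset.univ j, ← Finset.sum_mul]
  have h2 : ∑ i, (ξ i : ℂ) ^ 2 = (‖ξ‖ : ℂ) ^ 2 := by
    have := EuclideanSpace.real_norm_sq_eq ξ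
    exact_mod_cast this.symm
  rw [h2]
  simp only [Finset.mem_univ, if_true]
  rw [mul_div_cancel₀ _ hn, sub_self, mul_zero]

theorem integral_schwartz_mul_fourierInv (χ : 𝓢(Vec N, ℂ)) {m : Vec N → ℂ} (hm : Integrable m) :
    ∫ y, χ y * 𝓕⁻ m y = ∫ ξ, 𝓕⁻ χ ξ * m ξ := by
  simp_rw [SchwartzMap.fourierInv_coe, fourierInv_eq_integral, ← integral_const_mul,
    ← integral_mul_const]
  rw [integral_integral_swap]
  · congr 1; ext ξ; congr 1; ext y
    rw [real_inner_comm]; ring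
  · have h1 : Integrable (fun p : Vec N × Vec N => χ p.1 * m p.2) (volume.prod volume) :=
      χ.integrable.mul_prod hm
    have h2 := h1.bdd_mul (c := 1) (f := fun p : Vec N × Vec N =>
        Complex.exp (2 * Real.pi * Complex.I * inner ℝ p.2 p.1))
      (Continuous.aestronglyMeasurable (by fun_prop))
      (Eventually.of_forall fun p => (norm_char _ _).le)
    refine h2.congr (Eventually.of_forall fun p => ?_)
    simp only [Function.uncurry]; ring

theorem postcomp_ofReal_lineDeriv (ψ : 𝓢(Vec N, ℝ)) (v : Vec N) :
    SchwartzMap.postcompCLM Complex.ofRealCLM (∂_{v} ψ) =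
      ∂_{v} (SchwartzMap.postcompCLM Complex.ofRealCLM ψ) := by
  ext x
  rw [SchwartzMap.postcompCLM_apply, SchwartzMap.lineDerivOp_apply_eq_fderiv,
    SchwartzMap.lineDerivOp_apply_eq_fderiv]
  have h : (SchwartzMap.postcompCLM Complex.ofRealCLM ψ : Vec N → ℂ) =
      Complex.ofRealCLM ∘ ψ := by
    ext y; simp
  rw [h, (Complex.ofRealCLM.hasFDerivAt.comp x (ψ.hasFDerivAt x)).fderiv]
  rfl

/-- Moving the inverse transform onto the test function turns `∂_i` into `-2πi ξ_i`, and the sum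
over `i` then vanishes under the integral by `sum_coord_mul_oseenSymbol`. -/
theorem sum_integral_lineDeriv_mul_oseenKernel {s : ℝ} (hs : 0 < s) (j k : Fin N)
    (ψ : 𝓢(Vec N, ℝ)) :
    ∑ i, ∫ y, (∂_{EuclideanSpace.single i (1 : ℝ)} ψ) y * oseenKernel s i j k y = 0 := by
  set Ψ := SchwartzMap.postcompCLM Complex.ofRealCLM ψ with hΨ
  have h1 : ∀ i, ∫ y, (∂_{EuclideanSpace.single i (1 : ℝ)} ψ) y * oseenKernel s i j k y =
      (∫ ξ, -(2 * Real.pi * Complex.I) * 𝓕⁻ Ψ ξ * ((ξ i : ℂ) * oseenSymbol s i j k ξ)).re := by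
    intro i
    set χ := SchwartzMap.postcompCLM Complex.ofRealCLM (∂_{EuclideanSpace.single i (1 : ℝ)} ψ)
    have e1 := integral_schwartz_mul_fourierInv χ (integrable_oseenSymbol hs i j k)
    have e2 : ∀ ξ, 𝓕⁻ χ ξ * oseenSymbol s i j k ξ =
        -(2 * Real.pi * Complex.I) * 𝓕⁻ Ψ ξ * ((ξ i : ℂ) * oseenSymbol s i j k ξ) := by
      intro ξ
      simp only [χ]
      have hg : (fun y : Vec N => inner ℝ y (EuclideanSpace.single i (1 : ℝ))).HasTemperateGrowth :=
        by fun_prop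
      rw [postcomp_ofReal_lineDeriv, SchwartzMap.fourierInv_lineDerivOp_eq, _root_.smul_apply,
        SchwartzMap.smulLeftCLM_apply_apply hg, EuclideanSpace.inner_single_right]
      simp only [smul_eq_mul, Complex.real_smul, conj_trivial, one_mul]
      ring
    simp_rw [e2] at e1
    rw [← e1]
    have hi : Integrable fun y => χ y * 𝓕⁻ (oseenSymbol s i j k) y := by
      refine (integrable_fourierInv_oseenSymbol hs i j k).1.bdd_mul
        (c := SchwartzMap.seminorm ℝ 0 0 χ) χ.continuous.aestronglyMeasurable
        (Eventually.of_forall fun y => χ.norm_le_seminorm ℝ y)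
    refine Eq.trans ?_ (Complex.reCLM.integral_comp_comm hi)
    congr 1; ext1 y
    simp [χ, oseenKernel]
  simp_rw [h1]
  rw [← Complex.re_sum, ← integral_finsetSum]
  · simp_rw [← Finset.mul_sum, sum_coord_mul_oseenSymbol]
    simp
  · intro i _
    have hg : (fun y : Vec N => inner ℝ y (EuclideanSpace.single i (1 : ℝ))).HasTemperateGrowth :=
        by fun_prop
    have h2 : Integrable fun ξ => (-(2 * Real.pi * Complex.I) •
        SchwartzMap.smulLeftCLM ℂ (fun ξ : Vec N => ξ i) (𝓕⁻ Ψ)) ξ * oseenSymbol s i j k ξ := by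
      refine (integrable_oseenSymbol hs i j k).bdd_mul
        (c := SchwartzMap.seminorm ℝ 0 0 (-(2 * Real.pi * Complex.I) •
        SchwartzMap.smulLeftCLM ℂ (fun ξ : Vec N => ξ i) (𝓕⁻ Ψ)))
        (SchwartzMap.continuous _).aestronglyMeasurable
        (Eventually.of_forall fun y => SchwartzMap.norm_le_seminorm ℝ _ y)
    refine h2.congr (Eventually.of_forall fun ξ => ?_)
    simp only [_root_.smul_apply]
    rw [SchwartzMap.smulLeftCLM_apply_apply (hasTemperateGrowth_coord i)]
    simp only [smul_eq_mul, Complex.real_smul]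
    ring

theorem lineDeriv_compSubConst (ψ : 𝓢(Vec N, ℝ)) (v x y : Vec N) :
    (∂_{v} (SchwartzMap.compSubConstCLM ℝ x ψ)) y = (∂_{v} ψ) (y - x) := by
  rw [SchwartzMap.lineDerivOp_apply_eq_fderiv, SchwartzMap.lineDerivOp_apply_eq_fderiv]
  have h : (SchwartzMap.compSubConstCLM ℝ x ψ : Vec N → ℝ) = fun y => ψ (y - x) := by
    ext y; simp
  have h2 := (ψ.hasFDerivAt (y - x)).comp y ((hasFDerivAt_id y).sub_const x)
  rw [ContinuousLinearMap.comp_id] at h2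
  rw [h]
  exact congrArg (fun L : Vec N →L[ℝ] ℝ => L v) h2.fderiv

end DivKernel

/-! ### The operator `e^{sΔ} ℙ ∇ ·` on bounded matrix fields -/

section HeatLerayDiv

variable {N : ℕ} {s r M : ℝ} {F G : Vec N → Matrix (Fin N) (Fin N) ℝ}

/-- The sum of the `L¹` norms of the Oseen kernels at time one. -/
def oseenConst (N : ℕ) : ℝ :=
  ∑ i : Fin N, ∑ j : Fin N, ∑ k : Fin N, ∫ x, ‖𝓕⁻ (oseenSymbol 1 i j k) x‖

theorem oseenConst_nonneg (N : ℕ) : 0 ≤ oseenConst N :=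
  Finset.sum_nonneg fun _ _ => Finset.sum_nonneg fun _ _ => Finset.sum_nonneg fun _ _ =>
    integral_nonneg fun _ => norm_nonneg _

theorem norm_le_sum_abs (v : Vec N) : ‖v‖ ≤ ∑ i, |v i| := by
  have h : v = ∑ i, v i • EuclideanSpace.basisFun (Fin N) ℝ i := by
    have := ((EuclideanSpace.basisFun (Fin N) ℝ).sum_repr v).symm
    simpa using this
  nth_rw 1 [h]
  refine (norm_sum_le _ _).trans (Finset.sum_le_sum fun i _ => ?_)
  rw [norm_smul, (EuclideanSpace.basisFun (Fin N) ℝ).norm_eq_one, mul_one, Real.norm_eq_abs]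

theorem norm_heatLerayDiv_le (hs : 0 < s) (hM0 : 0 ≤ M) (hM : ∀ᵐ y, ∀ j k, |F y j k| ≤ M)
    (x : Vec N) : ‖heatLerayDiv s F x‖ ≤ oseenConst N * (√s)⁻¹ * M := by
  refine (norm_le_sum_abs _).trans ?_
  unfold oseenConst
  rw [Finset.sum_mul, Finset.sum_mul]
  refine Finset.sum_le_sum fun i _ => ?_
  simp only [heatLerayDiv]
  refine (Finset.abs_sum_le_sum_abs _ _).trans ?_
  rw [Finset.sum_mul, Finset.sum_mul]
  refine Finset.sum_le_sum fun j _ => ?_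
  refine (Finset.abs_sum_le_sum_abs _ _).trans ?_
  rw [Finset.sum_mul, Finset.sum_mul]
  refine Finset.sum_le_sum fun k _ => ?_
  have h := norm_kernel_integral_le (integrable_oseenKernel hs i j k)
    (f := fun y => F y j k) (M := M) (by filter_upwards [hM] with y hy using hy j k) x
  simp only [smul_eq_mul, Real.norm_eq_abs] at h
  refine h.trans (mul_le_mul_of_nonneg_right ?_ hM0)
  rw [mul_comm]
  exact integral_abs_oseenKernel_le hs i j k

theorem heatLerayDiv_congr (h : F =ᵐ[volume] G) (x : Vec N) :
    heatLerayDiv s F x = heatLerayDiv s G x := by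
  unfold heatLerayDiv
  congr 1; ext i
  refine Finset.sum_congr rfl fun j _ => Finset.sum_congr rfl fun k _ => integral_congr_ae ?_
  filter_upwards [h] with y hy
  rw [hy]

theorem heatLerayDiv_sub {M' : ℝ} (hs : 0 < s)
    (hF : ∀ j k, Measurable fun y => F y j k) (hM : ∀ y j k, |F y j k| ≤ M)
    (hG : ∀ j k, Measurable fun y => G y j k) (hM' : ∀ y j k, |G y j k| ≤ M') (x : Vec N) :
    heatLerayDiv s (fun y => F y - G y) x = heatLerayDiv s F x - heatLerayDiv s G x := by
  unfold heatLerayDiv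
  ext i
  simp only [PiLp.sub_apply, ← Finset.sum_sub_distrib]
  refine Finset.sum_congr rfl fun j _ => Finset.sum_congr rfl fun k _ => ?_
  have h1 := integrable_kernel_smul (integrable_oseenKernel hs i j k)
    (hF j k).aestronglyMeasurable (Eventually.of_forall fun y => hM y j k) x
  have h2 := integrable_kernel_smul (integrable_oseenKernel hs i j k)
    (hG j k).aestronglyMeasurable (Eventually.of_forall fun y => hM' y j k) x
  simp only [smul_eq_mul] at h1 h2
  rw [← integral_sub h1 h2]
  simp_rw [← mul_sub]
  rfl

theorem stronglyMeasurable_heatLerayDiv {H : ℝ → Vec N → Matrix (Fin N) (Fin N) ℝ}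
    (hH : ∀ j k, Measurable fun p : ℝ × Vec N => H p.1 p.2 j k) :
    StronglyMeasurable fun q : (ℝ × Vec N) × ℝ => heatLerayDiv q.1.1 (H q.2) q.1.2 := by
  refine Measurable.stronglyMeasurable ?_
  unfold heatLerayDiv
  refine (PiLp.continuous_toLp 2 (fun _ : Fin N => ℝ)).measurable.comp ?_
  refine measurable_pi_lambda _ fun i => Finset.measurable_sum _ fun j _ =>
    Finset.measurable_sum _ fun k _ => ?_
  refine (StronglyMeasurable.integral_prod_right' (f := fun q : ((ℝ × Vec N) × ℝ) × Vec N =>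
    oseenKernel q.1.1.1 i j k (q.1.1.2 - q.2) * H q.1.2 q.2 j k) ?_).measurable
  refine (Measurable.mul ?_ ?_).stronglyMeasurable
  · exact (measurable_oseenKernel i j k).comp
      (f := fun q : ((ℝ × Vec N) × ℝ) × Vec N => (q.1.1.1, q.1.1.2 - q.2)) (by fun_prop)
  · exact (hH j k).comp (f := fun q : ((ℝ × Vec N) × ℝ) × Vec N => (q.1.2, q.2)) (by fun_prop)

theorem measurable_heatLerayDiv (hF : ∀ j k, Measurable fun y => F y j k) :
    Measurable (heatLerayDiv s F) :=
  (stronglyMeasurable_heatLerayDiv (H := fun _ => F)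
    (fun j k => (hF j k).comp measurable_snd)).measurable.comp
    (g := fun q : (ℝ × Vec N) × ℝ => heatLerayDiv q.1.1 F q.1.2)
    (f := fun x : Vec N => ((s, x), (0 : ℝ))) (by fun_prop)

theorem integral_apply_coord {α : Type*} [MeasurableSpace α] {μ : Measure α} {f : α → Vec N}
    (hf : Integrable f μ) (i : Fin N) : (∫ a, f a ∂μ) i = ∫ a, f a i ∂μ :=
  ((EuclideanSpace.proj (𝕜 := ℝ) i : Vec N →L[ℝ] ℝ).integral_comp_comm hf).symm

theorem integral_kernel_heatLerayDiv (hs : 0 < s) (hF : ∀ j k, Measurable fun y => F y j k)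
    (hM : ∀ y j k, |F y j k| ≤ M) {k₀ : Vec N → ℝ} (hk : Integrable k₀) (x : Vec N) (i : Fin N) :
    ∫ y, k₀ (x - y) * heatLerayDiv s F y i =
      ∑ j, ∑ k, ∫ z, (∫ y, k₀ (x - z - y) * oseenKernel s i j k y) * F z j k := by
  unfold heatLerayDiv
  simp only [Finset.mul_sum]
  have hi : ∀ j k, Integrable fun y =>
      k₀ (x - y) * ∫ z, oseenKernel s i j k (y - z) * F z j k := by
    intro j k
    refine integrable_kernel_smul hk (f := fun y => ∫ z, oseenKernel s i j k (y - z) * F z j k)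
      (M := (∫ y, |oseenKernel s i j k y|) * M) ?_ (Eventually.of_forall fun y => ?_) x
    · refine (StronglyMeasurable.integral_prod_right' (f := fun q : Vec N × Vec N =>
        oseenKernel s i j k (q.1 - q.2) * F q.2 j k) ?_).aestronglyMeasurable
      refine (Measurable.mul ?_ ((hF j k).comp measurable_snd)).stronglyMeasurable
      exact (measurable_oseenKernel i j k).comp
        (f := fun q : Vec N × Vec N => (s, q.1 - q.2)) (by fun_prop)
    · exact norm_kernel_integral_le (integrable_oseenKernel hs i j k) (f := fun y => F y j k)
        (Eventually.of_forall fun y => hM y j k) y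
  rw [integral_finsetSum _ fun j _ => integrable_finsetSum _ fun k _ => hi j k]
  refine Finset.sum_congr rfl fun j _ => ?_
  rw [integral_finsetSum _ fun k _ => hi j k]
  refine Finset.sum_congr rfl fun k _ => ?_
  exact kernel_integral_comp hk (integrable_oseenKernel hs i j k) (fun _ => rfl)
    (f := fun y => F y j k) (hF j k).aestronglyMeasurable (Eventually.of_forall fun y => hM y j k) x

/-- The semigroup law transferred to the bounded field through `gk_conv_oseenKernel`; it lets the
heat flow act inside the Duhamel integral. -/
theorem hs_heatLerayDiv (hr : 0 < r) (hs' : 0 < s) (hF : ∀ j k, Measurable fun y => F y j k)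
    (hM0 : 0 ≤ M) (hM : ∀ y j k, |F y j k| ≤ M) (x : Vec N) :
    hs r (heatLerayDiv s F) x = heatLerayDiv (r + s) F x := by
  ext i
  unfold hs
  rw [integral_apply_coord (integrable_kernel_smul (integrable_gk hr)
    (measurable_heatLerayDiv hF).aestronglyMeasurable
    (Eventually.of_forall (norm_heatLerayDiv_le hs' hM0 (Eventually.of_forall hM))) x)]
  simp only [PiLp.smul_apply, smul_eq_mul]
  rw [integral_kernel_heatLerayDiv hs' hF hM (integrable_gk hr)]
  simp only [gk_conv_oseenKernel hs' _ _ _ hr]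
  rfl

/-- Fubini transfers the test function to the kernel: for each point `z` the inner integrals test
the Oseen kernel against a translate of `ψ`. -/
theorem sum_integral_lineDeriv_mul_heatLerayDiv (hs : 0 < s)
    (hF : ∀ j k, Measurable fun y => F y j k) (hM : ∀ y j k, |F y j k| ≤ M) (ψ : 𝓢(Vec N, ℝ)) :
    ∑ i, ∫ y, (∂_{EuclideanSpace.single i (1 : ℝ)} ψ) y * heatLerayDiv s F y i = 0 := by
  have h1 : ∀ i, ∫ y, (∂_{EuclideanSpace.single i (1 : ℝ)} ψ) y * heatLerayDiv s F y i =
      ∑ j, ∑ k, ∫ z, (∫ y, (∂_{EuclideanSpace.single i (1 : ℝ)} ψ) (y + z) *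
        oseenKernel s i j k y) * F z j k := by
    intro i
    -- The pairing is read as a convolution with the reflected test function, evaluated at `0`.
    have := integral_kernel_heatLerayDiv hs hF hM
      (k₀ := fun y => (∂_{EuclideanSpace.single i (1 : ℝ)} ψ) (-y))
      (SchwartzMap.integrable _).comp_neg 0 i
    simp only [zero_sub, neg_neg, neg_sub, sub_neg_eq_add] at this
    exact this
  have h3 : ∀ (i j k : Fin N), Integrable fun z =>
      (∫ y, (∂_{EuclideanSpace.single i (1 : ℝ)} ψ) (y + z) * oseenKernel s i j k y) *
        F z j k := by
    intro i j k
    have hint : Integrable fun z =>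
        ∫ y, (∂_{EuclideanSpace.single i (1 : ℝ)} ψ) (y + z) * oseenKernel s i j k y := by
      have := (Integrable.convolution_integrand (ContinuousLinearMap.mul ℝ ℝ)
        (integrable_oseenKernel hs i j k).comp_neg
        (SchwartzMap.integrable (μ := volume) (∂_{EuclideanSpace.single i (1 : ℝ)} ψ))
        ).integral_prod_left
      refine this.congr (Eventually.of_forall fun z => ?_)
      simp only [ContinuousLinearMap.mul_apply']
      rw [← integral_neg_eq_self]
      congr 1; ext1 y
      rw [neg_neg, mul_comm]; congr 2; abel
    refine hint.mul_bdd (c := M) (hF j k).aestronglyMeasurable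
      (Eventually.of_forall fun y => hM y j k)
  simp_rw [h1]
  rw [Finset.sum_comm]
  refine Finset.sum_eq_zero fun j _ => ?_
  rw [Finset.sum_comm]
  refine Finset.sum_eq_zero fun k _ => ?_
  rw [← integral_finsetSum _ fun i _ => h3 i j k]
  simp_rw [← Finset.sum_mul]
  have h2 : ∀ z : Vec N, ∑ i, ∫ y, (∂_{EuclideanSpace.single i (1 : ℝ)} ψ) (y + z) *
      oseenKernel s i j k y = 0 := by
    intro z
    have := sum_integral_lineDeriv_mul_oseenKernel hs j k (SchwartzMap.compSubConstCLM ℝ (-z) ψ)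
    simp only [lineDeriv_compSubConst, sub_neg_eq_add] at this
    exact this
  simp [h2]

end HeatLerayDiv


/-! ### The logarithmic weight and the time integrals -/

/-- `2 + ln (T / t)`. -/
def ell (T t : ℝ) : ℝ := 2 + Real.log T - Real.log t

section Weight

variable {S T s t τ : ℝ}

theorem two_le_ell (ht : 0 < t) (htT : t ≤ T) : 2 ≤ ell T t := by
  unfold ell
  linarith [Real.log_le_log ht htT]

theorem ell_pos (ht : 0 < t) (htT : t ≤ T) : 0 < ell T t :=
  two_pos.trans_le (two_le_ell ht htT)

theorem ell_anti (hs : 0 < s) (hst : s ≤ t) : ell T t ≤ ell T s := by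
  unfold ell
  linarith [Real.log_le_log hs hst]

theorem weight_eq (ht : 0 < t) (htT : t ≤ T) : weight T t = √t * ell T t := by
  have hT : 0 < T := ht.trans_le htT
  unfold weight
  rw [Real.log_div ht.ne' (by positivity), Real.log_mul (Real.exp_pos 2).ne' hT.ne', Real.log_exp,
    abs_of_nonpos (by have := two_le_ell ht htT; unfold ell at this; linarith)]
  unfold ell; ring

theorem weight_pos (ht : 0 < t) (htT : t ≤ T) : 0 < weight T t := by
  rw [weight_eq ht htT]
  exact mul_pos (Real.sqrt_pos.mpr ht) (ell_pos ht htT)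

theorem weight_nonneg : 0 ≤ weight T t := mul_nonneg (Real.sqrt_nonneg _) (abs_nonneg _)

/-- The constant `e²` in the weight is what makes this true: the derivative of `√t ell T t` is `(ell
T t - 2) / (2√t)`, and `ell T t ≥ 2` on `(0,T]`. The proof uses `log r ≤ r - 1` with `r = √t / √s`
instead. -/
theorem weight_mono (hs : 0 < s) (hst : s ≤ t) (htT : t ≤ T) : weight T s ≤ weight T t := by
  have ht : 0 < t := hs.trans_le hst
  rw [weight_eq hs (hst.trans htT), weight_eq ht htT]
  have hsq : 0 < √s := Real.sqrt_pos.mpr hs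
  have h1 : ell T s = ell T t + 2 * Real.log (√t / √s) := by
    rw [Real.log_div (Real.sqrt_pos.mpr ht).ne' hsq.ne', Real.log_sqrt ht.le, Real.log_sqrt hs.le]
    unfold ell; ring
  have h2 : Real.log (√t / √s) ≤ √t / √s - 1 :=
    Real.log_le_sub_one_of_pos (div_pos (Real.sqrt_pos.mpr ht) hsq)
  have h3 : 1 ≤ √t / √s := (one_le_div hsq).mpr (Real.sqrt_le_sqrt hst)
  have h4 : ell T s ≤ ell T t * (√t / √s) := by
    rw [h1]; nlinarith [two_le_ell ht htT]
  calc √s * ell T s ≤ √s * (ell T t * (√t / √s)) := by gcongr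
    _ = √t * ell T t := by field_simp

theorem weight_self (hT : 0 < T) : weight T T = 2 * √T := by
  rw [weight_eq hT le_rfl]; unfold ell; ring

theorem weight_le (hT : 0 < T) (ht : 0 < t) (htT : t ≤ T) : weight T t ≤ 2 * √T :=
  (weight_mono ht htT le_rfl).trans (weight_self hT).le

/-- The factor comparing the weights with reference times `S` and `T`. -/
def ratio (S T : ℝ) : ℝ := 1 + |Real.log S - Real.log T|

theorem one_le_ratio : 1 ≤ ratio S T := by unfold ratio; linarith [abs_nonneg (Real.log S - Real.log T)]

theorem ell_le_ratio (ht : 0 < t) (htT : t ≤ T) : ell S t ≤ ratio S T * ell T t := by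
  have h1 := two_le_ell ht htT
  have h2 := le_abs_self (Real.log S - Real.log T)
  have h3 := abs_nonneg (Real.log S - Real.log T)
  have h4 : ell S t = ell T t + (Real.log S - Real.log T) := by unfold ell; ring
  unfold ratio
  nlinarith

theorem weight_le_ratio (ht : 0 < t) (htS : t ≤ S) (htT : t ≤ T) :
    weight S t ≤ ratio S T * weight T t := by
  rw [weight_eq ht htS, weight_eq ht htT]
  have := mul_le_mul_of_nonneg_left (ell_le_ratio (S := S) ht htT) (Real.sqrt_nonneg t)
  linarith

theorem weight_le_weight (ht : 0 < t) (htS : t ≤ S) (hST : S ≤ T) : weight S t ≤ weight T t := by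
  rw [weight_eq ht htS, weight_eq ht (htS.trans hST)]
  refine mul_le_mul_of_nonneg_left ?_ (Real.sqrt_nonneg t)
  unfold ell
  linarith [Real.log_le_log (ht.trans_le htS) hST]

theorem measurable_weight : Measurable (weight T) := by unfold weight; fun_prop

/-- The square of the inverse weight. -/
def gw (T τ : ℝ) : ℝ := ((weight T τ) ^ 2)⁻¹

theorem gw_nonneg : 0 ≤ gw T τ := by unfold gw; positivity

theorem measurable_gw : Measurable (gw T) := (measurable_weight.pow_const 2).inv

/-- Here the logarithm pays off: `gw T τ = 1 / (τ ell²)` is the derivative of `1 / ell`, so it is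
integrable down to `0`. -/
theorem integral_gw (ht : 0 < t) (htT : t ≤ T) :
    IntegrableOn (gw T) (Ioo 0 t) ∧ ∫ τ in Ioo 0 t, gw T τ = (ell T t)⁻¹ := by
  -- Since `Real.log 0 = 0`, the formula has the wrong value at `0`; inserting the limit `0` gives
  -- continuity on the closed interval.
  set f : ℝ → ℝ := Function.update (fun τ => (ell T τ)⁻¹) 0 0 with hf
  have hlog : Tendsto (fun τ => ell T τ) (𝓝[>] 0) atTop := by
    unfold ell
    simp_rw [sub_eq_add_neg]
    exact tendsto_const_nhds.add_atTop (tendsto_neg_atBot_atTop.comp Real.tendsto_log_nhdsGT_zero)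
  have hcont : ContinuousOn f (Icc 0 t) := by
    rw [hf, continuousOn_update_iff]
    constructor
    · intro τ hτ
      have hτ0 : 0 < τ := lt_of_le_of_ne hτ.1.1 (Ne.symm hτ.2)
      refine ContinuousAt.continuousWithinAt (ContinuousAt.inv₀ ?_
        (ell_pos hτ0 (hτ.1.2.trans htT)).ne')
      unfold ell
      exact continuousAt_const.sub (Real.continuousAt_log hτ0.ne')
    · intro _
      refine (tendsto_inv_atTop_zero.comp hlog).mono_left (nhdsWithin_mono _ ?_)
      exact fun τ hτ => lt_of_le_of_ne hτ.1.1 (Ne.symm hτ.2)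
  have hderiv : ∀ τ ∈ Ioo 0 t, HasDerivAt f (gw T τ) τ := by
    intro τ hτ
    have hτT := hτ.2.le.trans htT
    have hpos := ell_pos hτ.1 hτT
    have h1 : HasDerivAt (fun τ => (ell T τ)⁻¹) (gw T τ) τ := by
      have h2 : HasDerivAt (ell T) (0 - τ⁻¹) τ :=
        (hasDerivAt_const τ (2 + Real.log T)).sub (Real.hasDerivAt_log hτ.1.ne')
      refine (h2.inv hpos.ne').congr_deriv ?_
      unfold gw
      rw [weight_eq hτ.1 hτT, mul_pow, Real.sq_sqrt hτ.1.le]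
      have := hτ.1.ne'
      field_simp; ring
    refine h1.congr_of_eventuallyEq ?_
    filter_upwards [eventually_ne_nhds hτ.1.ne'] with x hx
    rw [hf, Function.update_of_ne hx]
  have hint := intervalIntegral.integrableOn_deriv_of_nonneg hcont hderiv fun τ _ => gw_nonneg
  refine ⟨hint.mono_set Ioo_subset_Ioc_self, ?_⟩
  rw [← integral_Ioc_eq_integral_Ioo, ← intervalIntegral.integral_of_le ht.le,
    intervalIntegral.integral_eq_sub_of_hasDerivAt_of_le ht.le hcont hderiv
      ((intervalIntegrable_iff_integrableOn_Ioc_of_le ht.le).mpr hint)]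
  rw [hf, Function.update_of_ne ht.ne', Function.update_self, sub_zero]

theorem integral_inv_sqrt {a : ℝ} (hat : a ≤ t) :
    IntegrableOn (fun τ => (√(t - τ))⁻¹) (Ioo a t) ∧
      ∫ τ in Ioo a t, (√(t - τ))⁻¹ = 2 * √(t - a) := by
  set f : ℝ → ℝ := fun τ => -(2 * √(t - τ)) with hf
  have hcont : ContinuousOn f (Icc a t) := by rw [hf]; fun_prop
  have hderiv : ∀ τ ∈ Ioo a t, HasDerivAt f (√(t - τ))⁻¹ τ := by
    intro τ hτ
    have h0 : 0 < t - τ := sub_pos.mpr hτ.2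
    have h1 := (((hasDerivAt_id τ).const_sub t).sqrt h0.ne').const_mul 2 |>.neg
    refine h1.congr_deriv ?_
    have : √(t - id τ) ≠ 0 := (Real.sqrt_pos.mpr h0).ne'
    simp only [id] at this ⊢
    field_simp
  have hint := intervalIntegral.integrableOn_deriv_of_nonneg hcont hderiv fun τ _ => by positivity
  refine ⟨hint.mono_set Ioo_subset_Ioc_self, ?_⟩
  rw [← integral_Ioc_eq_integral_Ioo, ← intervalIntegral.integral_of_le hat,
    intervalIntegral.integral_eq_sub_of_hasDerivAt_of_le hat hcont hderiv
      ((intervalIntegrable_iff_integrableOn_Ioc_of_le hat).mpr hint)]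
  simp [hf]

/-- One factor is frozen on each half of `(0,t)`: for `τ ≤ t/2` the kernel is at most `2/√t`, and
for `τ ≥ t/2` monotonicity of the weight with `ell ≥ 2` gives `gw T τ ≤ 1/(t ell)`. After
integration each term contributes `2 / (√t ell)`, whence the constant `4`. -/
theorem inv_sqrt_mul_gw_le (htT : t ≤ T) (hτ : τ ∈ Ioo 0 t) :
    (√(t - τ))⁻¹ * gw T τ ≤ 2 * (√t)⁻¹ * gw T τ + (t * ell T t)⁻¹ * (√(t - τ))⁻¹ := by
  have ht : 0 < t := hτ.1.trans hτ.2
  have hl := two_le_ell ht htT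
  have h0 : 0 < t - τ := sub_pos.mpr hτ.2
  rcases le_total τ (t / 2) with h | h
  · have h1 : (√(t - τ))⁻¹ ≤ 2 * (√t)⁻¹ := by
      rw [← div_eq_mul_inv, inv_le_comm₀ (Real.sqrt_pos.mpr h0) (by positivity), inv_div]
      rw [div_le_iff₀ two_pos]
      refine Real.sqrt_le_iff.mpr ⟨by positivity, ?_⟩
      rw [mul_pow, Real.sq_sqrt h0.le]; linarith
    have h2 : 0 ≤ (t * ell T t)⁻¹ * (√(t - τ))⁻¹ := by positivity
    have := mul_le_mul_of_nonneg_right h1 (gw_nonneg (T := T) (τ := τ))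
    linarith
  · have h1 : gw T τ ≤ (t * ell T t)⁻¹ := by
      unfold gw
      refine inv_anti₀ (by positivity) ?_
      have h2 : √(t / 2) * ell T t ≤ weight T τ := by
        refine le_trans ?_ (weight_mono (by positivity) h (hτ.2.le.trans htT))
        rw [weight_eq (by positivity) (by linarith)]
        exact mul_le_mul_of_nonneg_left (ell_anti (by positivity) (by linarith))
          (Real.sqrt_nonneg _)
      calc t * ell T t ≤ t / 2 * ell T t ^ 2 := by nlinarith [mul_pos ht (two_pos.trans_le hl)]
        _ = (√(t / 2) * ell T t) ^ 2 := by rw [mul_pow, Real.sq_sqrt (by positivity)]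
        _ ≤ _ := by gcongr
    have h2 : 0 ≤ 2 * (√t)⁻¹ * gw T τ := mul_nonneg (by positivity) gw_nonneg
    have h3 : 0 ≤ (√(t - τ))⁻¹ := by positivity
    nlinarith [mul_le_mul_of_nonneg_left h1 h3]

theorem measurable_inv_sqrt_sub {r : ℝ} : Measurable (fun τ : ℝ => (√(r - τ))⁻¹) := by fun_prop

theorem integral_inv_sqrt_mul_gw (ht : 0 < t) (htT : t ≤ T) :
    IntegrableOn (fun τ => (√(t - τ))⁻¹ * gw T τ) (Ioo 0 t) ∧
      ∫ τ in Ioo 0 t, (√(t - τ))⁻¹ * gw T τ ≤ 4 * (weight T t)⁻¹ := by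
  obtain ⟨i1, e1⟩ := integral_gw ht htT
  obtain ⟨i2, e2⟩ := integral_inv_sqrt (t := t) ht.le
  have hI : IntegrableOn (fun τ => 2 * (√t)⁻¹ * gw T τ + (t * ell T t)⁻¹ * (√(t - τ))⁻¹)
    (Ioo 0 t) := (i1.const_mul _).add (i2.const_mul _)
  have hi : IntegrableOn (fun τ => (√(t - τ))⁻¹ * gw T τ) (Ioo 0 t) := by
    refine Integrable.mono' hI (measurable_inv_sqrt_sub.mul measurable_gw).aestronglyMeasurable ?_
    filter_upwards [ae_restrict_mem measurableSet_Ioo] with τ hτ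
    rw [Real.norm_eq_abs, abs_of_nonneg (mul_nonneg (by positivity) gw_nonneg)]
    exact inv_sqrt_mul_gw_le htT hτ
  refine ⟨hi, (setIntegral_mono_on hi hI measurableSet_Ioo
    fun τ hτ => inv_sqrt_mul_gw_le htT hτ).trans ?_⟩
  rw [integral_add (i1.const_mul _) (i2.const_mul _), integral_const_mul, integral_const_mul, e1,
    e2, weight_eq ht htT, sub_zero]
  have hl := ell_pos ht htT
  have hs := Real.sqrt_pos.mpr ht
  have : t = √t * √t := (Real.mul_self_sqrt ht.le).symm
  refine le_of_eq ?_
  rw [show (t * ell T t)⁻¹ = (√t * √t * ell T t)⁻¹ by rw [← this]]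
  field_simp; ring

theorem integral_inv_sqrt_add_mul_gw (hs : 0 ≤ s) (ht : 0 < t) (htT : t ≤ T) :
    IntegrableOn (fun τ => (√(s + t - τ))⁻¹ * gw T τ) (Ioo 0 t) ∧
      ∫ τ in Ioo 0 t, (√(s + t - τ))⁻¹ * gw T τ ≤ 4 * (weight T t)⁻¹ := by
  obtain ⟨i, h⟩ := integral_inv_sqrt_mul_gw ht htT
  have hle : ∀ τ ∈ Ioo 0 t, (√(s + t - τ))⁻¹ * gw T τ ≤ (√(t - τ))⁻¹ * gw T τ := by
    intro τ hτ
    have h0 : 0 < √(t - τ) := Real.sqrt_pos.mpr (sub_pos.mpr hτ.2)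
    exact mul_le_mul_of_nonneg_right (inv_anti₀ h0 (Real.sqrt_le_sqrt (by linarith))) gw_nonneg
  have hi : IntegrableOn (fun τ => (√(s + t - τ))⁻¹ * gw T τ) (Ioo 0 t) := by
    refine Integrable.mono' i (measurable_inv_sqrt_sub.mul measurable_gw).aestronglyMeasurable ?_
    filter_upwards [ae_restrict_mem measurableSet_Ioo] with τ hτ
    rw [Real.norm_eq_abs, abs_of_nonneg (mul_nonneg (by positivity) gw_nonneg)]
    exact hle τ hτ
  exact ⟨hi, (setIntegral_mono_on hi i measurableSet_Ioo hle).trans h⟩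

/-- This controls the Besov norm of the Duhamel term, whose heat flow at time `s` has the kernel
`(s+t-τ)^{-1/2}`. For `s ≤ t` the previous bound and monotonicity of the weight suffice; for `s ≥ t`
one uses `s+t-τ ≥ s`, the exact integral of `gw`, and `ell S s ≤ ell S t`. -/
theorem weight_mul_integral_le (hs : 0 < s) (hsS : s < S) (ht : 0 < t) (htT : t ≤ T) :
    weight S s * ∫ τ in Ioo 0 t, (√(s + t - τ))⁻¹ * gw T τ ≤ 4 * ratio S T := by
  obtain ⟨i, h⟩ := integral_inv_sqrt_add_mul_gw hs.le ht htT
  have hr := one_le_ratio (S := S) (T := T)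
  rcases le_total s t with hst | hst
  · have hw := weight_pos ht htT
    have h1 : weight S s ≤ ratio S T * weight T t :=
      (weight_le_ratio hs hsS.le (hst.trans htT)).trans
        (mul_le_mul_of_nonneg_left (weight_mono hs hst htT) (by linarith))
    calc weight S s * ∫ τ in Ioo 0 t, (√(s + t - τ))⁻¹ * gw T τ
        ≤ weight S s * (4 * (weight T t)⁻¹) := mul_le_mul_of_nonneg_left h weight_nonneg
      _ ≤ ratio S T * weight T t * (4 * (weight T t)⁻¹) :=
          mul_le_mul_of_nonneg_right h1 (by positivity)
      _ = 4 * ratio S T := by field_simp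
  · obtain ⟨i1, e1⟩ := integral_gw ht htT
    have hsq := Real.sqrt_pos.mpr hs
    have hl := ell_pos ht htT
    have h2 : ∫ τ in Ioo 0 t, (√(s + t - τ))⁻¹ * gw T τ ≤ (√s)⁻¹ * (ell T t)⁻¹ := by
      rw [← e1, ← integral_const_mul]
      refine setIntegral_mono_on i (i1.const_mul _) measurableSet_Ioo fun τ hτ => ?_
      exact mul_le_mul_of_nonneg_right (inv_anti₀ hsq (Real.sqrt_le_sqrt (by linarith [hτ.2])))
        gw_nonneg
    have h3 : weight S s ≤ √s * (ratio S T * ell T t) := by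
      rw [weight_eq hs hsS.le]
      exact mul_le_mul_of_nonneg_left ((ell_anti ht hst).trans (ell_le_ratio ht htT)) hsq.le
    calc weight S s * ∫ τ in Ioo 0 t, (√(s + t - τ))⁻¹ * gw T τ
        ≤ weight S s * ((√s)⁻¹ * (ell T t)⁻¹) := mul_le_mul_of_nonneg_left h2 weight_nonneg
      _ ≤ √s * (ratio S T * ell T t) * ((√s)⁻¹ * (ell T t)⁻¹) :=
          mul_le_mul_of_nonneg_right h3 (by positivity)
      _ = ratio S T := by field_simp
      _ ≤ 4 * ratio S T := by linarith

end Weight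


/-! ### The Duhamel integral -/

/-- `∫_0^t e^{(r-τ)Δ} ℙ ∇ · H(τ) dτ`. -/
def duh {N : ℕ} (H : ℝ → Vec N → Matrix (Fin N) (Fin N) ℝ) (r t : ℝ) (x : Vec N) : Vec N :=
  ∫ τ in Ioo 0 t, heatLerayDiv (r - τ) (H τ) x

/-- Joint measurability of a time dependent matrix field. -/
def MeasField {N : ℕ} (H : ℝ → Vec N → Matrix (Fin N) (Fin N) ℝ) : Prop :=
  ∀ j k, Measurable fun p : ℝ × Vec N => H p.1 p.2 j k

/-- The bound `|H(τ)| ≤ M / w_T(τ)²` on `(0,t)`. -/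
def FieldBound {N : ℕ} (T t M : ℝ) (H : ℝ → Vec N → Matrix (Fin N) (Fin N) ℝ) : Prop :=
  ∀ τ ∈ Ioo 0 t, ∀ y j k, |H τ y j k| ≤ M * gw T τ

section Duh

variable {N : ℕ} {S T t t₁ r s M : ℝ} {H : ℝ → Vec N → Matrix (Fin N) (Fin N) ℝ}

theorem MeasField.apply (hH : MeasField H) (τ : ℝ) (j k : Fin N) :
    Measurable fun y => H τ y j k :=
  (hH j k).comp (f := fun y : Vec N => (τ, y)) (by fun_prop)

theorem FieldBound.mono (hb : FieldBound T t M H) (h : t₁ ≤ t) : FieldBound T t₁ M H :=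
  fun τ hτ => hb τ ⟨hτ.1, hτ.2.trans_le h⟩

theorem FieldBound.norm_le (hb : FieldBound T t M H) (hM : 0 ≤ M) (htr : t ≤ r) {τ : ℝ}
    (hτ : τ ∈ Ioo 0 t) (x : Vec N) :
    ‖heatLerayDiv (r - τ) (H τ) x‖ ≤ oseenConst N * M * ((√(r - τ))⁻¹ * gw T τ) := by
  have := norm_heatLerayDiv_le (s := r - τ) (by linarith [hτ.2]) (mul_nonneg hM gw_nonneg)
    (Eventually.of_forall (hb τ hτ)) x
  refine this.trans (le_of_eq (by ring))

theorem MeasField.stronglyMeasurable (hH : MeasField H) :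
    StronglyMeasurable fun q : (ℝ × Vec N) × ℝ => heatLerayDiv (q.1.1 - q.2) (H q.2) q.1.2 :=
  (stronglyMeasurable_heatLerayDiv hH).comp_measurable
    (g := fun q : (ℝ × Vec N) × ℝ => ((q.1.1 - q.2, q.1.2), q.2)) (by fun_prop)

theorem integrableOn_duh (hH : MeasField H) (hb : FieldBound T t M H) (hM : 0 ≤ M)
    (ht : 0 < t) (htT : t ≤ T) (htr : t ≤ r) (x : Vec N) :
    IntegrableOn (fun τ => heatLerayDiv (r - τ) (H τ) x) (Ioo 0 t) := by
  have h1 := (integral_inv_sqrt_add_mul_gw (sub_nonneg.mpr htr) ht htT).1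
  rw [sub_add_cancel] at h1
  refine Integrable.mono' (h1.const_mul (oseenConst N * M)) ?_ ?_
  · exact (hH.stronglyMeasurable.comp_measurable
      (g := fun τ : ℝ => ((r, x), τ)) (by fun_prop)).aestronglyMeasurable
  · filter_upwards [ae_restrict_mem measurableSet_Ioo] with τ hτ
    exact hb.norm_le hM htr hτ x

theorem norm_duh_le_integral (hb : FieldBound T t M H) (hM : 0 ≤ M)
    (ht : 0 < t) (htT : t ≤ T) (htr : t ≤ r) (x : Vec N) :
    ‖duh H r t x‖ ≤ oseenConst N * M * ∫ τ in Ioo 0 t, (√(r - τ))⁻¹ * gw T τ := by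
  have h1 := (integral_inv_sqrt_add_mul_gw (sub_nonneg.mpr htr) ht htT).1
  rw [sub_add_cancel] at h1
  rw [← integral_const_mul]
  refine norm_integral_le_of_norm_le (h1.const_mul _) ?_
  filter_upwards [ae_restrict_mem measurableSet_Ioo] with τ hτ
  exact hb.norm_le hM htr hτ x

theorem norm_duh_le (hb : FieldBound T t M H) (hM : 0 ≤ M)
    (ht : 0 < t) (htT : t ≤ T) (htr : t ≤ r) (x : Vec N) :
    ‖duh H r t x‖ ≤ 4 * oseenConst N * M * (weight T t)⁻¹ := by
  have h2 := (integral_inv_sqrt_add_mul_gw (sub_nonneg.mpr htr) ht htT).2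
  rw [sub_add_cancel] at h2
  refine (norm_duh_le_integral hb hM ht htT htr x).trans ?_
  have := mul_le_mul_of_nonneg_left h2 (mul_nonneg (oseenConst_nonneg N) hM)
  linarith

theorem weight_mul_norm_duh_le (hb : FieldBound T t M H) (hM : 0 ≤ M)
    (ht : 0 < t) (htT : t ≤ T) (x : Vec N) :
    weight T t * ‖duh H t t x‖ ≤ 4 * oseenConst N * M := by
  have hw := weight_pos ht htT
  have := mul_le_mul_of_nonneg_left (norm_duh_le hb hM ht htT le_rfl x) hw.le
  refine this.trans (le_of_eq ?_)
  field_simp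

theorem weight_mul_norm_duh_add_le (hb : FieldBound T t M H) (hM : 0 ≤ M)
    (ht : 0 < t) (htT : t ≤ T) (hs : 0 < s) (hsS : s < S) (x : Vec N) :
    weight S s * ‖duh H (s + t) t x‖ ≤ 4 * ratio S T * oseenConst N * M := by
  have h1 := norm_duh_le_integral hb hM ht htT (r := s + t) (by linarith) x
  have h2 := weight_mul_integral_le hs hsS ht htT
  have h3 := mul_le_mul_of_nonneg_left h1 (weight_nonneg (T := S) (t := s))
  have h4 := mul_le_mul_of_nonneg_left h2 (mul_nonneg (oseenConst_nonneg N) hM)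
  linarith

/-- The upper limit of integration varies with the point, so it is encoded in an indicator on the
product space. -/
theorem stronglyMeasurable_duh (hH : MeasField H) :
    StronglyMeasurable fun p : ℝ × Vec N => duh H p.1 p.1 p.2 := by
  have h1 : (fun p : ℝ × Vec N => duh H p.1 p.1 p.2) = fun p => ∫ τ,
      {q : (ℝ × Vec N) × ℝ | 0 < q.2 ∧ q.2 < q.1.1}.indicator
        (fun q => heatLerayDiv (q.1.1 - q.2) (H q.2) q.1.2) (p, τ) := by
    ext1 p
    rw [duh, ← integral_indicator measurableSet_Ioo]
    congr 1
  rw [h1]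
  refine StronglyMeasurable.integral_prod_right' (hH.stronglyMeasurable.indicator ?_)
  exact (measurableSet_lt measurable_const measurable_snd).inter
    (measurableSet_lt measurable_snd (measurable_fst.comp measurable_fst))

theorem measurable_duh (hH : MeasField H) (t : ℝ) : Measurable (duh H t t) :=
  (stronglyMeasurable_duh hH).measurable.comp (f := fun x : Vec N => (t, x)) (by fun_prop)

theorem integrable_gk_smul_duh (hH : MeasField H) (hb : FieldBound T t M H) (hM : 0 ≤ M)
    (ht : 0 < t) (htT : t ≤ T) {k : Vec N → ℝ} (hk : Integrable k) :
    Integrable (fun p : Vec N × ℝ => k p.1 • heatLerayDiv (t - p.2) (H p.2) p.1)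
      (volume.prod (volume.restrict (Ioo 0 t))) := by
  have h1 := (integral_inv_sqrt_mul_gw ht htT).1.const_mul (oseenConst N * M)
  refine Integrable.mono' (hk.norm.mul_prod h1) ?_ ?_
  · refine AEStronglyMeasurable.smul hk.aestronglyMeasurable.comp_fst ?_
    exact (hH.stronglyMeasurable.comp_measurable
      (g := fun p : Vec N × ℝ => ((t, p.1), p.2)) (by fun_prop)).aestronglyMeasurable
  · have : ∀ᵐ p : Vec N × ℝ ∂(volume.prod (volume.restrict (Ioo 0 t))), p.2 ∈ Ioo 0 t :=
      Measure.quasiMeasurePreserving_snd.ae (ae_restrict_mem measurableSet_Ioo)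
    filter_upwards [this] with p hp
    rw [norm_smul]
    exact mul_le_mul_of_nonneg_left (hb.norm_le hM le_rfl hp p.1) (norm_nonneg _)

theorem hs_duh (hH : MeasField H) (hb : FieldBound T t M H) (hM : 0 ≤ M)
    (ht : 0 < t) (htT : t ≤ T) (hs' : 0 < s) (x : Vec N) :
    hs s (duh H t t) x = duh H (s + t) t x := by
  unfold hs duh
  simp_rw [← integral_smul]
  rw [integral_integral_swap (integrable_gk_smul_duh hH hb hM ht htT
    (integrable_comp_sub (integrable_gk hs') x))]
  refine setIntegral_congr_fun measurableSet_Ioo fun τ hτ => ?_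
  have := hs_heatLerayDiv hs' (sub_pos.mpr hτ.2) (hH.apply τ) (mul_nonneg hM gw_nonneg)
    (hb τ hτ) x
  rw [← add_sub_assoc] at this
  exact this

theorem gw_anti {τ : ℝ} (ht₁ : 0 < t₁) (h : t₁ ≤ τ) (hτ : τ ≤ T) : gw T τ ≤ gw T t₁ := by
  unfold gw
  have := weight_pos ht₁ (h.trans hτ)
  exact inv_anti₀ (by positivity) (pow_le_pow_left₀ this.le (weight_mono ht₁ h hτ) 2)

/-- Away from time zero `gw` is bounded by its value at `t₁`, and only the integrable singularity at
`τ = t` remains. -/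
theorem norm_tail_le (hb : FieldBound T t M H) (hM : 0 ≤ M) (ht₁ : 0 < t₁) (h : t₁ ≤ t)
    (htT : t ≤ T) (x : Vec N) :
    ‖∫ τ in Ioo t₁ t, heatLerayDiv (t - τ) (H τ) x‖ ≤
      2 * oseenConst N * M * gw T t₁ * √(t - t₁) := by
  obtain ⟨i, e⟩ := integral_inv_sqrt h
  have : 2 * oseenConst N * M * gw T t₁ * √(t - t₁) =
      ∫ τ in Ioo t₁ t, oseenConst N * M * gw T t₁ * (√(t - τ))⁻¹ := by
    rw [integral_const_mul, e]; ring
  rw [this]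
  refine norm_integral_le_of_norm_le (i.const_mul _) ?_
  filter_upwards [ae_restrict_mem measurableSet_Ioo] with τ hτ
  have hτ' : τ ∈ Ioo 0 t := ⟨ht₁.trans hτ.1, hτ.2⟩
  refine (hb.norm_le hM le_rfl hτ' x).trans ?_
  have h1 := gw_anti ht₁ hτ.1.le (hτ.2.le.trans htT)
  have h2 : 0 ≤ oseenConst N * M * (√(t - τ))⁻¹ :=
    mul_nonneg (mul_nonneg (oseenConst_nonneg N) hM) (by positivity)
  have := mul_le_mul_of_nonneg_left h1 h2
  linarith

/-- The semigroup law applied to the part of the integral before `t₁`. This past part is a heat flow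
of a bounded function, hence smooth, and the tail is small. -/
theorem duh_split (hH : MeasField H) (hb : FieldBound T t M H) (hM : 0 ≤ M) (ht₁ : 0 < t₁)
    (h : t₁ < t) (htT : t ≤ T) (x : Vec N) :
    duh H t t x = hs (t - t₁) (duh H t₁ t₁) x +
      ∫ τ in Ioo t₁ t, heatLerayDiv (t - τ) (H τ) x := by
  have ht : 0 < t := ht₁.trans h
  rw [hs_duh hH (hb.mono h.le) hM ht₁ (h.le.trans htT) (sub_pos.mpr h), sub_add_cancel]
  unfold duh
  have hi := integrableOn_duh hH hb hM ht htT le_rfl x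
  rw [← integrableOn_Ioc_iff_integrableOn_Ioo] at hi
  rw [← integral_Ioc_eq_integral_Ioo, ← integral_Ioc_eq_integral_Ioo,
    ← integral_Ioc_eq_integral_Ioo, ← setIntegral_union (Ioc_disjoint_Ioc_of_le le_rfl)
    measurableSet_Ioc (hi.mono_set (Ioc_subset_Ioc_right h.le))
    (hi.mono_set (Ioc_subset_Ioc_left ht₁.le)), Ioc_union_Ioc_eq_Ioc ht₁.le h.le]

/-- The length `r` depends on `t`, `T`, `M` and `ε` but not on the endpoints, so the same `r` serves
all nearby times. -/
theorem exists_tail_small (H : ℝ → Vec N → Matrix (Fin N) (Fin N) ℝ) (T : ℝ) (hM : 0 ≤ M)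
    (ht : 0 < t) {ε : ℝ} (hε : 0 < ε) :
    ∃ r > 0, r ≤ t / 2 ∧ ∀ t₁ t' : ℝ, t / 2 ≤ t₁ → t₁ ≤ t' → t' ≤ T → t' - t₁ ≤ r →
      FieldBound T t' M H →
      ∀ x, ‖∫ τ in Ioo t₁ t', heatLerayDiv (t' - τ) (H τ) x‖ ≤ ε := by
  set C := 2 * oseenConst N * M * gw T (t / 2) with hC
  have hC0 : 0 ≤ C := mul_nonneg (mul_nonneg (mul_nonneg two_pos.le (oseenConst_nonneg N)) hM)
    gw_nonneg
  refine ⟨min (t / 2) ((ε / (C + 1)) ^ 2), by positivity, min_le_left _ _, ?_⟩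
  intro t₁ t' h1 h2 h3 h4 hb' x
  have ht₁ : 0 < t₁ := by linarith
  refine (norm_tail_le hb' hM ht₁ h2 h3 x).trans ?_
  have h5 : √(t' - t₁) ≤ ε / (C + 1) :=
    Real.sqrt_le_iff.mpr ⟨by positivity, h4.trans (min_le_right _ _)⟩
  have h6 : gw T t₁ ≤ gw T (t / 2) := gw_anti (by linarith) h1 (h2.trans h3)
  calc 2 * oseenConst N * M * gw T t₁ * √(t' - t₁) ≤ C * (ε / (C + 1)) := by
        rw [hC]
        have := oseenConst_nonneg N
        gcongr
    _ ≤ ε := by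
      rw [mul_div_assoc', div_le_iff₀ (by positivity)]
      nlinarith

theorem uniformContinuous_of_approx {f : Vec N → Vec N}
    (h : ∀ ε > 0, ∃ g : Vec N → Vec N, UniformContinuous g ∧ ∀ x, ‖f x - g x‖ ≤ ε) :
    UniformContinuous f := by
  rw [Metric.uniformContinuous_iff]
  intro ε hε
  obtain ⟨g, hg, hfg⟩ := h (ε / 4) (by positivity)
  obtain ⟨δ, hδ, hg'⟩ := Metric.uniformContinuous_iff.mp hg (ε / 4) (by positivity)
  refine ⟨δ, hδ, fun {a b} hab => ?_⟩
  have h1 := hfg a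
  have h2 := hfg b
  have h3 := hg' hab
  rw [← dist_eq_norm] at h1 h2
  have h4 := dist_triangle4 (f a) (g a) (g b) (f b)
  rw [dist_comm (g b)] at h4
  linarith

theorem uniformContinuous_duh (hH : MeasField H) (hb : FieldBound T t M H) (hM : 0 ≤ M)
    (ht : 0 < t) (htT : t ≤ T) : UniformContinuous (duh H t t) := by
  refine uniformContinuous_of_approx fun ε hε => ?_
  obtain ⟨r, hr, hr2, htail⟩ := exists_tail_small H T hM ht hε
  have ht₁ : 0 < t - r := by linarith
  refine ⟨hs r (duh H (t - r) (t - r)), uniformContinuous_hs hr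
    (measurable_duh hH _).aestronglyMeasurable
    (Eventually.of_forall (norm_duh_le (hb.mono (by linarith)) hM ht₁ (by linarith) le_rfl)),
    fun x => ?_⟩
  have h1 := duh_split hH hb hM ht₁ (by linarith : t - r < t) htT x
  rw [sub_sub_cancel] at h1
  rw [h1, add_sub_cancel_left]
  exact htail (t - r) t (by linarith) (by linarith) htT (by linarith) hb x

/-- Both times are restarted from the common earlier time `t₁`. The past parts are heat flows of the
same bounded function, compared through the `L¹` continuity of the kernel, and the two tails are
small. -/
theorem duh_continuous_time (hH : MeasField H) (hb : FieldBound T T M H) (hM : 0 ≤ M)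
    {t₀ : ℝ} (ht₀ : 0 < t₀) (ht₀T : t₀ ≤ T) {ε : ℝ} (hε : 0 < ε) :
    ∃ δ > 0, ∀ t ∈ Ioc 0 T, |t - t₀| < δ → ∀ x, ‖duh H t t x - duh H t₀ t₀ x‖ ≤ ε := by
  obtain ⟨r, hr, hr2, htail⟩ := exists_tail_small H T hM ht₀
    (by positivity : 0 < ε / 3)
  set t₁ := t₀ - r / 2 with ht₁
  have ht₁0 : 0 < t₁ := by rw [ht₁]; linarith
  have ht₁T : t₁ ≤ T := by rw [ht₁]; linarith
  set f := duh H t₁ t₁ with hf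
  set C := 4 * oseenConst N * M * (weight T t₁)⁻¹ with hC
  have hC0 : 0 ≤ C := mul_nonneg (mul_nonneg (mul_nonneg (by norm_num) (oseenConst_nonneg N)) hM)
    (inv_nonneg.mpr weight_nonneg)
  have hfb : ∀ᵐ x, ‖f x‖ ≤ C :=
    Eventually.of_forall (norm_duh_le (hb.mono ht₁T) hM ht₁0 ht₁T le_rfl)
  have hlim : Tendsto (fun s => (∫ y : Vec N, |gk s y - gk (r / 2) y|) * C) (𝓝 (r / 2)) (𝓝 0) := by
    simpa using (tendsto_gk_time (N := N) (by positivity : 0 < r / 2)).mul_const C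
  obtain ⟨δ, hδ, hδ'⟩ := Metric.eventually_nhds_iff.mp
    (hlim.eventually (eventually_lt_nhds (by positivity : 0 < ε / 3)))
  -- Since `t₁ = t₀ - r/2`, the bound `|t - t₀| < r/2` ensures `0 < t - t₁ < r`, so the tail
  -- estimate covers `t` as well.
  refine ⟨min δ (r / 2), by positivity, fun t ht htt x => ?_⟩
  rw [lt_min_iff, abs_lt, abs_lt] at htt
  have h1 : t₁ < t := by rw [ht₁]; linarith [htt.2.1]
  have h2 : t₁ < t₀ := by rw [ht₁]; linarith
  rw [duh_split hH (hb.mono ht.2) hM ht₁0 h1 ht.2 x,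
    duh_split hH (hb.mono ht₀T) hM ht₁0 h2 ht₀T x, ← hf]
  have e1 := htail t₁ t (by rw [ht₁]; linarith) h1.le ht.2 (by rw [ht₁]; linarith [htt.2.2])
    (hb.mono ht.2) x
  have e2 := htail t₁ t₀ (by rw [ht₁]; linarith) h2.le ht₀T (by rw [ht₁]; linarith)
    (hb.mono ht₀T) x
  have e3 := norm_hs_sub_hs_le (sub_pos.mpr h1) (sub_pos.mpr h2)
    (measurable_duh hH t₁).aestronglyMeasurable hfb x
  have e4 : t₀ - t₁ = r / 2 := by rw [ht₁]; ring
  rw [e4] at e3 ⊢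
  have e5 := hδ' (y := t - t₁) (by
    rw [Real.dist_eq, abs_lt, ht₁]; constructor <;> linarith [htt.1.1, htt.1.2])
  set A := hs (t - t₁) f x
  set B := hs (r / 2) f x
  set P := ∫ τ in Ioo t₁ t, heatLerayDiv (t - τ) (H τ) x
  set Q := ∫ τ in Ioo t₁ t₀, heatLerayDiv (t₀ - τ) (H τ) x
  have e6 : A + P - (B + Q) = (A - B) + (P - Q) := by abel
  rw [e6]
  have e7 := norm_add_le (A - B) (P - Q)
  have e8 := norm_sub_le P Q
  linarith

theorem sum_integral_lineDeriv_mul_duh (hH : MeasField H) (hb : FieldBound T t M H) (hM : 0 ≤ M)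
    (ht : 0 < t) (htT : t ≤ T) (ψ : 𝓢(Vec N, ℝ)) :
    ∑ i, ∫ y, (∂_{EuclideanSpace.single i (1 : ℝ)} ψ) y * duh H t t y i = 0 := by
  have hI : ∀ i : Fin N, Integrable (fun p : Vec N × ℝ =>
      (∂_{EuclideanSpace.single i (1 : ℝ)} ψ) p.1 * heatLerayDiv (t - p.2) (H p.2) p.1 i)
      (volume.prod (volume.restrict (Ioo 0 t))) := by
    intro i
    have := integrable_gk_smul_duh hH hb hM ht htT
      (SchwartzMap.integrable (μ := volume) (∂_{EuclideanSpace.single i (1 : ℝ)} ψ))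
    exact (EuclideanSpace.proj (𝕜 := ℝ) i : Vec N →L[ℝ] ℝ).integrable_comp this
  have h1 : ∀ i : Fin N, ∫ y, (∂_{EuclideanSpace.single i (1 : ℝ)} ψ) y * duh H t t y i =
      ∫ τ in Ioo 0 t, ∫ y, (∂_{EuclideanSpace.single i (1 : ℝ)} ψ) y *
        heatLerayDiv (t - τ) (H τ) y i := by
    intro i
    rw [← integral_integral_swap (hI i)]
    congr 1; ext1 y
    rw [integral_const_mul, duh,
      integral_apply_coord (integrableOn_duh hH hb hM ht htT le_rfl y)]
  simp_rw [h1]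
  rw [← integral_finsetSum _ fun i _ => (hI i).integral_prod_right]
  rw [setIntegral_congr_fun (g := fun _ => (0 : ℝ)) measurableSet_Ioo, integral_zero]
  intro τ hτ
  exact sum_integral_lineDeriv_mul_heatLerayDiv (sub_pos.mpr hτ.2) (hH.apply τ) (hb τ hτ) ψ

theorem divFree_of_rep_duh (hH : MeasField H) (hb : FieldBound T t M H) (hM : 0 ≤ M)
    (ht : 0 < t) (htT : t ≤ T) {γ : TDist N} (hγ : IsBoundedRep γ (duh H t t)) : DivFree γ := by
  intro ψ
  rw [← sum_integral_lineDeriv_mul_duh hH hb hM ht htT ψ]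
  refine Finset.sum_congr rfl fun i _ => ?_
  rw [hγ.2, integral_apply_coord (integrable_schwartz_smul _ hγ.1)]
  rfl

theorem duh_sub {H' : ℝ → Vec N → Matrix (Fin N) (Fin N) ℝ} {M' : ℝ} (hH : MeasField H)
    (hb : FieldBound T t M H) (hM : 0 ≤ M) (hH' : MeasField H') (hb' : FieldBound T t M' H')
    (hM' : 0 ≤ M') (ht : 0 < t) (htT : t ≤ T) (htr : t ≤ r) (x : Vec N) :
    duh H r t x - duh H' r t x = duh (fun τ y => H τ y - H' τ y) r t x := by
  unfold duh
  rw [← integral_sub (integrableOn_duh hH hb hM ht htT htr x)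
    (integrableOn_duh hH' hb' hM' ht htT htr x)]
  refine setIntegral_congr_fun measurableSet_Ioo fun τ hτ => ?_
  exact (heatLerayDiv_sub (by linarith [hτ.2]) (hH.apply τ) (hb τ hτ) (hH'.apply τ)
    (hb' τ hτ) x).symm

end Duh


/-! ### The integral equation for jointly measurable paths -/

/-- The bound `w_T ‖u‖ ≤ A` on `(0,t)`. -/
def WBound {N : ℕ} (T t A : ℝ) (u : ℝ → Vec N → Vec N) : Prop :=
  ∀ τ ∈ Ioo 0 t, ∀ x, weight T τ * ‖u τ x‖ ≤ A

/-- Joint measurability of a path of vector fields. -/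
def MeasPath {N : ℕ} (u : ℝ → Vec N → Vec N) : Prop :=
  Measurable fun p : ℝ × Vec N => u p.1 p.2

/-- The field `u ⊗ u`. -/
def sqField {N : ℕ} (u : ℝ → Vec N → Vec N) (τ : ℝ) (y : Vec N) : Matrix (Fin N) (Fin N) ℝ :=
  tensor (u τ) (u τ) y

theorem sqField_congr {N : ℕ} {u v : ℝ → Vec N → Vec N} {τ : ℝ} (h : ∀ y, u τ y = v τ y) :
    sqField u τ = sqField v τ := by
  have : u τ = v τ := funext h
  funext y
  rw [sqField, sqField, this]

theorem duh_sqField_congr {N : ℕ} {u v : ℝ → Vec N → Vec N} {t : ℝ}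
    (h : ∀ τ ∈ Ioo 0 t, ∀ y, u τ y = v τ y) (r : ℝ) (x : Vec N) :
    duh (sqField u) r t x = duh (sqField v) r t x :=
  setIntegral_congr_fun measurableSet_Ioo fun τ hτ => by
    rw [sqField_congr (h τ hτ)]

theorem duhamel_eq_duh {N : ℕ} (u : ℝ → Vec N → Vec N) (t : ℝ) :
    duhamel u u t = duh (sqField u) t t := rfl

section Path

variable {N : ℕ} {T t t' A B D E : ℝ} {u v a b : ℝ → Vec N → Vec N}

theorem WBound.mono (h : WBound T t A u) (ht : t' ≤ t) (hA : A ≤ B) : WBound T t' B u :=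
  fun τ hτ x => (h τ ⟨hτ.1, hτ.2.trans_le ht⟩ x).trans hA

theorem WBound.nonneg (h : WBound T t A u) (ht : 0 < t) : 0 ≤ A :=
  (mul_nonneg weight_nonneg (norm_nonneg _)).trans (h (t / 2) ⟨by linarith, by linarith⟩ 0)

theorem WBound.sub (hu : WBound T t A u) (hv : WBound T t B v) :
    WBound T t (A + B) (fun τ x => u τ x - v τ x) := by
  intro τ hτ x
  have h1 := mul_le_mul_of_nonneg_left (norm_sub_le (u τ x) (v τ x))
    (weight_nonneg (T := T) (t := τ))
  have h2 := hu τ hτ x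
  have h3 := hv τ hτ x
  dsimp only
  linarith

theorem WBound.norm_le (h : WBound T t A u) (htT : t ≤ T) {τ : ℝ} (hτ : τ ∈ Ioo 0 t) (x : Vec N) :
    ‖u τ x‖ ≤ A * (weight T τ)⁻¹ := by
  rw [← div_eq_mul_inv, le_div_iff₀ (weight_pos hτ.1 (hτ.2.le.trans htT)), mul_comm]
  exact h τ hτ x

theorem MeasPath.sqField (hu : MeasPath u) : MeasField (sqField u) := by
  have h : ∀ j : Fin N, Measurable fun p : ℝ × Vec N => u p.1 p.2 j := fun j =>
    ((EuclideanSpace.proj (𝕜 := ℝ) j : Vec N →L[ℝ] ℝ).continuous.measurable).comp hu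
  exact fun j k => (h j).mul (h k)

theorem MeasPath.sub (hu : MeasPath u) (hv : MeasPath v) :
    MeasPath (fun τ x => u τ x - v τ x) := Measurable.sub hu hv

theorem MeasPath.duh (hu : MeasPath u) : MeasPath (fun t => duh (NSLog.sqField u) t t) :=
  (stronglyMeasurable_duh hu.sqField).measurable

theorem WBound.sqField (hu : WBound T t A u) (htT : t ≤ T) :
    FieldBound T t (A * A) (sqField u) := by
  intro τ hτ y j k
  have h := hu.norm_le htT hτ y
  unfold NSLog.sqField tensor gw
  rw [abs_mul, sq, mul_inv]
  calc |u τ y j| * |u τ y k| ≤ (A * (weight T τ)⁻¹) * (A * (weight T τ)⁻¹) :=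
        mul_le_mul ((abs_coord_le _ _).trans h) ((abs_coord_le _ _).trans h) (abs_nonneg _)
          ((norm_nonneg _).trans h)
    _ = _ := by ring

theorem WBound.sqField_sub (hu : WBound T t A u) (hv : WBound T t B v)
    (hd : WBound T t D (fun τ x => u τ x - v τ x)) (htT : t ≤ T) :
    FieldBound T t ((A + B) * D) (fun τ y => NSLog.sqField u τ y - NSLog.sqField v τ y) := by
  intro τ hτ y j k
  have h1 := hu.norm_le htT hτ y
  have h2 := hv.norm_le htT hτ y
  have h3 := hd.norm_le htT hτ y
  set w := (weight T τ)⁻¹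
  have e : (NSLog.sqField u τ y - NSLog.sqField v τ y) j k =
      u τ y j * (u τ y - v τ y) k + (u τ y - v τ y) j * v τ y k := by
    simp only [NSLog.sqField, tensor, Matrix.sub_apply, PiLp.sub_apply]; ring
  change |(NSLog.sqField u τ y - NSLog.sqField v τ y) j k| ≤ _
  rw [e]
  refine (abs_add_le _ _).trans ?_
  rw [abs_mul, abs_mul]
  have h4 := mul_le_mul ((abs_coord_le (u τ y) j).trans h1)
    ((abs_coord_le (u τ y - v τ y) k).trans h3) (abs_nonneg _) ((norm_nonneg _).trans h1)
  have h5 := mul_le_mul ((abs_coord_le (u τ y - v τ y) j).trans h3)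
    ((abs_coord_le (v τ y) k).trans h2) (abs_nonneg _) ((norm_nonneg _).trans h3)
  have e2 : (A + B) * D * gw T τ = A * w * (D * w) + D * w * (B * w) := by
    unfold gw; rw [sq, mul_inv]; ring
  rw [e2]
  exact add_le_add h4 h5

/-- The constant of the bilinear estimate. -/
def bilConst (N : ℕ) : ℝ := 4 * oseenConst N + 1

/-- The summand `1` in `bilConst` allows division by it without knowing that the kernels are
nonzero. -/
theorem bilConst_pos : 0 < bilConst N := by
  unfold bilConst; linarith [oseenConst_nonneg N]

theorem weight_duh_sq_le (hu : WBound T t A u) (ht : 0 < t) (htT : t ≤ T) (x : Vec N) :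
    weight T t * ‖duh (sqField u) t t x‖ ≤ bilConst N * (A * A) := by
  have hA := hu.nonneg ht
  refine (weight_mul_norm_duh_le (hu.sqField htT) (mul_nonneg hA hA) ht htT x).trans ?_
  unfold bilConst
  nlinarith [mul_nonneg hA hA]

theorem weight_duh_sq_sub_le (hum : MeasPath u) (hvm : MeasPath v) (hu : WBound T t A u)
    (hv : WBound T t B v) (hd : WBound T t D (fun τ x => u τ x - v τ x)) (ht : 0 < t)
    (htT : t ≤ T) (x : Vec N) :
    weight T t * ‖duh (sqField u) t t x - duh (sqField v) t t x‖ ≤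
      bilConst N * ((A + B) * D) := by
  have hA := hu.nonneg ht
  have hB := hv.nonneg ht
  have hD := hd.nonneg ht
  rw [duh_sub hum.sqField (hu.sqField htT) (mul_nonneg hA hA) hvm.sqField (hv.sqField htT)
    (mul_nonneg hB hB) ht htT le_rfl]
  have hM : 0 ≤ (A + B) * D := by positivity
  refine (weight_mul_norm_duh_le (hu.sqField_sub hv hd htT) hM ht htT x).trans ?_
  unfold bilConst
  nlinarith

/-- A contraction argument phrased by bounds instead of suprema: iterating `F ↦ D + F/2` from any a
priori bound `E` gives `2D + E/2ⁿ`. The value of `E` does not matter, only its existence. -/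
theorem WBound.of_contraction {d : ℝ → Vec N → Vec N} (h0 : WBound T t E d) (hE : 0 ≤ E)
    (hD : 0 ≤ D) (h : ∀ F, 0 ≤ F → WBound T t F d → WBound T t (D + F / 2) d) :
    WBound T t (2 * D) d := by
  have h1 : ∀ n : ℕ, WBound T t (2 * D + E * (1 / 2) ^ n) d := by
    intro n
    induction n with
    | zero => exact h0.mono le_rfl (by simp; linarith)
    | succ n ih =>
      exact (h _ (by positivity) ih).mono le_rfl (le_of_eq (by rw [pow_succ]; ring))
  intro τ hτ x
  have hlim : Tendsto (fun n : ℕ => 2 * D + E * (1 / 2 : ℝ) ^ n) atTop (𝓝 (2 * D + E * 0)) :=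
    ((tendsto_pow_atTop_nhds_zero_of_lt_one (by norm_num) (by norm_num)).const_mul E).const_add _
  rw [mul_zero, add_zero] at hlim
  exact ge_of_tendsto' hlim fun n => h1 n τ hτ x

/-- `u` solves the integral equation `u = a - B(u,u)` on `(0,T]`. -/
def Solves (T : ℝ) (a u : ℝ → Vec N → Vec N) : Prop :=
  ∀ t ∈ Ioc 0 T, ∀ x, u t x = a t x - duh (sqField u) t t x

/-- By bilinearity a bound `F` for `u - v` yields `D + 2 bilConst A F`, which is at most `D + F/2`
under the smallness assumption. -/
theorem Solves.stability (hum : MeasPath u) (hvm : MeasPath v) (hu : Solves T a u)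
    (hv : Solves T b v) (ht : 0 < t) (htT : t ≤ T) (hub : WBound T t A u) (hvb : WBound T t A v)
    (hA : 4 * bilConst N * A ≤ 1) (hab : WBound T t D (fun τ x => a τ x - b τ x)) :
    WBound T t (2 * D) (fun τ x => u τ x - v τ x) := by
  have hA0 := hub.nonneg ht
  refine (hub.sub hvb).of_contraction (by positivity) (hab.nonneg ht) fun F hF hd τ hτ x => ?_
  have hτT : τ ≤ T := hτ.2.le.trans htT
  have e : u τ x - v τ x = (a τ x - b τ x) -
      (duh (sqField u) τ τ x - duh (sqField v) τ τ x) := by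
    rw [hu τ ⟨hτ.1, hτT⟩ x, hv τ ⟨hτ.1, hτT⟩ x]; abel
  have h1 := weight_duh_sq_sub_le hum hvm (hub.mono hτ.2.le le_rfl) (hvb.mono hτ.2.le le_rfl)
    (hd.mono hτ.2.le le_rfl) hτ.1 hτT x
  have h2 := hab τ hτ x
  have h3 := mul_le_mul_of_nonneg_left (norm_sub_le (a τ x - b τ x)
    (duh (sqField u) τ τ x - duh (sqField v) τ τ x)) (weight_nonneg (T := T) (t := τ))
  rw [← e] at h3
  dsimp only at h2 ⊢
  nlinarith [bilConst_pos (N := N)]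

theorem duh_eq_zero {H : ℝ → Vec N → Matrix (Fin N) (Fin N) ℝ} {r : ℝ}
    (h : ∀ τ ∈ Ioo 0 t, ∀ y, H τ y = 0) (x : Vec N) : duh H r t x = 0 := by
  unfold duh
  rw [setIntegral_congr_fun (g := fun _ => (0 : Vec N)) measurableSet_Ioo, integral_zero]
  intro τ hτ
  ext i
  simp [heatLerayDiv, h τ hτ]

/-- Equality up to `t₁` cancels the past, so the difference is a tail integral and gains a factor
`√(τ - t₁)`. The step `δ` works for all `t₁ ≥ t'`, which permits finitely many steps without
smallness. -/
theorem Solves.unique_step (hT : 0 < T) (hum : MeasPath u) (hvm : MeasPath v)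
    (hu : Solves T a u) (hv : Solves T a v) (hub : WBound T T A u) (hvb : WBound T T A v)
    (ht' : 0 < t') :
    ∃ δ > 0, ∀ t₁, t' ≤ t₁ → t₁ ≤ T → (∀ τ ∈ Ioo 0 t₁, ∀ x, u τ x = v τ x) →
      ∀ τ ∈ Ioo 0 (min T (t₁ + δ)), ∀ x, u τ x = v τ x := by
  have hA0 := hub.nonneg hT
  set C := 2 * √T * (2 * oseenConst N * (A + A) * gw T t') with hC
  have hC0 : 0 ≤ C := mul_nonneg (by positivity) (mul_nonneg (mul_nonneg (mul_nonneg two_pos.le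
    (oseenConst_nonneg N)) (by positivity)) gw_nonneg)
  -- Chosen so that `C √δ ≤ 1/2`. The constant `C` is taken at the earliest time `t'`, where `gw` is
  -- largest.
  refine ⟨(1 / (2 * (C + 1))) ^ 2, by positivity, fun t₁ h1 h2 heq => ?_⟩
  set t₂ := min T (t₁ + (1 / (2 * (C + 1))) ^ 2) with ht₂
  have ht₂T : t₂ ≤ T := min_le_left _ _
  have ht₁0 : 0 < t₁ := ht'.trans_le h1
  have ht₂0 : 0 < t₂ := lt_min hT (by positivity)
  have key : WBound T t₂ (2 * 0) (fun τ x => u τ x - v τ x) := by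
    refine ((hub.sub hvb).mono ht₂T le_rfl).of_contraction (by positivity) le_rfl
      fun F hF hd τ hτ x => ?_
    dsimp only
    rcases lt_or_ge τ t₁ with hlt | hge
    · rw [heq τ ⟨hτ.1, hlt⟩ x, sub_self, norm_zero, mul_zero]; positivity
    rcases hge.eq_or_lt with rfl | hgt
    · have hz : duh (sqField u) t₁ t₁ x = duh (sqField v) t₁ t₁ x := duh_sqField_congr heq t₁ x
      rw [hu t₁ ⟨ht₁0, h2⟩ x, hv t₁ ⟨ht₁0, h2⟩ x, hz, sub_self, norm_zero, mul_zero]; positivity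
    have hτT : τ ≤ T := hτ.2.le.trans ht₂T
    have hub' := hub.mono hτT le_rfl
    have hvb' := hvb.mono hτT le_rfl
    have hd' := hd.mono hτ.2.le le_rfl
    have hM : 0 ≤ (A + A) * F := by positivity
    have hm : MeasField (fun τ y => NSLog.sqField u τ y - NSLog.sqField v τ y) := fun j k =>
      (hum.sqField j k).sub (hvm.sqField j k)
    have hfb := hub'.sqField_sub hvb' hd' hτT
    have e : u τ x - v τ x =
        -∫ s in Ioo t₁ τ, heatLerayDiv (τ - s) (NSLog.sqField u s - NSLog.sqField v s) x := by
      have e1 := duh_sub hum.sqField (hub'.sqField hτT) (mul_nonneg hA0 hA0) hvm.sqField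
        (hvb'.sqField hτT) (mul_nonneg hA0 hA0) hτ.1 hτT le_rfl x
      rw [duh_split hm hfb hM ht₁0 hgt hτT x] at e1
      have e2 : hs (τ - t₁) (duh (fun τ y => NSLog.sqField u τ y - NSLog.sqField v τ y) t₁ t₁) x
          = 0 := by
        unfold hs
        have : ∀ y, duh (fun τ y => NSLog.sqField u τ y - NSLog.sqField v τ y) t₁ t₁ y = 0 :=
          duh_eq_zero fun s hs y => by
            rw [sqField_congr (heq s hs), sub_self]
        simp [this]
      rw [e2, zero_add] at e1
      rw [hu τ ⟨hτ.1, hτT⟩ x, hv τ ⟨hτ.1, hτT⟩ x, sub_sub_sub_cancel_left, ← neg_sub, e1]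
      rfl
    rw [e, norm_neg]
    have h3 := norm_tail_le hfb hM ht₁0 hgt.le hτT x
    have h4 : √(τ - t₁) ≤ 1 / (2 * (C + 1)) := by
      refine Real.sqrt_le_iff.mpr ⟨by positivity, ?_⟩
      have := hτ.2.le.trans (min_le_right T (t₁ + (1 / (2 * (C + 1))) ^ 2))
      linarith
    have h5 : gw T t₁ ≤ gw T t' := gw_anti ht' h1 h2
    have h6 := weight_le hT hτ.1 hτT
    have h7 : 2 * oseenConst N * ((A + A) * F) * gw T t₁ * √(τ - t₁) ≤
        2 * oseenConst N * ((A + A) * F) * gw T t' * (1 / (2 * (C + 1))) := by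
      have := oseenConst_nonneg N
      gcongr
      exact mul_nonneg (by positivity) gw_nonneg
    refine (mul_le_mul h6 (h3.trans h7) (norm_nonneg _) (by positivity)).trans ?_
    have h8 : 2 * √T * (2 * oseenConst N * ((A + A) * F) * gw T t' * (1 / (2 * (C + 1)))) =
        F / 2 * (C / (C + 1)) := by
      rw [hC]; field_simp
    rw [h8, zero_add]
    exact mul_le_of_le_one_right (by positivity) ((div_le_one (by positivity)).mpr (by linarith))
  intro τ hτ x
  have h := key τ hτ x
  rw [mul_zero] at h
  have hw := weight_pos hτ.1 (hτ.2.le.trans ht₂T)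
  have : ‖u τ x - v τ x‖ ≤ 0 := by
    by_contra hc
    push Not at hc
    nlinarith
  exact sub_eq_zero.mp (norm_le_zero_iff.mp this)

theorem Solves.eq_of_eq_Ioo (hu : Solves T a u) (hv : Solves T a v)
    (h : ∀ τ ∈ Ioo 0 T, ∀ x, u τ x = v τ x) : ∀ t ∈ Ioc 0 T, ∀ x, u t x = v t x := by
  intro t ht x
  have hz : duh (sqField u) t t x = duh (sqField v) t t x :=
    duh_sqField_congr (fun τ hτ => h τ ⟨hτ.1, hτ.2.trans_le ht.2⟩) t x
  rw [hu t ht x, hv t ht x, hz]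

/-- Near `0` both solutions are small and `Solves.stability` with equal data applies; beyond that,
equality advances by a fixed `δ`. -/
theorem Solves.unique (hT : 0 < T) (hum : MeasPath u) (hvm : MeasPath v)
    (hu : Solves T a u) (hv : Solves T a v) (hub : WBound T T A u) (hvb : WBound T T A v)
    (hsmall : ∀ ε > 0, ∃ t > 0, WBound T t ε u ∧ WBound T t ε v) :
    ∀ t ∈ Ioc 0 T, ∀ x, u t x = v t x := by
  refine hu.eq_of_eq_Ioo hv ?_
  obtain ⟨t₀, ht₀, hu₀, hv₀⟩ := hsmall (1 / (4 * bilConst N)) (by have := bilConst_pos (N := N); positivity)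
  set t' := min t₀ T with ht'
  have ht'0 : 0 < t' := lt_min ht₀ hT
  have ht'T : t' ≤ T := min_le_right _ _
  have hinit : ∀ τ ∈ Ioo 0 t', ∀ x, u τ x = v τ x := by
    have hz : WBound T t' 0 (fun τ x => a τ x - a τ x) := fun τ hτ x => by simp
    have hp := bilConst_pos (N := N)
    have h := Solves.stability hum hvm hu hv ht'0 ht'T (hu₀.mono (min_le_left _ _) le_rfl)
      (hv₀.mono (min_le_left _ _) le_rfl) (le_of_eq (by field_simp)) hz
    intro τ hτ x
    have h1 := h τ hτ x
    have hw := weight_pos hτ.1 (hτ.2.le.trans ht'T)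
    rw [mul_zero] at h1
    have : ‖u τ x - v τ x‖ ≤ 0 := by
      by_contra hc
      push Not at hc
      nlinarith
    exact sub_eq_zero.mp (norm_le_zero_iff.mp this)
  obtain ⟨δ, hδ, hstep⟩ := Solves.unique_step hT hum hvm hu hv hub hvb ht'0
  have hall : ∀ n : ℕ, ∀ τ ∈ Ioo 0 (min T (t' + n * δ)), ∀ x, u τ x = v τ x := by
    intro n
    induction n with
    | zero => simpa [min_eq_right ht'T] using hinit
    | succ n ih =>
      have := hstep (min T (t' + n * δ)) (le_min ht'T (by
        have : 0 ≤ (n : ℝ) * δ := by positivity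
        linarith)) (min_le_left _ _) ih
      intro τ hτ x
      refine this τ ⟨hτ.1, hτ.2.trans_le (le_min (min_le_left _ _) ?_)⟩ x
      push_cast
      rcases min_choice T (t' + n * δ) with h | h <;> rw [h]
      · exact (min_le_left _ _).trans (by linarith)
      · exact (min_le_right _ _).trans (by linarith)
  intro τ hτ x
  obtain ⟨n, hn⟩ := exists_nat_gt (T / δ)
  refine hall n τ ⟨hτ.1, hτ.2.trans_le (le_min le_rfl ?_)⟩ x
  rw [div_lt_iff₀ hδ] at hn
  linarith

/-! ### Picard iteration -/

/-- The Picard iterates of `u = a - B(u,u)`. -/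
def picard (a : ℝ → Vec N → Vec N) : ℕ → ℝ → Vec N → Vec N
  | 0 => a
  | n + 1 => fun t x => a t x - duh (sqField (picard a n)) t t x

theorem measPath_picard (ha : MeasPath a) (n : ℕ) : MeasPath (picard a n) := by
  induction n with
  | zero => exact ha
  | succ n ih => exact ha.sub ih.duh

/-- The bound `2η` is preserved because `η + bilConst (2η)² ≤ η + η/2`. It is stated on every
`(0,t)`, with its own size, so that decay at time zero survives the iteration. -/
theorem WBound.picard {η : ℝ} (hη : 8 * bilConst N * η ≤ 1) (ht : 0 < t) (htT : t ≤ T)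
    (ha : WBound T t η a) (n : ℕ) : WBound T t (2 * η) (picard a n) := by
  have hη0 := ha.nonneg ht
  induction n with
  | zero => exact ha.mono le_rfl (by linarith)
  | succ n ih =>
    intro τ hτ x
    have hτT := hτ.2.le.trans htT
    have h1 := ha τ hτ x
    have h2 := weight_duh_sq_le (ih.mono hτ.2.le le_rfl) hτ.1 hτT x
    have h3 := mul_le_mul_of_nonneg_left (norm_sub_le (a τ x)
      (duh (NSLog.sqField (NSLog.picard a n)) τ τ x)) (weight_nonneg (T := T) (t := τ))
    simp only [NSLog.picard]
    nlinarith [bilConst_pos (N := N)]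

theorem WBound.picard_sub {η : ℝ} (hη : 8 * bilConst N * η ≤ 1) (hT : 0 < T)
    (ham : MeasPath a) (ha : WBound T T η a) (n : ℕ) :
    WBound T T (η * (1 / 2) ^ n)
      (fun τ x => NSLog.picard a (n + 1) τ x - NSLog.picard a n τ x) := by
  have hη0 := ha.nonneg hT
  have hp := bilConst_pos (N := N)
  induction n with
  | zero =>
    intro τ hτ x
    have h2 := weight_duh_sq_le (ha.mono hτ.2.le le_rfl) hτ.1 hτ.2.le x
    simp only [NSLog.picard, sub_sub_cancel_left, norm_neg, pow_zero, mul_one]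
    nlinarith
  | succ n ih =>
    intro τ hτ x
    have h1 := weight_duh_sq_sub_le (measPath_picard ham (n + 1)) (measPath_picard ham n)
      ((WBound.picard hη hT le_rfl ha (n + 1)).mono hτ.2.le le_rfl)
      ((WBound.picard hη hT le_rfl ha n).mono hτ.2.le le_rfl)
      (ih.mono hτ.2.le le_rfl) hτ.1 hτ.2.le x
    have e : NSLog.picard a (n + 1 + 1) τ x - NSLog.picard a (n + 1) τ x =
        -(duh (NSLog.sqField (NSLog.picard a (n + 1))) τ τ x -
          duh (NSLog.sqField (NSLog.picard a n)) τ τ x) := by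
      simp only [NSLog.picard]; abel
    dsimp only
    rw [e, norm_neg]
    refine h1.trans ?_
    rw [pow_succ]
    have : 0 ≤ η * (1 / 2 : ℝ) ^ n := by positivity
    nlinarith

/-- Successive iterates differ by a factor `4 bilConst η ≤ 1/2`, so they converge geometrically at
each point and, after weighting, uniformly. The last conclusion, for arbitrary `t` and `h`, is what
transfers the vanishing limit at `0` from `a` to `u`. -/
theorem exists_solves {η : ℝ} (hη : 8 * bilConst N * η ≤ 1) (hT : 0 < T)
    (ham : MeasPath a) (ha : WBound T T η a) :
    ∃ u, MeasPath u ∧ Solves T a u ∧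
      ∀ t h, 0 < t → t ≤ T → h ≤ η → WBound T t h a → WBound T t (2 * h) u := by
  have hη0 := ha.nonneg hT
  have hp := bilConst_pos (N := N)
  have hdist : ∀ t ∈ Ioo 0 T, ∀ x, ∀ n, dist (picard a n t x) (picard a (n + 1) t x) ≤
      (2 * η * (weight T t)⁻¹) / 2 / 2 ^ n := by
    intro t ht x n
    have := (WBound.picard_sub hη hT ham ha n).norm_le le_rfl ht x
    rw [dist_comm, dist_eq_norm]
    refine this.trans (le_of_eq ?_)
    rw [one_div, inv_pow]; ring
  have hex : ∀ t ∈ Ioo 0 T, ∀ x, ∃ z, Tendsto (fun n => picard a n t x) atTop (𝓝 z) :=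
    fun t ht x => cauchySeq_tendsto_of_complete (cauchySeq_of_le_geometric_two (hdist t ht x))
  choose! w hw using hex
  -- The limit exists only on the open interval; setting it to zero elsewhere keeps joint
  -- measurability.
  set w' : ℝ → Vec N → Vec N := fun t x => if t ∈ Ioo 0 T then w t x else 0 with hw'
  have hw'eq : ∀ t ∈ Ioo 0 T, ∀ x, w' t x = w t x := fun t ht x => if_pos ht
  have hw'm : MeasPath w' := by
    refine measurable_of_tendsto_metrizable (f := fun n (p : ℝ × Vec N) =>
      if p.1 ∈ Ioo 0 T then picard a n p.1 p.2 else 0) (fun n => ?_) ?_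
    · exact Measurable.ite (measurable_fst measurableSet_Ioo) (measPath_picard ham n)
        measurable_const
    · rw [tendsto_pi_nhds]
      intro p
      by_cases hpm : p.1 ∈ Ioo 0 T
      · simp only [hw', if_pos hpm]; exact hw p.1 hpm p.2
      · simp only [hw', if_neg hpm]; exact tendsto_const_nhds
  have hw'b : ∀ t h, 0 < t → t ≤ T → h ≤ η → WBound T t h a → WBound T t (2 * h) w' := by
    intro t h ht htT hh hah τ hτ x
    have hτT : τ ∈ Ioo 0 T := ⟨hτ.1, hτ.2.trans_le htT⟩
    rw [hw'eq τ hτT]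
    have hsm : 8 * bilConst N * h ≤ 1 := by nlinarith
    exact le_of_tendsto' ((hw τ hτT x).norm.const_mul _) fun n =>
      WBound.picard hsm ht htT hah n τ hτ x
  have hdiff : ∀ n, WBound T T (2 * η / 2 ^ n) (fun τ x => picard a n τ x - w' τ x) := by
    intro n τ hτ x
    dsimp only
    rw [hw'eq τ hτ]
    have h1 := dist_le_of_le_geometric_two_of_tendsto (hdist τ hτ x) (hw τ hτ x) n
    rw [dist_eq_norm] at h1
    have hwp := weight_pos hτ.1 hτ.2.le
    calc weight T τ * ‖picard a n τ x - w τ x‖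
        ≤ weight T τ * (2 * η * (weight T τ)⁻¹ / 2 ^ n) := by gcongr
      _ = 2 * η / 2 ^ n := by field_simp
  have hw'eqn : ∀ t ∈ Ioo 0 T, ∀ x, w' t x = a t x - duh (sqField w') t t x := by
    intro t ht x
    rw [hw'eq t ht]
    have hwp := weight_pos ht.1 ht.2.le
    have h1 : Tendsto (fun n => picard a (n + 1) t x) atTop (𝓝 (w t x)) :=
      (hw t ht x).comp (tendsto_add_atTop_nat 1)
    refine tendsto_nhds_unique h1 ?_
    simp only [picard]
    refine tendsto_const_nhds.sub ?_
    rw [tendsto_iff_norm_sub_tendsto_zero]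
    have h2 : ∀ n, ‖duh (sqField (picard a n)) t t x - duh (sqField w') t t x‖ ≤
        (weight T t)⁻¹ * (bilConst N * ((2 * η + 2 * η) * (2 * η / 2 ^ n))) := by
      intro n
      have := weight_duh_sq_sub_le (measPath_picard ham n) hw'm
        ((WBound.picard hη hT le_rfl ha n).mono ht.2.le le_rfl)
        ((hw'b T η hT le_rfl le_rfl ha).mono ht.2.le le_rfl) ((hdiff n).mono ht.2.le le_rfl)
        ht.1 ht.2.le x
      rw [← div_eq_inv_mul, le_div_iff₀ hwp, mul_comm]
      exact this
    refine squeeze_zero (fun n => norm_nonneg _) h2 ?_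
    have h3 : Tendsto (fun n : ℕ => (1 / 2 : ℝ) ^ n) atTop (𝓝 0) :=
      tendsto_pow_atTop_nhds_zero_of_lt_one (by norm_num) (by norm_num)
    have h4 := h3.const_mul ((weight T t)⁻¹ * (bilConst N * ((2 * η + 2 * η) * (2 * η))))
    rw [mul_zero] at h4
    refine h4.congr fun n => ?_
    rw [one_div, inv_pow]; ring
  -- The weighted bounds say nothing at `t = T`, so the solution is redefined by the equation
  -- itself, which also covers the endpoint.
  set u : ℝ → Vec N → Vec N := fun t x => a t x - duh (sqField w') t t x with hu
  have huw : ∀ t ∈ Ioo 0 T, ∀ x, u t x = w' t x := fun t ht x => (hw'eqn t ht x).symm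
  refine ⟨u, ham.sub hw'm.duh, fun t ht x => ?_, fun t h ht htT hh hah τ hτ x => ?_⟩
  · have hz : duh (sqField u) t t x = duh (sqField w') t t x :=
      duh_sqField_congr (fun τ hτ => huw τ ⟨hτ.1, hτ.2.trans_le ht.2⟩) t x
    rw [hz]
  · rw [huw τ ⟨hτ.1, hτ.2.trans_le htT⟩]
    exact hw'b t h ht htT hh hah τ hτ x

end Path


/-! ### The heat flow in the logarithmic Besov space -/

theorem tendsto_weight_zero {T : ℝ} (hT : 0 < T) : Tendsto (weight T) (𝓝[>] 0) (𝓝 0) := by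
  have h1 : Tendsto (fun t : ℝ => √t) (𝓝[>] 0) (𝓝 0) :=
    (Real.continuous_sqrt.tendsto' 0 0 Real.sqrt_zero).mono_left nhdsWithin_le_nhds
  have h2 : Tendsto (fun t : ℝ => Real.log t * t ^ (1 / 2 : ℝ)) (𝓝[>] 0) (𝓝 0) :=
    tendsto_log_mul_rpow_nhdsGT_zero (by norm_num)
  have h3 := (h1.mul_const (2 + Real.log T)).sub h2
  rw [zero_mul, sub_zero] at h3
  refine h3.congr' ?_
  filter_upwards [Ioo_mem_nhdsGT hT] with t ht
  rw [weight_eq ht.1 ht.2.le, ← Real.sqrt_eq_rpow, ell]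
  ring

theorem ofReal_mul_eLpNorm_le_iff {N : ℕ} {f : Vec N → Vec N} {w c : ℝ} (hw : 0 < w)
    (hc : 0 ≤ c) :
    ENNReal.ofReal w * eLpNorm f ∞ volume ≤ ENNReal.ofReal c ↔ ∀ᵐ x, w * ‖f x‖ ≤ c := by
  have h1 : ENNReal.ofReal w * eLpNorm f ∞ volume ≤ ENNReal.ofReal c ↔
      eLpNorm f ∞ volume ≤ ENNReal.ofReal (c / w) := by
    rw [ENNReal.ofReal_div_of_pos hw, ENNReal.le_div_iff_mul_le (Or.inl (by simpa using hw))
      (Or.inl ENNReal.ofReal_ne_top), mul_comm]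
  rw [h1, eLpNorm_top_le_iff (by positivity)]
  refine eventually_congr (Eventually.of_forall fun x => ?_)
  rw [le_div_iff₀ hw, mul_comm]

section Heat

variable {N : ℕ} {S T t s c M : ℝ} {φ γ : TDist N} {f g : Vec N → Vec N}

/-- The heat flow as a path. -/
def heatPath (φ : TDist N) : ℝ → Vec N → Vec N := fun t => heat t φ

/-- Continuity of `heat t φ` upgrades the essential bound to a pointwise one, so the Besov norm is
handled by `WBound`. -/
theorem logNorm_le_iff (hc : 0 ≤ c) :
    logNorm S φ ≤ ENNReal.ofReal c ↔ WBound S S c (heatPath φ) := by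
  unfold logNorm WBound heatPath
  rw [iSup₂_le_iff]
  refine forall₂_congr fun t ht => ?_
  have hw := weight_pos ht.1 ht.2.le
  rw [ofReal_mul_eLpNorm_le_iff hw hc]
  refine ⟨fun h x => ?_, fun h => Eventually.of_forall h⟩
  have := forall_norm_le_of_ae (f := fun x => weight S t • heat t φ x) (M := c)
    (by have := continuous_heat (t := t) φ; fun_prop) (by
      filter_upwards [h] with y hy
      rwa [norm_smul, Real.norm_of_nonneg hw.le]) x
  rwa [norm_smul, Real.norm_of_nonneg hw.le] at this

theorem WBound.heatPath_sub (h₁ : WBound S T c (heatPath φ)) (h₂ : WBound S T M (heatPath γ)) :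
    WBound S T (c + M) (heatPath (φ - γ)) := by
  intro t ht x
  have := h₁.sub h₂ t ht x
  rwa [heatPath, heat_sub]

theorem heatPath_neg_sub (h : WBound S T c (heatPath (φ - γ))) :
    WBound S T c (heatPath (γ - φ)) := by
  intro t ht x
  have := h t ht x
  rw [heatPath, heat_sub] at this ⊢
  rwa [norm_sub_rev]

/-- Beyond `S/2` the flow continues from the bounded function `heat (S/2) φ`, and the heat semigroup
does not increase the supremum. Hence the norm with reference time `S` controls all later times. -/
theorem norm_heat_le_of_half (hS : 0 < S) (h : WBound S S c (heatPath φ)) (ht : S / 2 ≤ t)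
    (x : Vec N) : ‖heat t φ x‖ ≤ c / weight S (S / 2) := by
  have hw := weight_pos (half_pos hS) (half_le_self hS.le)
  have h1 : ∀ y, ‖heat (S / 2) φ y‖ ≤ c / weight S (S / 2) := fun y => by
    rw [le_div_iff₀ hw, mul_comm]
    exact h (S / 2) ⟨half_pos hS, half_lt_self hS⟩ y
  rcases ht.eq_or_lt with rfl | ht
  · exact h1 x
  have h2 := heat_heat (sub_pos.mpr ht) (half_pos hS) (Eventually.of_forall h1) x
  rw [sub_add_cancel] at h2
  rw [← h2]
  exact norm_hs_le (sub_pos.mpr ht) (Eventually.of_forall h1) x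

theorem exists_heat_bound (hS : 0 < S) (h : WBound S S c (heatPath φ)) (ht : 0 < t) :
    ∃ M, ∀ x, ‖heat t φ x‖ ≤ M := by
  rcases lt_or_ge t (S / 2) with h1 | h1
  · exact ⟨_, fun x => h.norm_le le_rfl ⟨ht, by linarith⟩ x⟩
  · exact ⟨_, norm_heat_le_of_half hS h h1⟩

theorem memLp_of_bound (hf : AEStronglyMeasurable f volume) (hM : ∀ x, ‖f x‖ ≤ M) :
    MemLp f ∞ volume := memLp_top_of_bound hf M (Eventually.of_forall hM)

theorem memB_of_wBound (hS : 0 < S) (hc : 0 ≤ c) (h : WBound S S c (heatPath φ)) : MemB S φ := by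
  refine ⟨fun t ht => ?_, ((logNorm_le_iff hc).mpr h).trans_lt ENNReal.ofReal_lt_top⟩
  obtain ⟨M, hM⟩ := exists_heat_bound hS h ht
  exact memLp_of_bound (continuous_heat φ).aestronglyMeasurable hM

theorem MemB.wBound (h : MemB S φ) : WBound S S (logNorm S φ).toReal (heatPath φ) := by
  rw [← logNorm_le_iff ENNReal.toReal_nonneg, ENNReal.ofReal_toReal h.2.ne]

/-- The constant that bounds the weighted norm of the heat flow up to time `T`. -/
def extConst (S T : ℝ) : ℝ := ratio T S + 2 * √T / weight S (S / 2)

theorem extConst_pos (hS : 0 < S) : 0 < extConst S T := by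
  have hw := weight_pos (half_pos hS) (half_le_self hS.le)
  have := one_le_ratio (S := T) (T := S)
  unfold extConst
  positivity

theorem WBound.extend (hS : 0 < S) (hT : 0 < T) (hc : 0 ≤ c) (h : WBound S S c (heatPath φ)) :
    ∀ t ∈ Ioc 0 T, ∀ x, weight T t * ‖heat t φ x‖ ≤ extConst S T * c := by
  intro t ht x
  have hw := weight_pos (half_pos hS) (half_le_self hS.le)
  have hr := one_le_ratio (S := T) (T := S)
  unfold extConst
  rcases lt_or_ge t S with h1 | h1
  · have h2 := weight_le_ratio (S := T) (T := S) ht.1 ht.2 h1.le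
    calc weight T t * ‖heat t φ x‖ ≤ ratio T S * (weight S t * ‖heat t φ x‖) := by
          rw [← mul_assoc]; gcongr
      _ ≤ ratio T S * c := by gcongr; exact h t ⟨ht.1, h1⟩ x
      _ ≤ _ := by
          have : 0 ≤ 2 * √T / weight S (S / 2) := by positivity
          nlinarith
  · calc weight T t * ‖heat t φ x‖ ≤ 2 * √T * (c / weight S (S / 2)) := by
          refine mul_le_mul (weight_le hT ht.1 ht.2) (norm_heat_le_of_half hS h (by linarith) x)
            (norm_nonneg _) (by positivity)
      _ = 2 * √T / weight S (S / 2) * c := by ring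
      _ ≤ _ := by nlinarith

theorem wBound_extend (hS : 0 < S) (hT : 0 < T) (hc : 0 ≤ c) (h : WBound S S c (heatPath φ)) :
    WBound T T (extConst S T * c) (heatPath φ) :=
  fun t ht x => WBound.extend hS hT hc h t ⟨ht.1, ht.2.le⟩ x

/-- A smaller reference time gives a smaller weight, so smallness on `(0,T)` measured with `S`
persists with `T`. -/
theorem wBound_shrink (hTS : T ≤ S) {u : ℝ → Vec N → Vec N} (h : WBound S T c u) :
    WBound T T c u :=
  fun t ht x => (mul_le_mul_of_nonneg_right (weight_le_weight ht.1 ht.2.le hTS)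
    (norm_nonneg _)).trans (h t ht x)

theorem wBound_of_rep (hS : 0 < S) (hf : IsBoundedRep φ f) (hM : ∀ᵐ x, ‖f x‖ ≤ M) :
    WBound S S (2 * √S * M) (heatPath φ) := by
  intro t ht x
  rw [heatPath, heat_rep ht.1 hf]
  exact mul_le_mul (weight_le hS ht.1 ht.2.le) (norm_hs_le ht.1 hM x) (norm_nonneg _)
    (by positivity)

theorem memC_of_rep (hS : 0 < S) (hf : IsBoundedRep φ f) (hM : ∀ x, ‖f x‖ ≤ M)
    (huc : UniformContinuous f) : MemC S φ := by
  have hM0 : 0 ≤ M := (norm_nonneg _).trans (hM 0)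
  refine ⟨memB_of_wBound hS (by positivity) (wBound_of_rep hS hf (Eventually.of_forall hM)),
    fun ε hε => ⟨f, φ, huc, ⟨M, hM⟩, hf, ?_⟩⟩
  have : logNorm S (φ - φ) ≤ ENNReal.ofReal 0 := by
    rw [logNorm_le_iff le_rfl]
    intro t _ x
    rw [heatPath, heat_sub, sub_self, norm_zero, mul_zero]
  rw [ENNReal.ofReal_zero] at this
  exact this.trans_lt hε

theorem MemC.exists_approx (h : MemC S φ) {ε : ℝ} (hε : 0 < ε) :
    ∃ (g : Vec N → Vec N) (γ : TDist N) (M : ℝ), UniformContinuous g ∧ (∀ x, ‖g x‖ ≤ M) ∧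
      IsBoundedRep γ g ∧ WBound S S ε (heatPath (φ - γ)) := by
  obtain ⟨g, γ, h1, ⟨M, h2⟩, h3, h4⟩ := h.2 (ENNReal.ofReal ε) (by simpa using hε)
  exact ⟨g, γ, M, h1, h2, h3, (logNorm_le_iff hε.le).mp h4.le⟩

theorem MemB.exists_heat_bound (hS : 0 < S) (h : MemB S φ) (ht : 0 < t) :
    ∃ M, ∀ x, ‖heat t φ x‖ ≤ M := NSLog.exists_heat_bound hS h.wBound ht

theorem hs_heat (hS : 0 < S) (h : MemB S φ) (hs' : 0 < s) (ht : 0 < t) (x : Vec N) :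
    hs s (heat t φ) x = heat (s + t) φ x := by
  obtain ⟨M, hM⟩ := h.exists_heat_bound hS ht
  exact heat_heat hs' ht (Eventually.of_forall hM) x

theorem wBound_heat_shift (hS : 0 < S) (hφ : MemB S φ) (h : WBound S S c (heatPath φ))
    (ht : 0 < t) : WBound S S c (fun s => heat (s + t) φ) := by
  intro s hs' x
  dsimp only
  rw [add_comm, ← hs_heat hS hφ ht hs'.1]
  have hw := weight_pos hs'.1 hs'.2.le
  have := norm_hs_le (f := heat s φ) ht (Eventually.of_forall fun y => h.norm_le le_rfl hs' y) x
  calc weight S s * ‖hs t (heat s φ) x‖ ≤ weight S s * (c * (weight S s)⁻¹) := by gcongr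
    _ = c := by field_simp

/-- Strong continuity of the heat semigroup at zero, by an `ε/3` argument. The error `φ - γ` costs
`ε/3` twice because the semigroup is a contraction; for `γ` the difference is the heat flow of
`e^{tΔ} g - g`, which is uniformly small. -/
theorem MemC.tendsto_shift (hS : 0 < S) (hφ : MemC S φ) {ε : ℝ} (hε : 0 < ε) :
    ∃ δ > 0, ∀ t ∈ Ioo 0 δ, WBound S S ε (fun s x => heat (s + t) φ x - heat s φ x) := by
  obtain ⟨g, γ, M, hg, hM, hγ, hb⟩ := hφ.exists_approx (ε := ε / 3) (by positivity)
  have hsq : 0 < √S := Real.sqrt_pos.mpr hS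
  obtain ⟨δ, hδ, h⟩ := hs_tendsto_of_uniformContinuous hg hM
    (by positivity : 0 < ε / (6 * √S))
  have hγB : MemB S γ := (memC_of_rep hS hγ hM hg).1
  refine ⟨δ, hδ, fun t ht s hs' x => ?_⟩
  have hw := weight_nonneg (T := S) (t := s)
  have hB : MemB S (φ - γ) := memB_of_wBound hS (by positivity) hb
  have h1 := hb s hs' x
  have h2 := wBound_heat_shift hS hB hb ht.1 s hs' x
  have h3 : weight S s * ‖heat (s + t) γ x - heat s γ x‖ ≤ ε / 3 := by
    have e : heat (s + t) γ x - heat s γ x = hs s (fun y => hs t g y - g y) x := by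
      have e1 : heat t γ = hs t g := funext (heat_rep ht.1 hγ)
      rw [← hs_heat hS hγB hs'.1 ht.1, heat_rep hs'.1 hγ, e1]
      exact (hs_sub hs'.1 (e1 ▸ (continuous_heat γ).aestronglyMeasurable)
        (Eventually.of_forall fun y => norm_hs_le ht.1 (Eventually.of_forall hM) y)
        hγ.1.1 (Eventually.of_forall hM) x).symm
    rw [e]
    calc _ ≤ 2 * √S * (ε / (6 * √S)) := mul_le_mul (weight_le hS hs'.1 hs'.2.le)
          (norm_hs_le hs'.1 (Eventually.of_forall (h t ht)) x) (norm_nonneg _) (by positivity)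
      _ = ε / 3 := by field_simp; norm_num
  have e : heat (s + t) φ x - heat s φ x = heat (s + t) (φ - γ) x - heatPath (φ - γ) s x +
      (heat (s + t) γ x - heat s γ x) := by
    rw [heatPath, heat_sub, heat_sub]; abel
  dsimp only at h2 ⊢
  rw [e]
  have h4 := norm_add_le (heat (s + t) (φ - γ) x - heatPath (φ - γ) s x)
    (heat (s + t) γ x - heat s γ x)
  have h5 := norm_sub_le (heat (s + t) (φ - γ) x) (heatPath (φ - γ) s x)
  calc _ ≤ weight S s * (‖heat (s + t) (φ - γ) x‖ + ‖heatPath (φ - γ) s x‖ +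
        ‖heat (s + t) γ x - heat s γ x‖) := by gcongr; linarith
    _ ≤ ε := by rw [mul_add, mul_add]; linarith

/-- For the bounded approximant the weight alone tends to zero, and the error is small in norm. This
is where local existence for large data draws its smallness from. -/
theorem MemC.wBound_small (hS : 0 < S) (hφ : MemC S φ) {ε : ℝ} (hε : 0 < ε) :
    ∃ δ > 0, δ ≤ S ∧ WBound S δ ε (heatPath φ) := by
  obtain ⟨g, γ, M, hg, hM, hγ, hb⟩ := hφ.exists_approx (ε := ε / 2) (by positivity)
  have hM0 : 0 ≤ M := (norm_nonneg _).trans (hM 0)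
  have h1 := (tendsto_weight_zero hS).eventually_lt_const
    (by positivity : 0 < ε / (2 * (M + 1)))
  obtain ⟨δ, hδ, h2⟩ := mem_nhdsGT_iff_exists_Ioo_subset.mp h1
  refine ⟨min δ S, lt_min hδ hS, min_le_right _ _, fun t ht x => ?_⟩
  have ht1 : t ∈ Ioo 0 δ := ⟨ht.1, ht.2.trans_le (min_le_left _ _)⟩
  have ht2 : t ∈ Ioo 0 S := ⟨ht.1, ht.2.trans_le (min_le_right _ _)⟩
  have h3 : weight S t < ε / (2 * (M + 1)) := h2 ht1
  have h4 := hb t ht2 x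
  have h5 : ‖heat t γ x‖ ≤ M := by
    rw [heat_rep ht.1 hγ]; exact norm_hs_le ht.1 (Eventually.of_forall hM) x
  have hw := weight_nonneg (T := S) (t := t)
  rw [heatPath, heat_sub] at h4
  have h6 := norm_le_norm_sub_add (heat t φ x) (heat t γ x)
  have h7 : weight S t * (M + 1) ≤ ε / 2 := by
    calc _ ≤ ε / (2 * (M + 1)) * (M + 1) := by gcongr
      _ = _ := by field_simp
  have h8 : weight S t * ‖heat t φ x‖ ≤ weight S t * (‖heat t φ x - heat t γ x‖ + M) := by
    gcongr; linarith
  dsimp only [heatPath]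
  nlinarith

theorem MemC.wBound_small' (hS : 0 < S) (hT : 0 < T) (hφ : MemC S φ) {ε : ℝ} (hε : 0 < ε) :
    ∃ δ > 0, δ ≤ T ∧ WBound T δ ε (heatPath φ) := by
  have hr : 0 < ratio T S := one_pos.trans_le one_le_ratio
  obtain ⟨δ, hδ, hδS, h⟩ := hφ.wBound_small hS (ε := ε / ratio T S) (by positivity)
  refine ⟨min δ T, lt_min hδ hT, min_le_right _ _, fun t ht x => ?_⟩
  have h1 := h t ⟨ht.1, ht.2.trans_le (min_le_left _ _)⟩ x
  have h2 := weight_le_ratio (S := T) (T := S) ht.1 (ht.2.le.trans (min_le_right _ _))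
    (ht.2.le.trans ((min_le_left _ _).trans hδS))
  rw [le_div_iff₀ hr] at h1
  nlinarith [norm_nonneg (heatPath φ t x)]

theorem heat_continuous_time (hS : 0 < S) (hφ : MemB S φ) {t₀ : ℝ} (ht₀ : 0 < t₀) {ε : ℝ}
    (hε : 0 < ε) : ∃ δ > 0, ∀ t, 0 < t → |t - t₀| < δ → ∀ x, ‖heat t φ x - heat t₀ φ x‖ ≤ ε := by
  obtain ⟨M, hM⟩ := hφ.exists_heat_bound hS (half_pos ht₀)
  have hM0 : 0 ≤ M := (norm_nonneg _).trans (hM 0)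
  have h1 := (tendsto_gk_time (N := N) (half_pos ht₀)).mul_const M
  rw [zero_mul] at h1
  obtain ⟨δ, hδ, h2⟩ := Metric.eventually_nhds_iff.mp (h1.eventually_lt_const hε)
  refine ⟨min δ (t₀ / 2), lt_min hδ (half_pos ht₀), fun t _ htt x => ?_⟩
  have h3 := htt.trans_le (min_le_right _ _)
  rw [abs_lt] at h3
  have ht2 : 0 < t - t₀ / 2 := by linarith
  have e1 := hs_heat hS hφ ht2 (half_pos ht₀) x
  have e2 := hs_heat hS hφ (half_pos ht₀) (half_pos ht₀) x
  rw [sub_add_cancel] at e1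
  rw [add_halves] at e2
  rw [← e1, ← e2]
  refine (norm_hs_sub_hs_le ht2 (half_pos ht₀) (continuous_heat φ).aestronglyMeasurable
    (Eventually.of_forall hM) x).trans (h2 (y := t - t₀ / 2) ?_).le
  rw [Real.dist_eq, sub_sub, add_halves]
  exact htt.trans_le (min_le_left _ _)

theorem uniformContinuous_heat (hS : 0 < S) (hφ : MemB S φ) (ht : 0 < t) :
    UniformContinuous (heat t φ) := by
  obtain ⟨M, hM⟩ := hφ.exists_heat_bound hS (half_pos ht)
  have h := uniformContinuous_hs (half_pos ht) (continuous_heat (t := t / 2) φ).aestronglyMeasurable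
    (Eventually.of_forall hM)
  have e : hs (t / 2) (heat (t / 2) φ) = heat t φ := by
    funext x; rw [hs_heat hS hφ (half_pos ht) (half_pos ht), add_halves]
  rwa [e] at h

/-- Restarting at time `1/(n+1)` gives a convolution of a fixed function, jointly measurable in time
and space. At each point the approximations are eventually constant. -/
theorem measPath_heatPath (hS : 0 < S) (hφ : MemB S φ) : MeasPath (heatPath φ) := by
  refine measurable_of_tendsto_metrizable (f := fun (n : ℕ) (p : ℝ × Vec N) =>
    if p.1 ∈ Ioi (1 / ((n : ℝ) + 1)) then
      hs (p.1 - 1 / ((n : ℝ) + 1)) (heat (1 / ((n : ℝ) + 1)) φ) p.2 else 0) (fun n => ?_) ?_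
  · refine Measurable.ite (measurable_fst measurableSet_Ioi) ?_ measurable_const
    exact (stronglyMeasurable_hs (continuous_heat φ).aestronglyMeasurable).measurable.comp
      (g := fun p : ℝ × Vec N => hs p.1 _ p.2) (f := fun p : ℝ × Vec N =>
        (p.1 - 1 / ((n : ℝ) + 1), p.2)) (by fun_prop)
  · rw [tendsto_pi_nhds]
    intro p
    rcases lt_or_ge 0 p.1 with h | h
    · refine tendsto_const_nhds.congr' ?_
      filter_upwards [tendsto_one_div_add_atTop_nhds_zero_nat.eventually_lt_const h] with n hn
      rw [if_pos (show p.1 ∈ Ioi _ from hn), hs_heat hS hφ (sub_pos.mpr hn) (by positivity),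
        sub_add_cancel, heatPath]
    · refine tendsto_const_nhds.congr fun n => ?_
      have : (0 : ℝ) < 1 / ((n : ℝ) + 1) := by positivity
      rw [if_neg (show p.1 ∉ Ioi _ from fun hc => by have : _ < p.1 := hc; linarith), heatPath, heat,
        dif_neg h.not_gt]

end Heat


/-! ### Solutions in the solution class are classical paths -/

section Classical

variable {N : ℕ} {S T t A c : ℝ} {u₀ φ : TDist N} {U : ℝ → TDist N} {u v : ℝ → Vec N → Vec N}
  {f : Vec N → Vec N}

theorem ofReal_mul_linftyNorm_le_iff (hf : IsBoundedRep φ f) {w : ℝ} (hw : 0 < w) (hc : 0 ≤ c) :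
    ENNReal.ofReal w * linftyNorm φ ≤ ENNReal.ofReal c ↔ ∀ᵐ x, w * ‖f x‖ ≤ c := by
  rw [linftyNorm_eq hf, ofReal_mul_eLpNorm_le_iff hw hc]

theorem forall_mul_norm_le_of_ae (hf : Continuous f) {w : ℝ} (hw : 0 < w)
    (h : ∀ᵐ x, w * ‖f x‖ ≤ c) (x : Vec N) : w * ‖f x‖ ≤ c := by
  have h1 : ∀ᵐ x, ‖f x‖ ≤ c / w := by
    filter_upwards [h] with y hy
    rwa [le_div_iff₀ hw, mul_comm]
  have := forall_norm_le_of_ae hf h1 x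
  rwa [le_div_iff₀ hw, mul_comm] at this

theorem duh_sqField_congr_ae (h : ∀ᵐ τ, τ ∈ Ioo 0 T → u τ =ᵐ[volume] v τ) (ht : t ≤ T)
    (x : Vec N) : duh (sqField u) t t x = duh (sqField v) t t x := by
  refine setIntegral_congr_ae measurableSet_Ioo ?_
  filter_upwards [h] with τ hτ hτt
  refine heatLerayDiv_congr ?_ x
  filter_upwards [hτ ⟨hτt.1, hτt.2.trans_le ht⟩] with y hy
  ext j k
  change u τ y j * u τ y k = v τ y j * v τ y k
  rw [hy]

/-- A truncated Borel version of a measurable path that obeys the weighted bound almost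
everywhere. -/
theorem exists_measPath_version
    (hu : AEStronglyMeasurable (fun p : ℝ × Vec N => u p.1 p.2)
      ((volume.restrict (Ioo (0 : ℝ) T)).prod volume)) (hA : 0 ≤ A)
    (hb : ∀ t ∈ Ioo 0 T, ∀ᵐ x, weight T t * ‖u t x‖ ≤ A) :
    ∃ v, MeasPath v ∧ WBound T T A v ∧ ∀ᵐ τ, τ ∈ Ioo 0 T → u τ =ᵐ[volume] v τ := by
  have hm : Measurable (hu.mk _) := hu.stronglyMeasurable_mk.measurable
  set m := hu.mk _ with hmdef
  classical
  -- The bound on `u` holds only almost everywhere; cutting off at level `A` makes it pointwise and,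
  -- for almost every time, alters `m` only on a null set.
  refine ⟨fun t x => if weight T t * ‖m (t, x)‖ ≤ A then m (t, x) else 0, ?_, ?_, ?_⟩
  · refine Measurable.ite (measurableSet_le ?_ measurable_const) hm measurable_const
    exact (measurable_weight.comp measurable_fst).mul hm.norm
  · intro τ _ x
    dsimp only
    split_ifs with h
    · exact h
    · rwa [norm_zero, mul_zero]
  · have h1 := Measure.ae_ae_of_ae_prod hu.ae_eq_mk
    rw [ae_restrict_iff' measurableSet_Ioo] at h1
    filter_upwards [h1] with τ h2 hτ
    filter_upwards [h2 hτ, hb τ hτ] with x h3 h4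
    have h5 : m (τ, x) = u τ x := h3.symm
    rw [h5, if_pos h4]

/-- The representative in `IsMild` is arbitrary up to null sets. Inserting a truncated Borel version
into the right-hand side of the equation gives a continuous representative at each time; it agrees
almost everywhere with what was inserted, hence has the same Duhamel term and solves the equation
pointwise. -/
theorem IsSolution.exists_solves (hS : 0 < S) (hT : 0 < T) (h₀ : MemB S u₀)
    (h : IsSolution S T u₀ U) :
    ∃ v A, MeasPath v ∧ Solves T (heatPath u₀) v ∧ WBound T T A v ∧
      (∀ t ∈ Ioc 0 T, IsBoundedRep (U t) (v t)) ∧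
      ∀ ε > 0, ∃ t > 0, t ≤ T ∧ WBound T t ε v := by
  obtain ⟨hcl, -, u, hum, hur, hueq⟩ := h
  set A := (pathNorm T U).toReal with hA
  have hA0 : 0 ≤ A := ENNReal.toReal_nonneg
  have hub : ∀ t ∈ Ioo 0 T, ∀ᵐ x, weight T t * ‖u t x‖ ≤ A := fun t ht => by
    rw [← ofReal_mul_linftyNorm_le_iff (hur t ht) (weight_pos ht.1 ht.2.le) hA0, hA,
      ENNReal.ofReal_toReal hcl.bounded.ne]
    exact le_iSup₂ (f := fun t (_ : t ∈ Ioo (0 : ℝ) T) =>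
      ENNReal.ofReal (weight T t) * linftyNorm (U t)) t ht
  obtain ⟨w, hwm, hwb, hwu⟩ := exists_measPath_version hum hA0 hub
  set v : ℝ → Vec N → Vec N := fun t x => heatPath u₀ t x - duh (sqField w) t t x with hv
  have hvr : ∀ t ∈ Ioc 0 T, IsBoundedRep (U t) (v t) := fun t ht => by
    have e : v t = fun x => heat t u₀ x - duhamel u u t x := funext fun x => by
      rw [duhamel_eq_duh, duh_sqField_congr_ae hwu ht.2]; rfl
    rw [e]; exact hueq t ht
  have hvw : ∀ᵐ τ, τ ∈ Ioo 0 T → v τ =ᵐ[volume] w τ := by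
    filter_upwards [hwu] with τ h1 hτ
    exact ((hvr τ ⟨hτ.1, hτ.2.le⟩).ae_eq (hur τ hτ)).trans (h1 hτ)
  have hvc : ∀ t ∈ Ioc 0 T, Continuous (v t) := fun t ht =>
    (continuous_heat u₀).sub (uniformContinuous_duh hwm.sqField
      ((hwb.mono ht.2 le_rfl).sqField ht.2) (mul_nonneg hA0 hA0) ht.1 ht.2).continuous
  have hvb : ∀ t ∈ Ioo 0 T, ∀ c, 0 ≤ c →
      ENNReal.ofReal (weight T t) * linftyNorm (U t) ≤ ENNReal.ofReal c →
      ∀ x, weight T t * ‖v t x‖ ≤ c := fun t ht c hc h x => by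
    have ht' : t ∈ Ioc 0 T := ⟨ht.1, ht.2.le⟩
    have hw := weight_pos ht.1 ht.2.le
    exact forall_mul_norm_le_of_ae (hvc t ht') hw
      ((ofReal_mul_linftyNorm_le_iff (hvr t ht') hw hc).mp h) x
  refine ⟨v, A, (measPath_heatPath hS h₀).sub hwm.duh, fun t ht x => ?_, fun t ht => ?_, hvr,
    fun ε hε => ?_⟩
  · rw [duh_sqField_congr_ae hvw ht.2]
  · refine hvb t ht A hA0 ?_
    rw [hA, ENNReal.ofReal_toReal hcl.bounded.ne]
    exact le_iSup₂ (f := fun t (_ : t ∈ Ioo (0 : ℝ) T) =>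
      ENNReal.ofReal (weight T t) * linftyNorm (U t)) t ht
  · have h1 := ENNReal.tendsto_nhds_zero.mp hcl.tendsto_zero (ENNReal.ofReal ε) (by simpa using hε)
    obtain ⟨δ, hδ, h2⟩ := mem_nhdsGT_iff_exists_Ioo_subset.mp h1
    refine ⟨min δ T, lt_min hδ hT, min_le_right _ _, fun t ht => ?_⟩
    exact hvb t ⟨ht.1, ht.2.trans_le (min_le_right _ _)⟩ ε hε.le
      (h2 ⟨ht.1, ht.2.trans_le (min_le_left _ _)⟩)

theorem IsSolution.eqOn (hS : 0 < S) (hT : 0 < T) (h₀ : MemB S u₀) {V : ℝ → TDist N}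
    (hU : IsSolution S T u₀ U) (hV : IsSolution S T u₀ V) : EqOn U V (Icc 0 T) := by
  obtain ⟨u, A, hum, hus, hub, hur, hu0⟩ := hU.exists_solves hS hT h₀
  obtain ⟨v, B, hvm, hvs, hvb, hvr, hv0⟩ := hV.exists_solves hS hT h₀
  have h := Solves.unique hT hum hvm hus hvs (hub.mono le_rfl (le_max_left A B))
    (hvb.mono le_rfl (le_max_right A B)) fun ε hε => by
      obtain ⟨t₁, h1, -, h2⟩ := hu0 ε hε
      obtain ⟨t₂, h3, -, h4⟩ := hv0 ε hε
      exact ⟨min t₁ t₂, lt_min h1 h3, h2.mono (min_le_left _ _) le_rfl,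
        h4.mono (min_le_right _ _) le_rfl⟩
  intro t ht
  rcases ht.1.eq_or_lt with rfl | h0
  · rw [hU.2.1, hV.2.1]
  · exact (hur t ⟨h0, ht.2⟩).eq_of_ae (hvr t ⟨h0, ht.2⟩)
      (Eventually.of_forall (h t ⟨h0, ht.2⟩))

end Classical


/-! ### Existence, uniqueness and Lipschitz dependence -/

section Existence

variable {N : ℕ} {S T t s B η : ℝ} {φ : TDist N} {u v : ℝ → Vec N → Vec N}

theorem Solves.eq_fun (h : Solves T (heatPath φ) u) (ht : t ∈ Ioc 0 T) :
    u t = fun x => heat t φ x - duh (sqField u) t t x := funext (h t ht)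

theorem hs_solves (hS : 0 < S) (hφ : MemB S φ) (hum : MeasPath u)
    (hu : Solves T (heatPath φ) u) (hub : WBound T T B u) (ht : t ∈ Ioc 0 T) (hs' : 0 < s)
    (x : Vec N) : hs s (u t) x = heat (s + t) φ x - duh (sqField u) (s + t) t x := by
  have hB : 0 ≤ B := hub.nonneg (ht.1.trans_le ht.2)
  obtain ⟨M, hM⟩ := hφ.exists_heat_bound hS ht.1
  have hfb := (hub.mono ht.2 le_rfl).sqField ht.2
  rw [hu.eq_fun ht, hs_sub hs' (continuous_heat φ).aestronglyMeasurable (Eventually.of_forall hM)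
    (measurable_duh hum.sqField t).aestronglyMeasurable
    (Eventually.of_forall (norm_duh_le hfb (mul_nonneg hB hB) ht.1 ht.2 le_rfl)),
    hs_heat hS hφ hs' ht.1, hs_duh hum.sqField hfb (mul_nonneg hB hB) ht.1 ht.2 hs']

/-- A classical solution of the integral equation represents a solution in the solution class. -/
theorem exists_isSolution_of_solves (hS : 0 < S) (hT : 0 < T) (hφ : MemC S φ) (hdiv : DivFree φ)
    (hum : MeasPath u) (hu : Solves T (heatPath φ) u) (hub : WBound T T B u)
    (hsmall : ∀ ε > 0, ∃ t > 0, t ≤ T ∧ WBound T t ε u) : ∃ U, IsSolution S T φ U := by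
  have hB : 0 ≤ B := hub.nonneg hT
  have hBB : 0 ≤ B * B := mul_nonneg hB hB
  have hfb : FieldBound T T (B * B) (sqField u) := hub.sqField le_rfl
  have hduhM : ∀ t ∈ Ioc 0 T, ∀ x, ‖duh (sqField u) t t x‖ ≤
      4 * oseenConst N * (B * B) * (weight T t)⁻¹ := fun t ht =>
    norm_duh_le (hfb.mono ht.2) hBB ht.1 ht.2 le_rfl
  have hduhL : ∀ t ∈ Ioc 0 T, MemLp (duh (sqField u) t t) ∞ volume := fun t ht =>
    memLp_of_bound (measurable_duh hum.sqField t).aestronglyMeasurable (hduhM t ht)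
  have hheatL : ∀ t ∈ Ioc 0 T, MemLp (heat t φ) ∞ volume := fun t ht => hφ.1.1 t ht.1
  have huL : ∀ t ∈ Ioc 0 T, MemLp (u t) ∞ volume := fun t ht => by
    rw [hu.eq_fun ht]; exact (hheatL t ht).sub (hduhL t ht)
  have hΓ : ∀ t ∈ Ioc 0 T, ∃ γ : TDist N, IsBoundedRep γ (u t) := fun t ht =>
    ⟨_, isBoundedRep_ofFun (huL t ht)⟩
  choose! Γ hΓ using hΓ
  classical
  set U : ℝ → TDist N := fun t => if t = 0 then φ else Γ t with hU
  have hU0 : U 0 = φ := if_pos rfl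
  have hUr : ∀ t ∈ Ioc 0 T, IsBoundedRep (U t) (u t) := fun t ht => by
    rw [hU]; dsimp only; rw [if_neg ht.1.ne']; exact hΓ t ht
  have hheat : ∀ t ∈ Ioc 0 T, ∀ s, 0 < s → ∀ x,
      heat s (U t) x = heat (s + t) φ x - duh (sqField u) (s + t) t x := fun t ht s hs' x => by
    rw [heat_rep hs' (hUr t ht), hs_solves hS hφ.1 hum hu hub ht hs']
  have hpos : ∀ t ∈ Icc 0 T, t = 0 ∨ t ∈ Ioc 0 T := fun t ht =>
    ht.1.eq_or_lt.imp Eq.symm fun h => ⟨h, ht.2⟩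
  refine ⟨U, ⟨fun t ht => ?_, fun t₀ ht₀ => ?_, fun t ht => ?_, ?_, ?_⟩, hU0, u,
    hum.aestronglyMeasurable, fun t ht => hUr t ⟨ht.1, ht.2.le⟩, fun t ht => ?_⟩
  · rcases hpos t ht with rfl | ht
    · rwa [hU0]
    obtain ⟨M, hM⟩ := hφ.1.exists_heat_bound hS ht.1
    refine memC_of_rep hS (hUr t ht) (M := M + 4 * oseenConst N * (B * B) * (weight T t)⁻¹)
      (fun x => ?_) ?_
    · rw [hu.eq_fun ht]
      exact (norm_sub_le _ _).trans (add_le_add (hM x) (hduhM t ht x))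
    · rw [hu.eq_fun ht]
      exact (uniformContinuous_heat hS hφ.1 ht.1).sub
        (uniformContinuous_duh hum.sqField (hfb.mono ht.2) hBB ht.1 ht.2)
  · rw [ENNReal.tendsto_nhds_zero]
    intro ε hε
    obtain ⟨r, hr0, hr⟩ := ENNReal.lt_iff_exists_nnreal_btwn.mp hε
    have hr0' : (0 : ℝ) < r := by exact_mod_cast hr0
    -- At `t₀ = 0` continuity comes from `MemC.tendsto_shift` and the smallness of `u` near zero; at
    -- `t₀ > 0` it follows from uniform convergence, which is stronger than the Besov norm.
    suffices h : ∀ᶠ t in 𝓝[Icc 0 T] t₀, WBound S S r (heatPath (U t - U t₀)) by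
      filter_upwards [h] with t ht
      refine le_trans ?_ hr.le
      rw [← ENNReal.ofReal_coe_nnreal]
      exact (logNorm_le_iff r.2).mpr ht
    rcases hpos t₀ ht₀ with rfl | ht₀
    · set K := 4 * ratio S T * oseenConst N with hK
      have hK0 : 0 ≤ K := mul_nonneg (mul_nonneg (by norm_num)
        (zero_le_one.trans one_le_ratio)) (oseenConst_nonneg N)
      -- With `c ≤ 1`, a bound `c` on `u` makes the Duhamel part at most `K c² ≤ K c ≤ r/2`.
      set c := min 1 ((r : ℝ) / (2 * (K + 1))) with hc
      have hc0 : 0 < c := lt_min one_pos (by positivity)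
      have hcK : K * (c * c) ≤ r / 2 := by
        have h1 : c ≤ 1 := min_le_left _ _
        have h2 : (K + 1) * c ≤ r / 2 := by
          calc (K + 1) * c ≤ (K + 1) * ((r : ℝ) / (2 * (K + 1))) := by
                gcongr; exact min_le_right _ _
            _ = r / 2 := by field_simp
        have h3 : c * c ≤ c := by nlinarith
        nlinarith [mul_le_mul_of_nonneg_left h3 hK0]
      obtain ⟨δ₁, hδ₁, hsh⟩ := hφ.tendsto_shift hS (ε := r / 2) (by positivity)
      obtain ⟨δ₂, hδ₂, hδ₂T, hub2⟩ := hsmall c hc0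
      filter_upwards [self_mem_nhdsWithin,
        nhdsWithin_le_nhds (Iio_mem_nhds (lt_min hδ₁ hδ₂))] with t ht htδ s hs' x
      rcases hpos t ht with rfl | ht
      · rw [heatPath, heat_sub, sub_self, norm_zero, mul_zero]; exact hr0'.le
      have h1 := hsh t ⟨ht.1, htδ.trans_le (min_le_left _ _)⟩ s hs' x
      have htδ2 : t ≤ δ₂ := (htδ.trans_le (min_le_right _ _)).le
      have h2 := weight_mul_norm_duh_add_le (S := S) ((hub2.mono htδ2 le_rfl).sqField ht.2)
        (mul_nonneg hc0.le hc0.le) ht.1 ht.2 hs'.1 hs'.2 x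
      rw [heatPath, heat_sub, hU0, hheat t ht s hs'.1, sub_right_comm]
      refine (mul_le_mul_of_nonneg_left (norm_sub_le _ _) weight_nonneg).trans ?_
      rw [mul_add]
      dsimp only at h1
      linarith
    · have hsq : 0 < √S := Real.sqrt_pos.mpr hS
      have hε' : 0 < (r : ℝ) / (4 * √S) := by positivity
      obtain ⟨δ₁, hδ₁, h1⟩ := heat_continuous_time hS hφ.1 ht₀.1 hε'
      obtain ⟨δ₂, hδ₂, h2⟩ := duh_continuous_time hum.sqField hfb hBB ht₀.1 ht₀.2 hε'
      filter_upwards [self_mem_nhdsWithin,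
        nhdsWithin_le_nhds (Metric.ball_mem_nhds t₀ (lt_min ht₀.1 (lt_min hδ₁ hδ₂)))] with t ht htδ
      rw [Metric.mem_ball, Real.dist_eq, lt_min_iff, lt_min_iff] at htδ
      have ht : t ∈ Ioc 0 T := ⟨by have := (abs_lt.mp htδ.1).1; linarith, ht.2⟩
      have h3 := wBound_of_rep hS ((hUr t ht).sub (hUr t₀ ht₀)) (M := r / (2 * √S))
        (Eventually.of_forall fun x => ?_)
      · exact h3.mono le_rfl (le_of_eq (by field_simp))
      · rw [hu t ht x, hu t₀ ht₀ x, sub_sub_sub_comm]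
        refine (norm_sub_le _ _).trans ((add_le_add (h1 t ht.1 htδ.2.1 x)
          (h2 t ht htδ.2.2 x)).trans (le_of_eq ?_))
        field_simp; norm_num
  · rcases hpos t ht with rfl | ht
    · rwa [hU0]
    have h1 := isBoundedRep_ofFun (hheatL t ht)
    have h2 := isBoundedRep_ofFun (hduhL t ht)
    rw [(hUr t ht).eq_of_ae (h1.sub h2) (Eventually.of_forall (hu t ht))]
    exact (divFree_of_rep_heat ht.1 hdiv h1).sub
      (divFree_of_rep_duh hum.sqField (hfb.mono ht.2) hBB ht.1 ht.2 h2)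
  · refine lt_of_le_of_lt (iSup₂_le fun t ht => ?_) (ENNReal.ofReal_lt_top (r := B))
    exact (ofReal_mul_linftyNorm_le_iff (hUr t ⟨ht.1, ht.2.le⟩) (weight_pos ht.1 ht.2.le) hB).mpr
      (Eventually.of_forall (hub t ht))
  · rw [ENNReal.tendsto_nhds_zero]
    intro ε hε
    obtain ⟨r, hr0, hr⟩ := ENNReal.lt_iff_exists_nnreal_btwn.mp hε
    have hr0' : (0 : ℝ) < r := by exact_mod_cast hr0
    obtain ⟨δ, hδ, hδT, hb⟩ := hsmall r hr0'
    filter_upwards [Ioo_mem_nhdsGT hδ] with t ht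
    refine le_trans ?_ hr.le
    rw [← ENNReal.ofReal_coe_nnreal]
    exact (ofReal_mul_linftyNorm_le_iff (hUr t ⟨ht.1, ht.2.le.trans hδT⟩)
      (weight_pos ht.1 (ht.2.le.trans hδT)) r.2).mpr (Eventually.of_forall (hb t ht))
  · have h := hUr t ht
    rwa [hu.eq_fun ht] at h

/-- The classical solution for data with a small heat flow. -/
theorem exists_small_solves (hS : 0 < S) (hT : 0 < T) (hη : 8 * bilConst N * η ≤ 1)
    (hφ : MemC S φ) (hb : WBound T T η (heatPath φ)) :
    ∃ u, MeasPath u ∧ Solves T (heatPath φ) u ∧ WBound T T (2 * η) u ∧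
      ∀ ε > 0, ∃ t > 0, t ≤ T ∧ WBound T t ε u := by
  have hη0 := hb.nonneg hT
  obtain ⟨u, hum, hu, h⟩ := exists_solves hη hT (measPath_heatPath hS hφ.1) hb
  refine ⟨u, hum, hu, h T η hT le_rfl le_rfl hb, fun ε hε => ?_⟩
  -- For `η = 0` the solution vanishes; otherwise `min η (ε/2)` is positive and can serve as a
  -- target size.
  rcases hη0.eq_or_lt with h0 | h0
  · exact ⟨T, hT, le_rfl, (h T η hT le_rfl le_rfl hb).mono le_rfl (by linarith)⟩
  obtain ⟨t, ht, htT, hbt⟩ := hφ.wBound_small' hS hT (ε := min η (ε / 2))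
    (lt_min h0 (by positivity))
  refine ⟨t, ht, htT, (h t _ ht htT (min_le_left _ _) hbt).mono le_rfl ?_⟩
  linarith [min_le_right η (ε / 2)]

theorem uniquelySolvable_of_wBound (hS : 0 < S) (hT : 0 < T) (hη : 8 * bilConst N * η ≤ 1)
    (hφ : MemC S φ) (hdiv : DivFree φ) (hb : WBound T T η (heatPath φ)) :
    UniquelySolvable S T φ := by
  obtain ⟨u, hum, hu, hub, hsmall⟩ := exists_small_solves hS hT hη hφ hb
  obtain ⟨U, hU⟩ := exists_isSolution_of_solves hS hT hφ hdiv hum hu hub hsmall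
  exact ⟨U, hU, fun V hV => hV.eqOn hS hT hφ.1 hU⟩

/-- By uniqueness every solution in the class is the Picard solution, so it inherits the bound `2η`
although the class itself only demands finiteness. -/
theorem IsSolution.exists_small_solves (hS : 0 < S) (hT : 0 < T) (hη : 8 * bilConst N * η ≤ 1)
    (hφ : MemC S φ) (hb : WBound T T η (heatPath φ)) {U : ℝ → TDist N}
    (hU : IsSolution S T φ U) :
    ∃ u, MeasPath u ∧ Solves T (heatPath φ) u ∧ WBound T T (2 * η) u ∧
      ∀ t ∈ Ioc 0 T, IsBoundedRep (U t) (u t) := by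
  obtain ⟨u, hum, hu, hub, hu0⟩ := NSLog.exists_small_solves hS hT hη hφ hb
  obtain ⟨v, A, hvm, hv, hvb, hvr, hv0⟩ := hU.exists_solves hS hT hφ.1
  have h := Solves.unique hT hum hvm hu hv (hub.mono le_rfl (le_max_left _ A))
    (hvb.mono le_rfl (le_max_right (2 * η) A)) fun ε hε => by
      obtain ⟨t₁, h1, -, h2⟩ := hu0 ε hε
      obtain ⟨t₂, h3, -, h4⟩ := hv0 ε hε
      exact ⟨min t₁ t₂, lt_min h1 h3, h2.mono (min_le_left _ _) le_rfl,
        h4.mono (min_le_right _ _) le_rfl⟩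
  refine ⟨u, hum, hu, hub, fun t ht => ?_⟩
  rw [show u t = v t from funext (h t ht)]
  exact hvr t ht

theorem MemB.logNorm_sub_ne_top (hS : 0 < S) {γ : TDist N} (hφ : MemB S φ) (hγ : MemB S γ) :
    logNorm S (φ - γ) ≠ ∞ :=
  (memB_of_wBound hS (add_nonneg ENNReal.toReal_nonneg ENNReal.toReal_nonneg)
    (hφ.wBound.heatPath_sub hγ.wBound)).2.ne

/-- The three summands of the constant are the contraction of the Besov norm under the heat flow,
the Duhamel difference with both solutions bounded by `2η`, and the weighted norm of the difference.
The last two rest on `Solves.stability`, which bounds the difference by `2 extConst` times the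
distance of the data. -/
theorem IsSolution.solNorm_sub_le (hS : 0 < S) (hT : 0 < T) (hη : 8 * bilConst N * η ≤ 1)
    {γ : TDist N} (hφ : MemC S φ) (hγ : MemC S γ) (hφb : WBound T T η (heatPath φ))
    (hγb : WBound T T η (heatPath γ)) {V W : ℝ → TDist N} (hV : IsSolution S T φ V)
    (hW : IsSolution S T γ W) :
    solNorm S T (fun t => V t - W t) ≤
      ENNReal.ofReal (1 + 4 * ratio S T * oseenConst N * ((2 * η + 2 * η) * (2 * extConst S T)) +
        2 * extConst S T) * logNorm S (φ - γ) := by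
  have hη0 := hφb.nonneg hT
  have hr : 0 ≤ ratio S T := zero_le_one.trans one_le_ratio
  have hO := oseenConst_nonneg N
  have hE := (extConst_pos (S := S) (T := T) hS).le
  obtain ⟨v, hvm, hv, hvb, hvr⟩ := hV.exists_small_solves hS hT hη hφ hφb
  obtain ⟨w, hwm, hw, hwb, hwr⟩ := hW.exists_small_solves hS hT hη hγ hγb
  have htop := hφ.1.logNorm_sub_ne_top hS hγ.1
  set d := (logNorm S (φ - γ)).toReal with hd
  have hd0 : 0 ≤ d := ENNReal.toReal_nonneg
  have hde : logNorm S (φ - γ) = ENNReal.ofReal d := (ENNReal.ofReal_toReal htop).symm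
  have hlog : WBound S S d (heatPath (φ - γ)) := (logNorm_le_iff hd0).mp hde.le
  have hB : MemB S (φ - γ) := memB_of_wBound hS hd0 hlog
  have hdiff : WBound T T (2 * (extConst S T * d)) (fun τ x => v τ x - w τ x) := by
    refine Solves.stability hvm hwm hv hw hT le_rfl hvb hwb (by linarith) fun t ht x => ?_
    have := wBound_extend hS hT hd0 hlog t ht x
    rwa [heatPath, heat_sub] at this
  have hM : 0 ≤ (2 * η + 2 * η) * (2 * (extConst S T * d)) := by positivity
  rw [hde, ← ENNReal.ofReal_mul (by positivity), add_mul,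
    ENNReal.ofReal_add (by positivity) (by positivity)]
  refine add_le_add (iSup₂_le fun t ht => ?_) (iSup₂_le fun t ht => ?_)
  · rw [logNorm_le_iff (by positivity)]
    rcases ht.1.eq_or_lt with rfl | h0
    · dsimp only
      rw [hV.2.1, hW.2.1]
      refine hlog.mono le_rfl ?_
      have : 0 ≤ 4 * ratio S T * oseenConst N * ((2 * η + 2 * η) * (2 * extConst S T)) := by
        positivity
      nlinarith
    have ht' : t ∈ Ioc 0 T := ⟨h0, ht.2⟩
    intro s hs' x
    have e : heatPath (V t - W t) s x = heat (s + t) (φ - γ) x -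
        duh (fun τ y => sqField v τ y - sqField w τ y) (s + t) t x := by
      have h4 : 0 ≤ 2 * η * (2 * η) := by positivity
      rw [heatPath, heat_sub, heat_rep hs'.1 (hvr t ht'), heat_rep hs'.1 (hwr t ht'),
        hs_solves hS hφ.1 hvm hv hvb ht' hs'.1, hs_solves hS hγ.1 hwm hw hwb ht' hs'.1,
        ← duh_sub hvm.sqField ((hvb.mono ht.2 le_rfl).sqField ht.2) h4 hwm.sqField
          ((hwb.mono ht.2 le_rfl).sqField ht.2) h4 h0 ht.2 (by linarith [hs'.1]), heat_sub]
      abel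
    have h1 := wBound_heat_shift hS hB hlog h0 s hs' x
    have h2 := weight_mul_norm_duh_add_le (S := S) ((hvb.mono ht.2 le_rfl).sqField_sub
      (hwb.mono ht.2 le_rfl) (hdiff.mono ht.2 le_rfl) ht.2) hM h0 ht.2 hs'.1 hs'.2 x
    rw [e]
    refine (mul_le_mul_of_nonneg_left (norm_sub_le _ _) weight_nonneg).trans ?_
    rw [mul_add]
    dsimp only at h1
    refine (add_le_add h1 h2).trans (le_of_eq ?_)
    ring
  · rw [ofReal_mul_linftyNorm_le_iff ((hvr t ⟨ht.1, ht.2.le⟩).sub (hwr t ⟨ht.1, ht.2.le⟩))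
      (weight_pos ht.1 ht.2.le) (by positivity), mul_assoc]
    exact Eventually.of_forall (hdiff t ht)

theorem lipschitzSolvableOn_of_wBound (hS : 0 < S) (hT : 0 < T) (hη : 8 * bilConst N * η ≤ 1)
    {A : Set (TDist N)}
    (hA : ∀ v ∈ A, MemC S v ∧ DivFree v ∧ WBound T T η (heatPath v)) :
    LipschitzSolvableOn S T A :=
  ⟨fun v hv => uniquelySolvable_of_wBound hS hT hη (hA v hv).1 (hA v hv).2.1 (hA v hv).2.2,
    Real.toNNReal _, fun v hv w hw _ _ hV hW =>
      hV.solNorm_sub_le hS hT hη (hA v hv).1 (hA w hw).1 (hA v hv).2.2 (hA w hw).2.2 hW⟩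

theorem wBound_of_mem_dataBall {φ₀ : TDist N} {ε : ℝ} (hε : 0 < ε) (h : φ ∈ dataBall S φ₀ ε) :
    WBound S S ε (heatPath (φ - φ₀)) := (logNorm_le_iff hε.le).mp h.2.2

/-- The time is chosen so that the weighted heat flow of `φ` is at most `η/2`; a perturbation of
size `η/2` then stays below the threshold `η`, both around `0` and around `φ`. -/
theorem local_wellPosedness (hS : 0 < S) (hφ : MemC S φ) (hdiv : DivFree φ) :
    ∃ T : ℝ, 0 < T ∧ UniquelySolvable S T φ ∧ ∃ ε : ℝ, 0 < ε ∧
      LipschitzSolvableOn S T (dataBall (N := N) S 0 ε) ∧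
      LipschitzSolvableOn S T (dataBall S φ ε) := by
  have hp := bilConst_pos (N := N)
  set η : ℝ := 1 / (8 * bilConst N) with hη
  have hη0 : 0 < η := by positivity
  have hη1 : 8 * bilConst N * η ≤ 1 := le_of_eq (by rw [hη]; field_simp)
  obtain ⟨T, hT, hTS, hb⟩ := hφ.wBound_small hS (half_pos hη0)
  refine ⟨T, hT, uniquelySolvable_of_wBound hS hT hη1 hφ hdiv
    ((wBound_shrink hTS hb).mono le_rfl (half_le_self hη0.le)), η / 2, half_pos hη0,
    lipschitzSolvableOn_of_wBound hS hT hη1 fun v hv => ⟨hv.1, hv.2.1, ?_⟩,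
    lipschitzSolvableOn_of_wBound hS hT hη1 fun v hv => ⟨hv.1, hv.2.1, ?_⟩⟩
  · have h := wBound_of_mem_dataBall (half_pos hη0) hv
    rw [sub_zero] at h
    exact wBound_shrink hTS (h.mono hTS (half_le_self hη0.le))
  · have h := wBound_of_mem_dataBall (half_pos hη0) hv
    -- A datum `v` of the ball is written as `φ - (φ - v)`.
    have h4 := hb.heatPath_sub ((heatPath_neg_sub h).mono hTS le_rfl)
    rw [sub_sub_cancel, add_halves] at h4
    exact wBound_shrink hTS h4

/-- The threshold `η` does not depend on `T`; the time enters the radius only through `extConst S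
T`, the cost of passing from reference time `S` to `T`. -/
theorem semiglobal_wellPosedness (N : ℕ) (hS : 0 < S) (hT : 0 < T) :
    ∃ ε : ℝ, 0 < ε ∧ LipschitzSolvableOn S T (dataBall (N := N) S 0 ε) := by
  have hp := bilConst_pos (N := N)
  set η : ℝ := 1 / (8 * bilConst N) with hη
  have hη0 : 0 < η := by positivity
  have hη1 : 8 * bilConst N * η ≤ 1 := le_of_eq (by rw [hη]; field_simp)
  have hE := extConst_pos (S := S) (T := T) hS
  refine ⟨η / extConst S T, by positivity, lipschitzSolvableOn_of_wBound hS hT hη1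
    fun v hv => ⟨hv.1, hv.2.1, ?_⟩⟩
  have h := wBound_of_mem_dataBall (by positivity) hv
  rw [sub_zero] at h
  exact (wBound_extend hS hT (by positivity) h).mono le_rfl (le_of_eq (by field_simp))

end Existence

end

end NSLog

theorem theorem2p2 (N : ℕ) (hN : 2 ≤ N) (S : ℝ) (hS : 0 < S) :
    (∀ u₀ : NSLog.TDist N, NSLog.MemC S u₀ → NSLog.DivFree u₀ →
      ∃ T : ℝ, 0 < T ∧ NSLog.UniquelySolvable S T u₀ ∧
        ∃ ε : ℝ, 0 < ε ∧
          NSLog.LipschitzSolvableOn S T (NSLog.dataBall (N := N) S 0 ε) ∧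
          NSLog.LipschitzSolvableOn S T (NSLog.dataBall S u₀ ε)) ∧
    (∀ T : ℝ, 0 < T → ∃ ε : ℝ, 0 < ε ∧
      NSLog.LipschitzSolvableOn S T (NSLog.dataBall (N := N) S 0 ε)) :=
  ⟨fun _ h₀ hdiv => NSLog.local_wellPosedness hS h₀ hdiv,
    fun _ hT => NSLog.semiglobal_wellPosedness N hS hT⟩
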